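/- **Setting.** Let $n\ge 3$, $p\in(0,n-2)$, and put $$a=2(n-2-p),\quad b=2+(n-3)(n-2-a),\quad c=a\bigl(1+(n-2)(n-2-a)\bigr),\quad d=\frac{(n-1)\,a\,b}{(n-2)^2+1}.$$ Let $\rho$ be a $C^2$ function on the unit sphere $S^{n-1}\subset\mathbb R^n$ having $0$ as a regular value, with $\Lambda=\{\rho>0\}$ non-empty and connected, let $\lambda=\max(\rho,0)$ (the localization function) and $P\ge 2$ (the localization exponent). On $S^{n-1}$ put $d\chi=\lambda^{2P}d\omega$; for a function $g$ on the cone, $\fint g\,d\chi$ at radius $r$ is the average $\int_\Lambda g(r\omega)\,d\chi(\omega)/\int_\Lambda d\chi$, also written $\langle g\rangle$, and $\tilde g=g-\langle g\rangle$. Let $\Omega_R=\{x:|x|>R,\ x/|x|\in\Lambda\}$, $\vartheta=r\partial_r$, and let $\nabla$, $\nabla^2$, $\Delta_S$ be the gradient, covariant Hessian and Laplace–Beltrami operator of the unit sphere, $\mathring\nabla^2$ the traceless part of $\nabla^2$. The localized Hamiltonian operator is $$H^\lambda[u]=\omega^{-2}\Bigl((n-2)\,\Delta(\omega^2\Delta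 u)+\partial_i\partial_j(\omega^2\,\partial_i\partial_j u)\Bigr),\qquad \omega^2=\lambda^{2P}r^{n-2p}.$$ The shell norm at radius $r$ is $$\|u\|_r^2=\fint \bigl((\vartheta^2u)^2+(\vartheta u)^2+|\nabla\vartheta u|^2+u^2+|\nabla u|^2+|\nabla^2u|^2\bigr)d\chi .$$ **Functionals.** Let $c_2,c_{13}\in\mathbb R$ and $$c_9^2=\tfrac{n^2-3n+3}{(n-1)^2},\quad c_{10}=-\tfrac{n-1}{n^2-3n+3}\bigl(c+(n-2)c_2\bigr),\quad c_{11}^2=\tfrac1{n-1},\quad c_{12}^2=\tfrac{2}{n-1}(1+a+c_2).$$ With $w=(\vartheta+a)u$, define $$\Phi[u]=\tfrac12\fint \Bigl((\vartheta^2u+a\vartheta u-c_2u)^2+c_9^2(\Delta_Su+c_{10}u)^2+c_{11}^2|\mathring\nabla^2u|^2+c_{12}^2|\nabla u|^2+c_{13}^2u^2\Bigr)d\chi,$$ $$M[u]=-\tfrac1{n-1}\fint (\vartheta^2u+a\vartheta u-c_2u)\,r^4H^\lambda[u]\,d\chi,\qquad X[u]=(\vartheta+a)(\vartheta+2a)\Phi[u]+M[u],$$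 $$\Upsilon[u]=\fint \Bigl(-\bigl(\tfrac{2(n-2)}{n-1}\vartheta w+\tfrac{c}{(n-1)a}w\bigr)\Delta_Sw+a(\vartheta w)^2-2c_2\,w\,\vartheta w\Bigr)d\chi,$$ and the dissipation functionals $\Psi_\beta[u]=X[u]-(\vartheta+\beta)\Upsilon[u]$ for $\beta\in\{a,2a\}$. **Conditions on $c_2,c_{13}$.** Put $$d_1=\tfrac ca+(n-2)\beta,\quad c_2^{\min}=\tfrac{d_1^2}{n-1}+a(\beta-a)-b,\quad d_2=(n-2)c_2+\tfrac{c}{2a}(2a-\beta),\quad d_3=(\beta-a)c_2+\tfrac{d_1d_2}{n-1},$$ $$(c_{13}^2)^{\min}=\tfrac{d_2^2}{n-1}+\tfrac{d_3^2}{c_2-c_2^{\min}}-\tfrac{(c+(n-2)c_2)^2}{n^2-3n+3}-c_2^2,$$ $$d_4=\frac{a}{c_2\sqrt{c_2-c_2^{\min}}}+\frac{1}{\sqrt{c_{13}^2-(c_{13}^2)^{\min}}}\Bigl(1+\frac{a\,d_3}{c_2(c_2-c_2^{\min})}\Bigr),\quad d_6=\frac{c_2}{n-1}\Bigl(n-2-\frac{c_2\,c^2}{(n-1)a^2}d_4^2\Bigr).$$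 The pair $(c_2,c_{13})$ is *admissible* if $c_2>0$ and, for both $\beta=a$ and $\beta=2a$: $c_2>c_2^{\min}$, $c_{13}^2>(c_{13}^2)^{\min}$ and $d_6>0$. **Statement.** (i) For every sufficiently large $c_2$, every sufficiently large $c_{13}$ (depending on $c_2$) makes $(c_2,c_{13})$ admissible. Moreover, if $c>0$, the pair given by $$c_2=\max_{\beta\in\{a,2a\}}\Bigl(c_2^{\min}+\frac{c}{n-2}\Bigr),\qquad c_{13}^2=\max_{\beta\in\{a,2a\}}\Bigl((c_{13}^2)^{\min}+4(n-1)^2\Bigl(\frac{c}{(n-2)a}+\frac{(n-2)d_3}{c}\Bigr)^2c_2\Bigr)$$ is admissible. Let now $(c_2,c_{13})$ be admissible. (ii) If $R>0$ and $u$ is $C^4$ at every point $x$ with $|x|>R$, $x/|x|\in\overline\Lambda$, then for $\beta\in\{a,2a\}$, at every radius $r>R$, $$\Psi_\beta[u]=\fint \Bigl(\psi_{\rm ten}[w]+\psi_{\rm sca}[w]+\psi_{\rm bil}[u,w]+\tfrac{c_2}{n-1}A[u]\Bigr)d\chi,$$ where, with $c_{130}=c_{13}^2+\frac{(c+(n-2)c_2)^2}{n^2-3n+3}-c_2(b-c_2)$,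 $$\psi_{\rm ten}[w]=\tfrac1{n-1}\bigl(|\mathring\nabla^2w|^2+2|\nabla\vartheta w|^2+2(c_2+1+a)|\nabla w|^2\bigr),$$ $$\begin{aligned}\psi_{\rm sca}[w]={}&\bigl(\vartheta^2w+\tfrac{n-2}{n-1}\Delta_Sw\bigr)^2+\tfrac{(\Delta_Sw)^2}{n-1}+\tfrac{2d_1}{n-1}\,\vartheta w\,\Delta_Sw+\bigl(c_2+b+a(a-\beta)\bigr)(\vartheta w)^2\\&-\tfrac{2d_2}{n-1}\,w\,\Delta_Sw+2(\beta-a)c_2\,w\,\vartheta w+(c_{130}+c_2b)w^2,\end{aligned}$$ $$\psi_{\rm bil}[u,w]=\tfrac{c_2c}{(n-1)a}\Bigl(\bigl(w-\tfrac a{c_2}\vartheta w\bigr)\Delta_Su-u\,\Delta_Sw\Bigr)+c_{130}\,u\,\vartheta w,$$ $$A[u]=(n-2)(\Delta_Su)^2+|\nabla^2u|^2+2(1+a)|\nabla u|^2-c\,u\,\Delta_Su .$$ For $u$ only in $C^3(\Omega_R)$ with $\|u\|_r$, $\|\vartheta u\|_r$ finite, $\Psi_\beta[u]$ is understood through this formula,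 as in (iii) and (iv). (iii) There are $C_0,\delta>0$, depending only on $n,p,c_2,c_{13}$ (in particular neither on $\lambda$, $\Lambda$, $P$ nor on $R$), such that for all $R>0$, $u\in C^3(\Omega_R)$, $\beta\in\{a,2a\}$ and all $r>R$ at which $\|u\|_r$ and $\|\vartheta u\|_r$ are finite, $$C_0\,\Psi_\beta[u]+\fint u^2\,d\chi\ \ge\ \delta\bigl(\|\vartheta u\|_r^2+\|u\|_r^2\bigr).$$ (iv) Let $\nu$ be a normalized element of the kernel of the harmonic operator on $\Lambda$: a function of the angle, $C^4$ in $\Lambda$, with $\fint (\nu^2+|\nabla\nu|^2+|\nabla^2\nu|^2)d\chi<\infty$, $H^\lambda[\nu r^{-a}]=0$ and $\langle\Delta_S\nu-d\,\nu\rangle=\frac{4\,|S^{n-1}|}{((n-2)^2+1)\int d\chi}$. Define the fluctuation operator $$\begin{aligned}K[\tilde u]={}&(n-1)\fint \tilde\nu\,\bigl(\vartheta^2w+a\,\vartheta w-b\,w\bigr)^{\sim}d\chi+\fint \bigl(-2\nabla w\cdot\nabla\nu+(n-2)(\tilde\nu\,\Delta_Sw+\tilde w\,\widetilde{\Delta_S\nu})\bigr)d\chi\\&+\bigl((n-2)(n-2-a)+1\bigr)\fint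 \bigl(\tilde u\,\widetilde{\Delta_S\nu}-\tilde\nu\,\Delta_Su\bigr)d\chi .\end{aligned}$$ There are $C,\varepsilon,\delta>0$, depending only on $n,p,c_2,c_{13}$, such that the following holds for every localization function, $P$, $R>0$ and $\nu$. Suppose that $\fint \tilde v^2d\chi\le\eta\fint (\Delta_Sv)^2d\chi$ holds with some $\eta<\varepsilon$ for all $v\in C^2(\Lambda)$ with $\fint (v^2+|\nabla v|^2+|\nabla^2v|^2)d\chi<\infty$, or only the weaker inequality $\fint \tilde v^2d\chi\le\eta\fint ((\Delta_Sv)^2+|\nabla v|^2)d\chi$. Suppose also that $g>0$ and that $K[\tilde u]^2\le\kappa^2(\|\vartheta u\|_r^2+\|u\|_r^2)$ for all $u\in C^3(\Omega_R)$ and $r>R$ for which these norms are finite, with $g\kappa^2<\varepsilon$. Then, for all such $u$, $r$ and $\beta\in\{a,2a\}$, $$C\,\Psi_\beta[u]+\langle u\rangle^2-g\,K[\tilde u]^2\ \ge\ \delta\bigl(\|\vartheta u\|_r^2+\|u\|_r^2\bigr).$$ -/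

import Mathlib

open MeasureTheory Metric

noncomputable section

namespace LocHam

/-- Euclidean space `ℝⁿ`. -/
abbrev E (n : ℕ) : Type := EuclideanSpace ℝ (Fin n)

section Operators

variable {n : ℕ}

/-- Partial derivative `∂_i u`. -/
def pd (i : Fin n) (u : E n → ℝ) (x : E n) : ℝ :=
  fderiv ℝ u x (EuclideanSpace.single i 1)

/-- Euclidean Laplacian `∂_i ∂_i u`. -/
def lap (u : E n → ℝ) (x : E n) : ℝ := ∑ i, pd i (pd i u) x

/-- Radial derivative `ϑ u = r ∂_r u = x_i ∂_i u`. -/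
def rad (u : E n → ℝ) (x : E n) : ℝ := fderiv ℝ u x x

/-- Radial derivative `r d/dr` of a function of the radius only. -/
def radR (f : ℝ → ℝ) (r : ℝ) : ℝ := r * deriv f r

/-- Angular derivative `r ∂_i u - (x_i / r) ϑ u`, i.e. the `i`-th Cartesian component of the
gradient on the unit sphere of `ω ↦ u (r ω)`. -/
def angD (i : Fin n) (u : E n → ℝ) (x : E n) : ℝ :=
  ‖x‖ * pd i u x - x i / ‖x‖ * rad u x

/-- Cartesian components of the covariant Hessian, on the unit sphere, of `ω ↦ u (r ω)`. -/
def angHess (i j : Fin n) (u : E n → ℝ) (x : E n) : ℝ :=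
  angD i (angD j u) x + x j / ‖x‖ * angD i u x

/-- Laplace-Beltrami operator of the unit sphere applied to `ω ↦ u (r ω)`. -/
def angLap (u : E n → ℝ) (x : E n) : ℝ := ∑ i, angD i (angD i u) x

/-- Scalar product of two angular gradients. -/
def gradDot (u v : E n → ℝ) (x : E n) : ℝ := ∑ i, angD i u x * angD i v x

/-- Squared norm of the angular gradient. -/
def gradSq (u : E n → ℝ) (x : E n) : ℝ := gradDot u u x

/-- Squared norm of the covariant angular Hessian. -/
def hessSq (u : E n → ℝ) (x : E n) : ℝ := ∑ i, ∑ j, angHess i j u x ^ 2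

/-- Squared norm of the traceless part of the covariant angular Hessian; the metric of the sphere
has Cartesian components `δ_ij - x_i x_j / r²`. -/
def hessTracelessSq (u : E n → ℝ) (x : E n) : ℝ :=
  ∑ i, ∑ j, (angHess i j u x
    - angLap u x / ((n : ℝ) - 1) * ((if i = j then 1 else 0) - x i * x j / ‖x‖ ^ 2)) ^ 2

end Operators

section Constants

variable (n : ℕ) (p : ℝ)

def aH : ℝ := 2 * ((n : ℝ) - 2 - p)

def bH : ℝ := 2 + ((n : ℝ) - 3) * ((n : ℝ) - 2 - aH n p)

def cH : ℝ := aH n p * (1 + ((n : ℝ) - 2) * ((n : ℝ) - 2 - aH n p))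

def dH : ℝ := ((n : ℝ) - 1) * aH n p * bH n p / (((n : ℝ) - 2) ^ 2 + 1)

def d1 (β : ℝ) : ℝ := cH n p / aH n p + ((n : ℝ) - 2) * β

def c2min (β : ℝ) : ℝ :=
  d1 n p β ^ 2 / ((n : ℝ) - 1) + aH n p * (β - aH n p) - bH n p

def d2 (c2 β : ℝ) : ℝ :=
  ((n : ℝ) - 2) * c2 + cH n p / (2 * aH n p) * (2 * aH n p - β)

def d3 (c2 β : ℝ) : ℝ :=
  (β - aH n p) * c2 + 1 / ((n : ℝ) - 1) * d1 n p β * d2 n p c2 β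

/-- The lower bound required of `c13 ^ 2`. -/
def c13sqMin (c2 β : ℝ) : ℝ :=
  d2 n p c2 β ^ 2 / ((n : ℝ) - 1) + d3 n p c2 β ^ 2 / (c2 - c2min n p β)
    - (cH n p + ((n : ℝ) - 2) * c2) ^ 2 / ((n : ℝ) ^ 2 - 3 * n + 3) - c2 ^ 2

def d4 (c13 c2 β : ℝ) : ℝ :=
  aH n p / (c2 * √(c2 - c2min n p β))
    + 1 / √(c13 ^ 2 - c13sqMin n p c2 β)
      * (1 + aH n p * d3 n p c2 β / (c2 * (c2 - c2min n p β)))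

def d6 (c13 c2 β : ℝ) : ℝ :=
  c2 / ((n : ℝ) - 1) * (((n : ℝ) - 2)
    - c2 * cH n p ^ 2 / (((n : ℝ) - 1) * aH n p ^ 2) * d4 n p c13 c2 β ^ 2)

/-- The conditions imposed on the two free constants `c2`, `c13`. -/
def Admissible (c2 c13 : ℝ) : Prop :=
  0 < c2 ∧ ∀ β ∈ ({aH n p, 2 * aH n p} : Set ℝ),
    c2min n p β < c2 ∧ c13sqMin n p c2 β < c13 ^ 2 ∧ 0 < d6 n p c13 c2 β

/-- A concrete choice of `c2`. -/
def c2Choice : ℝ :=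
  max (c2min n p (aH n p) + cH n p / ((n : ℝ) - 2))
    (c2min n p (2 * aH n p) + cH n p / ((n : ℝ) - 2))

/-- A concrete choice of `c13 ^ 2`, given `c2`. -/
def c13sqChoice (c2 : ℝ) : ℝ :=
  let f : ℝ → ℝ := fun β => c13sqMin n p c2 β + 4 * ((n : ℝ) - 1) ^ 2
    * (cH n p / (((n : ℝ) - 2) * aH n p) + ((n : ℝ) - 2) * d3 n p c2 β / cH n p) ^ 2 * c2
  max (f (aH n p)) (f (2 * aH n p))

end Constants

/-- Localization function together with the localization exponent `P`. The localization function
`λ` is the positive part of a `C²` function `ρ` on the unit sphere for which `0` is a regular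
value; hence `Λ = {λ > 0}` is a regular domain of the sphere, and `λ` is `C²` up to the boundary
of `Λ` and vanishes there exactly linearly. The choice `ρ = 1` gives the whole sphere. -/
structure Localization (n : ℕ) where
  rho : E n → ℝ
  P : ℝ
  two_le_P : 2 ≤ P
  contDiffAt : ∀ ω : E n, ‖ω‖ = 1 → ContDiffAt ℝ 2 rho ω
  regular : ∀ ω : E n, ‖ω‖ = 1 → rho ω = 0 → ∃ i, angD i rho ω ≠ 0
  connected : IsConnected {ω : E n | ‖ω‖ = 1 ∧ 0 < rho ω}

namespace Localization

variable {n : ℕ} (L : Localization n)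

/-- The domain `Λ` in the unit sphere. -/
def dom : Set (E n) := {ω | ‖ω‖ = 1 ∧ 0 < L.rho ω}

/-- The open truncated cone `Ω_R`. -/
def cone (R : ℝ) : Set (E n) := {x | R < ‖x‖ ∧ ‖x‖⁻¹ • x ∈ L.dom}

/-- The weight `λ^{2P}`, as a function of the angular variable `x/|x|`. -/
def weight (x : E n) : ℝ := max (L.rho (‖x‖⁻¹ • x)) 0 ^ (2 * L.P)

/-- Total mass of `dχ = λ^{2P} dω`. -/
def mass : ℝ := ∫ ω : sphere (0 : E n) 1, L.weight ω ∂(volume : Measure (E n)).toSphere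

/-- The shell average `⨍ g(r ω) dχ(ω)`; the weight vanishes outside `Λ`. -/
def avg (g : E n → ℝ) (r : ℝ) : ℝ :=
  (∫ ω : sphere (0 : E n) 1, g (r • (ω : E n)) * L.weight ω
    ∂(volume : Measure (E n)).toSphere) / L.mass

/-- Integrability of `ω ↦ g(r ω)` on `Λ` with respect to `dχ`. -/
def ShellIntegrable (g : E n → ℝ) (r : ℝ) : Prop :=
  Integrable (fun ω : sphere (0 : E n) 1 => g (r • (ω : E n)) * L.weight ω)
    (volume : Measure (E n)).toSphere

/-- The fluctuation `g - ⟨g⟩` on the shell of radius `|x|`. -/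
def fluct (g : E n → ℝ) (x : E n) : ℝ := g x - L.avg g ‖x‖

/-- The squared variational weight `ω_p² = λ^{2P} r^{n-2p}`. -/
def omegaSq (p : ℝ) (x : E n) : ℝ := L.weight x * ‖x‖ ^ ((n : ℝ) - 2 * p)

/-- The localized squared Hamiltonian operator. -/
def hamOp (p : ℝ) (u : E n → ℝ) (x : E n) : ℝ :=
  (L.omegaSq p x)⁻¹ * (((n : ℝ) - 2) * lap (fun y => L.omegaSq p y * lap u y) x
    + ∑ i, ∑ j, pd i (pd j (fun y => L.omegaSq p y * pd i (pd j u) y)) x)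

end Localization

section Functionals

variable {n : ℕ} (L : Localization n)

/-- Integrand of the squared `H²`-norm on a shell. -/
def h2Density (u : E n → ℝ) (x : E n) : ℝ := u x ^ 2 + gradSq u x + hessSq u x

/-- Integrand of the squared shell norm
`‖ϑ²u‖²_{L²} + ‖ϑu‖²_{H¹} + ‖u‖²_{H²}`. -/
def shellDensity (u : E n → ℝ) (x : E n) : ℝ :=
  rad (rad u) x ^ 2 + (rad u x ^ 2 + gradSq (rad u) x) + h2Density u x

/-- Squared shell norm, for the averaged measure on the shell of radius `r`. -/
def shellNormSq (u : E n → ℝ) (r : ℝ) : ℝ := L.avg (shellDensity u) r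

/-- Both shell norms, of `ϑu` and of `u`, are finite on the shell of radius `r`. -/
def FiniteShellNorm (u : E n → ℝ) (r : ℝ) : Prop :=
  L.ShellIntegrable (shellDensity (rad u)) r ∧ L.ShellIntegrable (shellDensity u) r

/-- Parameters of the class of shell functionals. -/
structure ShellCoeffs where
  c1 : ℝ
  c2 : ℝ
  c3 : ℝ
  c4 : ℝ
  c5 : ℝ
  c6 : ℝ
  c7 : ℝ
  c8 : ℝ
  c9 : ℝ
  c10 : ℝ
  c11 : ℝ
  c12 : ℝ
  c13 : ℝ
  c14 : ℝ
  c15 : ℝ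
  c16 : ℝ
  c17 : ℝ

/-- The selected parameters; only `c2` and `c13` are free. -/
def chosen (n : ℕ) (p c2 c13 : ℝ) : ShellCoeffs where
  c1 := aH n p
  c2 := c2
  c3 := 0
  c4 := 0
  c5 := aH n p
  c6 := 0
  c7 := aH n p
  c8 := 0
  c9 := √(((n : ℝ) ^ 2 - 3 * n + 3) / ((n : ℝ) - 1) ^ 2)
  c10 := -(((n : ℝ) - 1) / ((n : ℝ) ^ 2 - 3 * n + 3)) * (cH n p + ((n : ℝ) - 2) * c2)
  c11 := √(1 / ((n : ℝ) - 1))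
  c12 := √(2 / ((n : ℝ) - 1) * (1 + aH n p + c2))
  c13 := c13
  c14 := aH n p
  c15 := -2 * c2
  c16 := 0
  c17 := 0

/-- The Hamiltonian shell energy `Φ[u]` as a function of the radius. -/
def shellEnergy (k : ShellCoeffs) (u : E n → ℝ) (r : ℝ) : ℝ :=
  1 / 2 * L.avg (fun x =>
    (rad (rad u) x + k.c1 * rad u x - k.c2 * u x + k.c3 * angLap u x) ^ 2
      + k.c4 ^ 2 * gradSq (fun y => rad u y + k.c5 * u y) x
      + k.c6 ^ 2 * (rad u x + k.c7 * u x + k.c8 * angLap u x) ^ 2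
      + k.c9 ^ 2 * (angLap u x + k.c10 * u x) ^ 2
      + k.c11 ^ 2 * hessTracelessSq u x
      + k.c12 ^ 2 * gradSq u x
      + k.c13 ^ 2 * u x ^ 2) r

/-- The source functional `M[u]`. -/
def sourceFunctional (p : ℝ) (k : ShellCoeffs) (u : E n → ℝ) (r : ℝ) : ℝ :=
  -(1 / ((n : ℝ) - 1)) * L.avg (fun x =>
    (rad (rad u) x + k.c1 * rad u x - k.c2 * u x + k.c3 * angLap u x)
      * (‖x‖ ^ 4 * L.hamOp p u x)) r

/-- `X[u] = (ϑ + a)(ϑ + 2a) Φ[u] + M[u]`. -/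
def chiFunctional (p : ℝ) (k : ShellCoeffs) (u : E n → ℝ) (r : ℝ) : ℝ :=
  radR (radR (shellEnergy L k u)) r + 3 * aH n p * radR (shellEnergy L k u) r
    + 2 * aH n p ^ 2 * shellEnergy L k u r + sourceFunctional L p k u r

/-- `w = (ϑ + a) u`. -/
def harm (p : ℝ) (u : E n → ℝ) (x : E n) : ℝ := rad u x + aH n p * u x

/-- The radial-integration functional `Υ[u]`. -/
def upsilonFunctional (p : ℝ) (k : ShellCoeffs) (u : E n → ℝ) (r : ℝ) : ℝ :=
  let w := harm p u
  L.avg (fun x =>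
    k.c4 ^ 2 * gradDot w (rad w) x
      - (2 * (((n : ℝ) - 2) / ((n : ℝ) - 1)) * rad w x
          + ((n : ℝ) - 2) / ((n : ℝ) - 1) * (k.c1 - aH n p) * w x
          + cH n p / (((n : ℝ) - 1) * aH n p) * w x - k.c6 ^ 2 * k.c8 * w x) * angLap w x
      + (k.c14 * rad w x ^ 2 + k.c15 * (w x * rad w x) + k.c16 * w x ^ 2
          + k.c17 * gradSq w x)) r

/-- The dissipation functional `Ψ_β[u] = X[u] - (ϑ + β) Υ[u]`. -/
def dissipation (p : ℝ) (k : ShellCoeffs) (β : ℝ) (u : E n → ℝ) (r : ℝ) : ℝ :=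
  chiFunctional L p k u r
    - (radR (upsilonFunctional L p k u) r + β * upsilonFunctional L p k u r)

/-- The constant `c_130`. -/
def c130 (n : ℕ) (p c2 c13 : ℝ) : ℝ :=
  c13 ^ 2 + 1 / ((n : ℝ) ^ 2 - 3 * n + 3) * (cH n p + ((n : ℝ) - 2) * c2) ^ 2
    - c2 * (bH n p - c2)

/-- Tensorial part of the integrand quadratic in `w`. -/
def psiTen (p c2 : ℝ) (w : E n → ℝ) (x : E n) : ℝ :=
  1 / ((n : ℝ) - 1) * (hessTracelessSq w x + 2 * gradSq (rad w) x
    + 2 * (c2 + 1 + aH n p) * gradSq w x)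

/-- Scalar part of the integrand quadratic in `w`. -/
def psiSca (p c2 c13 β : ℝ) (w : E n → ℝ) (x : E n) : ℝ :=
  (rad (rad w) x + ((n : ℝ) - 2) / ((n : ℝ) - 1) * angLap w x) ^ 2
    + 1 / ((n : ℝ) - 1) * angLap w x ^ 2
    + 2 * (cH n p / aH n p + ((n : ℝ) - 2) * β) / ((n : ℝ) - 1) * (rad w x * angLap w x)
    + (c2 + bH n p + aH n p * (aH n p - β)) * rad w x ^ 2
    - 1 / ((n : ℝ) - 1) * (2 * ((n : ℝ) - 2) * c2
        + (2 * aH n p - β) * (cH n p / aH n p)) * (w x * angLap w x)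
    + 2 * (β - aH n p) * c2 * (w x * rad w x)
    + (c130 n p c2 c13 + c2 * bH n p) * w x ^ 2

/-- Integrand bilinear in `u` and `w`. -/
def psiBil (p c2 c13 : ℝ) (u w : E n → ℝ) (x : E n) : ℝ :=
  c2 * cH n p / (((n : ℝ) - 1) * aH n p)
      * ((w x - aH n p / c2 * rad w x) * angLap u x - angLap w x * u x)
    + c130 n p c2 c13 * (rad w x * u x)

/-- Integrand of the quadratic form of the harmonic operator. -/
def harmonicForm (p : ℝ) (u : E n → ℝ) (x : E n) : ℝ :=
  ((n : ℝ) - 2) * angLap u x ^ 2 + hessSq u x + 2 * (1 + aH n p) * gradSq u x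
    - cH n p * (u x * angLap u x)

/-- The dissipation functional written, after integration by parts on the shell, as the integral
of a quadratic form in the derivatives `ϑ^j ∇^k u` with `j + k ≤ 3`, `k ≤ 2`. It makes sense as
soon as the shell norms of `u` and `ϑu` are finite. -/
def dissipationForm (p c2 c13 β : ℝ) (u : E n → ℝ) (r : ℝ) : ℝ :=
  L.avg (fun x => psiTen p c2 (harm p u) x + psiSca p c2 c13 β (harm p u) x
    + psiBil p c2 c13 u (harm p u) x + c2 / ((n : ℝ) - 1) * harmonicForm p u x) r

/-- `ν` is the normalized element of the kernel of the harmonic operator: an angular function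
with `ν ∈ H²(Λ, dχ)`, `H[ν r^{-a}] = 0` and
`⟨Δν - d ν⟩ = 4 |S^{n-1}| / (((n-2)² + 1) ∫ dχ)`. -/
structure IsNormalizedKernel (p : ℝ) (ν : E n → ℝ) : Prop where
  homogeneous : ∀ x : E n, x ≠ 0 → ν x = ν (‖x‖⁻¹ • x)
  contDiffOn : ContDiffOn ℝ 4 ν (L.cone 0)
  finite : L.ShellIntegrable (h2Density ν) 1
  kernel : ∀ x ∈ L.cone 0, L.hamOp p (fun y => ν y * ‖y‖ ^ (-aH n p)) x = 0
  normalized : L.avg (fun x => angLap ν x - dH n p * ν x) 1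
    = 4 / (((n : ℝ) - 2) ^ 2 + 1) * ((volume : Measure (E n)).toSphere.real Set.univ / L.mass)

/-- The fluctuation operator `K[u - ⟨u⟩]`. All radial derivatives are written under the integral
sign; fluctuations are taken on each shell, and `∇(u - ⟨u⟩) = ∇u`, `Δ(u - ⟨u⟩) = Δu`. -/
def fluctOp (p : ℝ) (ν u : E n → ℝ) (r : ℝ) : ℝ :=
  let w := harm p u
  let νf := fun x : E n => ν x - L.avg ν 1
  let Δνf := fun x : E n => angLap ν x - L.avg (angLap ν) 1
  ((n : ℝ) - 1) * L.avg (fun x => νf x * L.fluct (fun y =>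
      rad (rad w) y + aH n p * rad w y - bH n p * w y) x) r
    + L.avg (fun x => -2 * gradDot w ν x
        + ((n : ℝ) - 2) * (νf x * angLap w x + L.fluct w x * Δνf x)) r
    + (((n : ℝ) - 2) * ((n : ℝ) - 2 - aH n p) + 1)
      * L.avg (fun x => L.fluct u x * Δνf x - νf x * angLap u x) r

/-- The best constant `C ∈ [0,∞]` in the Poincaré inequality `⨍ (v - ⟨v⟩)² ≤ C ⨍ Q[v]` on `Λ`
(`∞` when there is none). -/
def poincareConst (Q : (E n → ℝ) → E n → ℝ) : ENNReal :=
  ⨅ (C : NNReal) (_ : ∀ v : E n → ℝ, (∀ x ∈ L.dom, ContDiffAt ℝ 2 v x) →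
      L.ShellIntegrable (h2Density v) 1 →
      L.avg (fun x => L.fluct v x ^ 2) 1 ≤ C * L.avg (Q v) 1), (C : ENNReal)

end Functionals

end LocHam

end

/-! Write `W` for the weight λ^{2P}. The argument separates the integral identity (ii), which needs
calculus on spheres, from the coercivity (iii), (iv), which is pointwise algebra in the jet of `u`.

For (ii): `W` is constant along rays, so ϑ passes under the shell average (`radR_avg`). It also
commutes with the angular gradient, Hessian and Laplacian (`rad_angD`, `rad_angHess`, `rad_angLap`),
so Φ and Υ can be differentiated under the integral. The operator H is a sum of double divergences.
The divergence theorem on spheres (`sphInt_angD`) moves both derivatives onto the test function φ =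
ϑ²u + aϑu - c₂u (`sphInt_flux_flux`, `avg_mul_hamOp`). Since 2P ≥ 4, `W` is C² on the whole sphere,
so one integrates over the whole sphere and no boundary terms on ∂Λ appear. What remains is an
identity between densities that holds pointwise, without further integration by parts:
`jet_identity`, applied in `psiDensity_eq`. The coefficients of Φ are such that the products φ·ϑ⁴u,
Δu·Δϑ²u, ∇²u·∇²ϑ²u and ∇u·∇ϑ²u in (ϑ+a)(ϑ+2a)Φ are cancelled by M, while (ϑ+β)Υ accounts for further
mixed terms. A cutoff (`exists_contDiff_eventuallyEq`) reduces a function that is C⁴ near the closed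
cone to one that is C⁴ away from the origin.

For (iii): ψ_sca is a sum of four squares (`psiSca_squares`), and the last two have coefficients c₂
- c₂^min and c₁₃² - (c₁₃²)^min. The cross term (w - (a/c₂)ϑw)Δu is dominated by half of these two
squares and half of the term (n-2)(Δu)² of A[u]; this is what d₆ > 0 provides, through
`sq_le_d4_mul`. Every other cross term of ψ_bil and A[u] contains a factor `u` and is absorbed by
Young's inequality at the price of a multiple of u² (`exists_quadratic_coercive`). The estimate is
pointwise, hence survives integration against any nonnegative weight with the same constants.

For (iv): ⨍u² = ⟨u⟩² + ⨍ũ², and the Poincaré inequality, rescaled to the shell of radius `r`, bounds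
⨍ũ² by a small multiple of the shell norm. The hypothesis on K does the same for gK², so both are
absorbed in (iii).

For (i): as c₁₃ → ∞ the second summand of d₄ disappears and d₆ > 0 reduces to an inequality that
holds for large c₂. The explicit choice bounds both summands of d₄ directly (`sq_choice_sum_lt`). -/

noncomputable section

namespace LocHam

/-! ### Admissible constants: signs of the auxiliary quantities, existence, and the explicit choice.
-/

section ConstantBounds

variable {n : ℕ} {p : ℝ}

lemma one_le_sub_two (hn : 3 ≤ n) : (1 : ℝ) ≤ (n : ℝ) - 2 := by
  have : (3 : ℝ) ≤ n := by exact_mod_cast hn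
  linarith

lemma aH_pos (hp : p < (n : ℝ) - 2) : 0 < aH n p := by
  unfold aH; linarith

lemma cH_div_aH (hp : p < (n : ℝ) - 2) :
    cH n p / aH n p = 1 + ((n : ℝ) - 2) * ((n : ℝ) - 2 - aH n p) := by
  have := aH_pos hp
  unfold cH
  field_simp

lemma d1_pos (hn : 3 ≤ n) (hp : p < (n : ℝ) - 2) {β : ℝ} (hβ : aH n p ≤ β) :
    0 < d1 n p β := by
  have hm := one_le_sub_two hn
  rw [d1, cH_div_aH hp]
  nlinarith

/-- For β = a the term in `a` cancels in d₁, leaving d₁ = 1 + (n-2)², so only b has to be compared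
with d₁²/(n-1). This sign gives c₂ ≥ c/(n-2) for the explicit choice. -/
lemma c2min_aH_nonneg (hn : 3 ≤ n) (hp : p < (n : ℝ) - 2) : 0 ≤ c2min n p (aH n p) := by
  have hm := one_le_sub_two hn
  have ha := aH_pos hp
  rw [c2min, d1, cH_div_aH hp, bH]
  generalize aH n p = a at *
  obtain ⟨m, hm'⟩ : ∃ m : ℝ, (n : ℝ) = m + 2 := ⟨n - 2, by ring⟩
  rw [hm'] at hm ⊢
  have hm1 : 1 ≤ m := by linarith
  -- Dropping `a` only increases the left side because m ≥ 1. After multiplication by m + 1 the gap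
  -- is then (m - 1)(m³ + 2m + 1), which vanishes for n = 3.
  have key : 2 + (m - 1) * (m - a) ≤ (1 + m ^ 2) ^ 2 / (m + 1) := by
    rw [le_div_iff₀ (by linarith)]
    nlinarith [mul_nonneg (mul_nonneg (sub_nonneg.2 hm1) (by linarith : (0:ℝ) ≤ m + 1)) ha.le,
      mul_nonneg (sub_nonneg.2 hm1) (by positivity : (0:ℝ) ≤ m ^ 3 + 2 * m + 1)]
  have e : (1 + (m + 2 - 2) * (m + 2 - 2 - a) + (m + 2 - 2) * a) ^ 2 / (m + 2 - 1)
      = (1 + m ^ 2) ^ 2 / (m + 1) := by ring_nf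
  rw [e]
  linarith [key]

/-- For β = 2a the summand a(β - a) = a² survives once b is absorbed in d₁²/(n-1). The bound a²/2 is
the amount needed for d₂ > 0 at β = a, where c may be negative. -/
lemma sq_aH_div_two_le_c2min (hn : 3 ≤ n) (hp : p < (n : ℝ) - 2) :
    aH n p ^ 2 / 2 ≤ c2min n p (2 * aH n p) := by
  have hm := one_le_sub_two hn
  have ha := aH_pos hp
  rw [c2min, d1, cH_div_aH hp, bH]
  generalize aH n p = a at *
  obtain ⟨m, hm'⟩ : ∃ m : ℝ, (n : ℝ) = m + 2 := ⟨n - 2, by ring⟩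
  rw [hm'] at hm ⊢
  have hm1 : 1 ≤ m := by linarith
  have key : 2 + (m - 1) * (m - a) ≤ (1 + m ^ 2 + m * a) ^ 2 / (m + 1) := by
    rw [le_div_iff₀ (by linarith)]
    nlinarith [mul_nonneg (mul_nonneg (sub_nonneg.2 hm1) (by linarith : (0:ℝ) ≤ m + 1)) ha.le,
      mul_nonneg (sub_nonneg.2 hm1) (by positivity : (0:ℝ) ≤ m ^ 3 + 2 * m + 1),
      (by positivity : 0 ≤ 2 * (1 + m ^ 2) * (m * a) + (m * a) ^ 2)]
  have e : (1 + (m + 2 - 2) * (m + 2 - 2 - a) + (m + 2 - 2) * (2 * a)) ^ 2 / (m + 2 - 1)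
      = (1 + m ^ 2 + m * a) ^ 2 / (m + 1) := by ring_nf
  rw [e]
  nlinarith [key, sq_nonneg a]

/-- The sign of `d3` makes the two summands of `d4` nonnegative, so that `d4` dominates the
corresponding Euclidean norm. -/
lemma d3_pos (hn : 3 ≤ n) (hp : p < (n : ℝ) - 2) {c2 β : ℝ}
    (h2 : c2min n p (2 * aH n p) < c2) (hβ : β ∈ ({aH n p, 2 * aH n p} : Set ℝ)) :
    0 < d3 n p c2 β := by
  have hm := one_le_sub_two hn
  have ha := aH_pos hp
  have hc := sq_aH_div_two_le_c2min hn hp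
  have hc2 : 0 < c2 := by nlinarith [sq_nonneg (aH n p)]
  have hc2' : aH n p ^ 2 / 2 < c2 := by linarith
  have hd1 : 0 < d1 n p β := d1_pos hn hp (by
    rcases hβ with rfl | h
    · exact le_rfl
    · rw [Set.mem_singleton_iff.1 h]; linarith)
  have hd2 : 0 < d2 n p c2 β := by
    rcases hβ with rfl | h
    -- Expanding c gives d₂ = (n-2)(c₂ - a²/2) + a(1 + (n-2)²)/2, positive whatever the sign of c.
    · have e : d2 n p c2 (aH n p) = ((n : ℝ) - 2) * c2 + cH n p / 2 := by
        unfold d2; field_simp; ring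
      rw [e, cH]
      nlinarith [mul_pos ha (by positivity : 0 < 1 + ((n : ℝ) - 2) ^ 2),
        mul_pos (by linarith : 0 < (n : ℝ) - 2) (sub_pos.2 hc2')]
    · rw [Set.mem_singleton_iff.1 h, d2, sub_self, mul_zero, add_zero]
      exact mul_pos (by linarith) hc2
  have h3 : 0 ≤ (β - aH n p) * c2 := by
    refine mul_nonneg ?_ hc2.le
    rcases hβ with rfl | h
    · simp
    · rw [Set.mem_singleton_iff.1 h]; linarith
  have : 0 < 1 / ((n : ℝ) - 1) * d1 n p β * d2 n p c2 β :=
    mul_pos (mul_pos (one_div_pos.2 (by linarith)) hd1) hd2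
  unfold d3; linarith

lemma d6_pos_iff (hn : 3 ≤ n) {c13 c2 β : ℝ} (hc2 : 0 < c2) :
    0 < d6 n p c13 c2 β ↔ c2 * cH n p ^ 2 / (((n : ℝ) - 1) * aH n p ^ 2) * d4 n p c13 c2 β ^ 2
      < (n : ℝ) - 2 := by
  have hm := one_le_sub_two hn
  rw [d6, mul_pos_iff_of_pos_left (div_pos hc2 (by linarith)), sub_pos]

open Filter Topology in
-- Only the factor 1/√(c₁₃² - (c₁₃²)^min) depends on c₁₃, and it tends to 0.
lemma tendsto_d4 (c2 β : ℝ) : Tendsto (fun c13 => d4 n p c13 c2 β) atTop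
    (𝓝 (aH n p / (c2 * √(c2 - c2min n p β)))) := by
  have h1 : Tendsto (fun c13 : ℝ => c13 ^ 2 - c13sqMin n p c2 β) atTop atTop :=
    tendsto_atTop_add_const_right _ _ (tendsto_pow_atTop two_ne_zero)
  have h2 : Tendsto (fun c13 : ℝ => 1 / √(c13 ^ 2 - c13sqMin n p c2 β)) atTop (𝓝 0) := by
    simp only [one_div]
    exact (Real.tendsto_sqrt_atTop.comp h1).inv_tendsto_atTop
  simpa [d4] using (tendsto_const_nhds (x := aH n p / (c2 * √(c2 - c2min n p β)))).add
    (h2.mul_const (1 + aH n p * d3 n p c2 β / (c2 * (c2 - c2min n p β))))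

open Filter Topology in
-- In the limit c₁₃ → ∞ the condition d₆ > 0 becomes c² < (n-1)(n-2)c₂(c₂ - c₂^min). The two lower
-- bounds on c₂ make this strict, so it persists for large c₁₃.
lemma eventually_admissible_at (hn : 3 ≤ n) (hp : p < (n : ℝ) - 2) {c2 β : ℝ}
    (h1 : c2min n p β + 1 ≤ c2) (h2 : cH n p ^ 2 + 1 ≤ c2) :
    ∀ᶠ c13 in atTop, c2min n p β < c2 ∧ c13sqMin n p c2 β < c13 ^ 2 ∧ 0 < d6 n p c13 c2 β := by
  have hm := one_le_sub_two hn
  have ha := aH_pos hp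
  have hc2 : 0 < c2 := by nlinarith [sq_nonneg (cH n p)]
  have hg : 1 ≤ c2 - c2min n p β := by linarith
  have hev : ∀ᶠ c13 : ℝ in atTop, c13sqMin n p c2 β < c13 ^ 2 :=
    (tendsto_pow_atTop two_ne_zero).eventually_gt_atTop _
  have hlim : c2 * cH n p ^ 2 / (((n : ℝ) - 1) * aH n p ^ 2)
      * (aH n p / (c2 * √(c2 - c2min n p β))) ^ 2 < (n : ℝ) - 2 := by
    have e : c2 * cH n p ^ 2 / (((n : ℝ) - 1) * aH n p ^ 2)
        * (aH n p / (c2 * √(c2 - c2min n p β))) ^ 2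
        = cH n p ^ 2 / (((n : ℝ) - 1) * c2 * (c2 - c2min n p β)) := by
      have : √(c2 - c2min n p β) ^ 2 = c2 - c2min n p β := Real.sq_sqrt (by linarith)
      have h0 : (n : ℝ) - 1 ≠ 0 := by linarith
      have h0' : c2 - c2min n p β ≠ 0 := by linarith
      rw [div_pow, mul_pow, this]
      field_simp
    rw [e, div_lt_iff₀ (by apply mul_pos (mul_pos (by linarith) hc2); linarith)]
    have h3 : c2 ≤ c2 * (c2 - c2min n p β) := le_mul_of_one_le_right hc2.le hg
    have h4 : c2 * (c2 - c2min n p β) ≤ ((n : ℝ) - 1) * (c2 * (c2 - c2min n p β)) :=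
      le_mul_of_one_le_left (by linarith) (by linarith)
    have h5 : ((n : ℝ) - 1) * (c2 * (c2 - c2min n p β))
        ≤ ((n : ℝ) - 2) * (((n : ℝ) - 1) * (c2 * (c2 - c2min n p β))) :=
      le_mul_of_one_le_left (by linarith) hm
    nlinarith
  have hev2 := (((tendsto_d4 (n := n) (p := p) c2 β).pow 2).const_mul
    (c2 * cH n p ^ 2 / (((n : ℝ) - 1) * aH n p ^ 2))).eventually_lt_const hlim
  filter_upwards [hev, hev2] with c13 h5 h6
  exact ⟨by linarith, h5, (d6_pos_iff hn hc2).2 h6⟩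

theorem exists_admissible (hn : 3 ≤ n) (hp : p < (n : ℝ) - 2) :
    ∃ c2₀ : ℝ, ∀ c2 ≥ c2₀, ∃ c13₀ : ℝ, ∀ c13 ≥ c13₀, Admissible n p c2 c13 := by
  refine ⟨max (cH n p ^ 2 + 1) (max (c2min n p (aH n p) + 1) (c2min n p (2 * aH n p) + 1)),
    fun c2 hc2 => ?_⟩
  obtain ⟨h1, h2⟩ := max_le_iff.1 hc2
  obtain ⟨h2, h3⟩ := max_le_iff.1 h2
  have hc2' : 0 < c2 := by nlinarith [sq_nonneg (cH n p)]
  obtain ⟨c13₀, h⟩ := Filter.eventually_atTop.1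
    ((eventually_admissible_at hn hp h2 h1).and (eventually_admissible_at hn hp h3 h1))
  refine ⟨c13₀, fun c13 hc => ⟨hc2', ?_⟩⟩
  rintro β (rfl | rfl)
  exacts [(h c13 hc).1, (h c13 hc).2]

/-- Here m = n - 2, e = d₃, and x, y are the gaps of c₂ and c₁₃² above their minima. Multiplied by
√c₂·c/a, the first summand of d₄ is at most m, because √c₂·√x ≥ c/m. The second is at most
m/(2(m+1)), because of the size of y. -/
lemma sq_choice_sum_lt {m a c c2 e x y : ℝ} (hm : 0 < m) (ha : 0 < a) (hc : 0 < c)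
    (he : 0 < e) (h0 : c / m ≤ c2) (hg : c / m ≤ x)
    (hy : 4 * (m + 1) ^ 2 * (c / (m * a) + m * e / c) ^ 2 * c2 ≤ y) :
    c2 * c ^ 2 / ((m + 1) * a ^ 2) * (a / (c2 * √x) + 1 / √y * (1 + a * e / (c2 * x))) ^ 2 < m := by
  have hcm : 0 < c / m := div_pos hc hm
  have hc2 : 0 < c2 := hcm.trans_le h0
  set q := c / (m * a) + m * e / c with hq
  have hq0 : 0 < q := by positivity
  have hx : 0 < x := hcm.trans_le hg
  have hy0 : 0 < y := lt_of_lt_of_le (by positivity) hy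
  set s := √c2 with hs
  have hs0 : 0 < s := Real.sqrt_pos.2 hc2
  have hss : s ^ 2 = c2 := Real.sq_sqrt hc2.le
  have hX : c / m ≤ s * √x := by
    rw [hs, ← Real.sqrt_mul hc2.le]
    apply Real.le_sqrt_of_sq_le
    rw [sq]; exact mul_le_mul h0 hg hcm.le hc2.le
  have hY : 2 * (m + 1) * q * s ≤ √y := by
    apply Real.le_sqrt_of_sq_le
    rw [← hss] at hy; linarith [hy]
  have hsx : 0 < √x := Real.sqrt_pos.2 hx
  have hsy : 0 < √y := Real.sqrt_pos.2 hy0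
  have A1 : s * c / a * (a / (c2 * √x)) ≤ m := by
    rw [← hss]
    have : s * c / a * (a / (s ^ 2 * √x)) = c / (s * √x) := by field_simp
    rw [this, div_le_iff₀ (by positivity)]
    have := mul_le_mul_of_nonneg_left hX hm.le
    rwa [mul_div_cancel₀ _ hm.ne'] at this
  have hB : 1 + a * e / (c2 * x) ≤ a * m / c * q := by
    have h1 : a * m / c * q = 1 + a * e / (c / m * (c / m)) := by
      rw [hq]; field_simp
    rw [h1]
    gcongr
  have A2 : s * c / a * (1 / √y * (1 + a * e / (c2 * x))) ≤ m / (2 * (m + 1)) := by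
    have h3 : 1 / √y ≤ 1 / (2 * (m + 1) * q * s) := one_div_le_one_div_of_le (by positivity) hY
    calc s * c / a * (1 / √y * (1 + a * e / (c2 * x)))
        ≤ s * c / a * (1 / (2 * (m + 1) * q * s) * (a * m / c * q)) := by gcongr
      _ = m / (2 * (m + 1)) := by field_simp
  have A0 : 0 ≤ s * c / a * (a / (c2 * √x)) + s * c / a * (1 / √y * (1 + a * e / (c2 * x))) := by
    positivity
  have h1 : c2 * c ^ 2 / ((m + 1) * a ^ 2)
      * (a / (c2 * √x) + 1 / √y * (1 + a * e / (c2 * x))) ^ 2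
      = (s * c / a * (a / (c2 * √x)) + s * c / a * (1 / √y * (1 + a * e / (c2 * x)))) ^ 2
        / (m + 1) := by
    rw [← mul_add, mul_pow, div_pow, mul_pow, hss]
    field_simp
  rw [h1, div_lt_iff₀ (by linarith)]
  -- Cleared of denominators, the strict inequality is m(2m+3)² < 4(m+1)³, with gap 3m + 4.
  calc _ ≤ (m + m / (2 * (m + 1))) ^ 2 := by gcongr
    _ < m * (m + 1) := by
      have : m + m / (2 * (m + 1)) = m * (2 * m + 3) / (2 * (m + 1)) := by field_simp; ring
      rw [this, div_pow, div_lt_iff₀ (by positivity)]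
      nlinarith [mul_pos hm hm, mul_pos hm (mul_pos hm hm)]

lemma choice_admissible_at (hn : 3 ≤ n) (hp : p < (n : ℝ) - 2) (hc : 0 < cH n p) {c2 c13 β : ℝ}
    (hd3 : 0 < d3 n p c2 β)
    (h0 : cH n p / ((n : ℝ) - 2) ≤ c2) (h1 : c2min n p β + cH n p / ((n : ℝ) - 2) ≤ c2)
    (h2 : c13sqMin n p c2 β + 4 * ((n : ℝ) - 1) ^ 2
      * (cH n p / (((n : ℝ) - 2) * aH n p) + ((n : ℝ) - 2) * d3 n p c2 β / cH n p) ^ 2 * c2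
      ≤ c13 ^ 2) :
    c2min n p β < c2 ∧ c13sqMin n p c2 β < c13 ^ 2 ∧ 0 < d6 n p c13 c2 β := by
  have hm := one_le_sub_two hn
  have ha := aH_pos hp
  have hm0 : 0 < (n : ℝ) - 2 := by linarith
  have hn1 : 0 < (n : ℝ) - 1 := by linarith
  have hcm : 0 < cH n p / ((n : ℝ) - 2) := div_pos hc hm0
  have hc2 : 0 < c2 := hcm.trans_le h0
  set q := cH n p / (((n : ℝ) - 2) * aH n p) + ((n : ℝ) - 2) * d3 n p c2 β / cH n p with hq
  have hq0 : 0 < q := by positivity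
  have hpos : 0 < 4 * ((n : ℝ) - 1) ^ 2 * q ^ 2 * c2 := by positivity
  refine ⟨by linarith, by linarith, (d6_pos_iff hn hc2).2 ?_⟩
  rw [d4, show (n : ℝ) - 1 = (n : ℝ) - 2 + 1 by ring]
  refine sq_choice_sum_lt hm0 ha hc hd3 h0 (by linarith) ?_
  rw [show (n : ℝ) - 2 + 1 = (n : ℝ) - 1 by ring]
  linarith

theorem choice_admissible (hn : 3 ≤ n) (hp : p < (n : ℝ) - 2) (hc : 0 < cH n p) {c13 : ℝ}
    (h : c13 ^ 2 = c13sqChoice n p (c2Choice n p)) : Admissible n p (c2Choice n p) c13 := by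
  have hm := one_le_sub_two hn
  have hcm : 0 < cH n p / ((n : ℝ) - 2) := div_pos hc (by linarith)
  have h1 : c2min n p (aH n p) + cH n p / ((n : ℝ) - 2) ≤ c2Choice n p := le_max_left _ _
  have h2 : c2min n p (2 * aH n p) + cH n p / ((n : ℝ) - 2) ≤ c2Choice n p := le_max_right _ _
  -- The value β = a in the maximum suffices here, since c₂^min is nonnegative there.
  have h0 : cH n p / ((n : ℝ) - 2) ≤ c2Choice n p := by linarith [c2min_aH_nonneg hn hp]
  have h3 : c2min n p (2 * aH n p) < c2Choice n p := by linarith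
  refine ⟨hcm.trans_le h0, ?_⟩
  rintro β (rfl | rfl)
  · exact choice_admissible_at hn hp hc (d3_pos hn hp h3 (by simp)) h0 h1
      (h ▸ le_max_left _ _)
  · exact choice_admissible_at hn hp hc (d3_pos hn hp h3 (by simp)) h0 h2
      (h ▸ le_max_right _ _)

end ConstantBounds

/-! ### Calculus of the radial and angular derivatives: linearity, locality, regularity,
commutation. -/

section Calculus

variable {n : ℕ} {f g : E n → ℝ} {x : E n} {U : Set (E n)}

lemma rad_add (hf : DifferentiableAt ℝ f x) (hg : DifferentiableAt ℝ g x) :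
    rad (fun y => f y + g y) x = rad f x + rad g x := by
  unfold rad; rw [fderiv_fun_add hf hg]; rfl

lemma rad_sub (hf : DifferentiableAt ℝ f x) (hg : DifferentiableAt ℝ g x) :
    rad (fun y => f y - g y) x = rad f x - rad g x := by
  unfold rad; rw [fderiv_fun_sub hf hg]; rfl

lemma rad_mul (hf : DifferentiableAt ℝ f x) (hg : DifferentiableAt ℝ g x) :
    rad (fun y => f y * g y) x = rad f x * g x + f x * rad g x := by
  unfold rad; rw [fderiv_fun_mul hf hg]
  simp only [add_apply, smul_apply, smul_eq_mul]; ring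

lemma rad_const_mul (c : ℝ) (hf : DifferentiableAt ℝ f x) :
    rad (fun y => c * f y) x = c * rad f x := by
  unfold rad; rw [fderiv_const_mul hf]; rfl

lemma rad_sum {ι : Type*} (s : Finset ι) {F : ι → E n → ℝ}
    (h : ∀ i ∈ s, DifferentiableAt ℝ (F i) x) :
    rad (fun y => ∑ i ∈ s, F i y) x = ∑ i ∈ s, rad (F i) x := by
  unfold rad; rw [fderiv_fun_sum h]; simp

lemma pd_add (i : Fin n) (hf : DifferentiableAt ℝ f x) (hg : DifferentiableAt ℝ g x) :
    pd i (fun y => f y + g y) x = pd i f x + pd i g x := by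
  unfold pd; rw [fderiv_fun_add hf hg]; rfl

lemma pd_sub (i : Fin n) (hf : DifferentiableAt ℝ f x) (hg : DifferentiableAt ℝ g x) :
    pd i (fun y => f y - g y) x = pd i f x - pd i g x := by
  unfold pd; rw [fderiv_fun_sub hf hg]; rfl

lemma pd_mul (i : Fin n) (hf : DifferentiableAt ℝ f x) (hg : DifferentiableAt ℝ g x) :
    pd i (fun y => f y * g y) x = pd i f x * g x + f x * pd i g x := by
  unfold pd; rw [fderiv_fun_mul hf hg]
  simp only [add_apply, smul_apply, smul_eq_mul]; ring

lemma pd_const_mul (i : Fin n) (c : ℝ) (hf : DifferentiableAt ℝ f x) :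
    pd i (fun y => c * f y) x = c * pd i f x := by
  unfold pd; rw [fderiv_const_mul hf]; rfl

lemma pd_sum (i : Fin n) {ι : Type*} (s : Finset ι) {F : ι → E n → ℝ}
    (h : ∀ j ∈ s, DifferentiableAt ℝ (F j) x) :
    pd i (fun y => ∑ j ∈ s, F j y) x = ∑ j ∈ s, pd i (F j) x := by
  unfold pd; rw [fderiv_fun_sum h]; simp

lemma angD_add (i : Fin n) (hf : DifferentiableAt ℝ f x) (hg : DifferentiableAt ℝ g x) :
    angD i (fun y => f y + g y) x = angD i f x + angD i g x := by
  unfold angD; rw [pd_add i hf hg, rad_add hf hg]; ring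

lemma angD_sub (i : Fin n) (hf : DifferentiableAt ℝ f x) (hg : DifferentiableAt ℝ g x) :
    angD i (fun y => f y - g y) x = angD i f x - angD i g x := by
  unfold angD; rw [pd_sub i hf hg, rad_sub hf hg]; ring

lemma angD_mul (i : Fin n) (hf : DifferentiableAt ℝ f x) (hg : DifferentiableAt ℝ g x) :
    angD i (fun y => f y * g y) x = angD i f x * g x + f x * angD i g x := by
  unfold angD; rw [pd_mul i hf hg, rad_mul hf hg]; ring

lemma angD_const_mul (i : Fin n) (c : ℝ) (hf : DifferentiableAt ℝ f x) :
    angD i (fun y => c * f y) x = c * angD i f x := by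
  unfold angD; rw [pd_const_mul i c hf, rad_const_mul c hf]; ring

lemma angD_sum (i : Fin n) {ι : Type*} (s : Finset ι) {F : ι → E n → ℝ}
    (h : ∀ j ∈ s, DifferentiableAt ℝ (F j) x) :
    angD i (fun y => ∑ j ∈ s, F j y) x = ∑ j ∈ s, angD i (F j) x := by
  unfold angD; rw [pd_sum i s h, rad_sum s h, Finset.mul_sum, Finset.mul_sum,
    Finset.sum_sub_distrib]

open Filter Topology

lemma rad_congr (h : f =ᶠ[𝓝 x] g) : rad f =ᶠ[𝓝 x] rad g := by
  filter_upwards [h.fderiv (𝕜 := ℝ)] with y hy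
  rw [rad, rad, hy]

lemma pd_congr (i : Fin n) (h : f =ᶠ[𝓝 x] g) : pd i f =ᶠ[𝓝 x] pd i g := by
  filter_upwards [h.fderiv (𝕜 := ℝ)] with y hy
  rw [pd, pd, hy]

lemma angD_congr (i : Fin n) (h : f =ᶠ[𝓝 x] g) : angD i f =ᶠ[𝓝 x] angD i g := by
  filter_upwards [rad_congr h, pd_congr i h] with y hy hy'
  rw [angD, angD, hy, hy']

lemma angHess_congr (i j : Fin n) (h : f =ᶠ[𝓝 x] g) : angHess i j f =ᶠ[𝓝 x] angHess i j g := by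
  filter_upwards [angD_congr i (angD_congr j h), angD_congr i h] with y hy hy'
  rw [angHess, angHess, hy, hy']

lemma angLap_congr (h : f =ᶠ[𝓝 x] g) : angLap f =ᶠ[𝓝 x] angLap g := by
  have : ∀ᶠ y in 𝓝 x, ∀ i, angD i (angD i f) y = angD i (angD i g) y :=
    eventually_all.2 fun i => angD_congr i (angD_congr i h)
  filter_upwards [this] with y hy
  simp only [angLap, hy]

lemma gradDot_congr {f' g' : E n → ℝ} (h : f =ᶠ[𝓝 x] g) (h' : f' =ᶠ[𝓝 x] g') :
    gradDot f f' =ᶠ[𝓝 x] gradDot g g' := by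
  have : ∀ᶠ y in 𝓝 x, ∀ i, angD i f y = angD i g y ∧ angD i f' y = angD i g' y :=
    eventually_all.2 fun i => (angD_congr i h).and (angD_congr i h')
  filter_upwards [this] with y hy
  simp only [gradDot, fun i => (hy i).1, fun i => (hy i).2]

lemma gradSq_congr (h : f =ᶠ[𝓝 x] g) : gradSq f =ᶠ[𝓝 x] gradSq g := gradDot_congr h h

lemma hessSq_congr (h : f =ᶠ[𝓝 x] g) : hessSq f =ᶠ[𝓝 x] hessSq g := by
  have : ∀ᶠ y in 𝓝 x, ∀ i j, angHess i j f y = angHess i j g y :=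
    eventually_all.2 fun i => eventually_all.2 fun j => angHess_congr i j h
  filter_upwards [this] with y hy
  simp only [hessSq, hy]

lemma hessTracelessSq_congr (h : f =ᶠ[𝓝 x] g) :
    hessTracelessSq f =ᶠ[𝓝 x] hessTracelessSq g := by
  have : ∀ᶠ y in 𝓝 x, ∀ i j, angHess i j f y = angHess i j g y :=
    eventually_all.2 fun i => eventually_all.2 fun j => angHess_congr i j h
  filter_upwards [this, angLap_congr h] with y hy hy'
  simp only [hessTracelessSq, hy, hy']

lemma harm_congr (p : ℝ) (h : f =ᶠ[𝓝 x] g) : harm p f =ᶠ[𝓝 x] harm p g := by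
  filter_upwards [h, rad_congr h] with y hy hy'
  rw [harm, harm, hy, hy']

/-! ### Regularity on an open set that avoids the origin -/

section Regularity

variable {k m : WithTop ℕ∞}

lemma contDiffOn_pd (hU : IsOpen U) (hf : ContDiffOn ℝ k f U) (hk : m + 1 ≤ k) (i : Fin n) :
    ContDiffOn ℝ m (pd i f) U :=
  (hf.fderiv_of_isOpen hU hk).clm_apply contDiffOn_const

lemma contDiffOn_rad (hU : IsOpen U) (hf : ContDiffOn ℝ k f U) (hk : m + 1 ≤ k) :
    ContDiffOn ℝ m (rad f) U :=
  (hf.fderiv_of_isOpen hU hk).clm_apply contDiffOn_id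

lemma contDiffOn_norm' (h0 : (0 : E n) ∉ U) : ContDiffOn ℝ m (fun x : E n => ‖x‖) U :=
  contDiffOn_id.norm ℝ fun x hx h => h0 (by simpa [← h] using hx)

lemma contDiffOn_proj (i : Fin n) : ContDiffOn ℝ m (fun x : E n => x i) U :=
  ((EuclideanSpace.proj i : E n →L[ℝ] ℝ).contDiff).contDiffOn

/-- The `i`-th component of the radial unit vector. -/
def rdir (i : Fin n) (x : E n) : ℝ := x i / ‖x‖

lemma contDiffOn_rdir (h0 : (0 : E n) ∉ U) (i : Fin n) : ContDiffOn ℝ m (rdir i) U :=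
  (contDiffOn_proj i).div (contDiffOn_norm' h0) fun x hx h =>
    h0 (by simpa [norm_eq_zero.1 h] using hx)

lemma contDiffOn_angD (hU : IsOpen U) (h0 : (0 : E n) ∉ U) (hf : ContDiffOn ℝ k f U)
    (hk : m + 1 ≤ k) (i : Fin n) : ContDiffOn ℝ m (angD i f) U :=
  ((contDiffOn_norm' h0).mul (contDiffOn_pd hU hf hk i)).sub
    ((contDiffOn_rdir h0 i).mul (contDiffOn_rad hU hf hk))

lemma contDiffOn_angHess (hU : IsOpen U) (h0 : (0 : E n) ∉ U) (hf : ContDiffOn ℝ k f U)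
    (hk : m + 1 + 1 ≤ k) (i j : Fin n) : ContDiffOn ℝ m (angHess i j f) U :=
  (contDiffOn_angD hU h0 (contDiffOn_angD hU h0 hf hk j) le_rfl i).add
    ((contDiffOn_rdir h0 j).mul (contDiffOn_angD hU h0 hf
      (le_trans (add_le_add_left le_self_add 1) hk) i))

lemma contDiffOn_angLap (hU : IsOpen U) (h0 : (0 : E n) ∉ U) (hf : ContDiffOn ℝ k f U)
    (hk : m + 1 + 1 ≤ k) : ContDiffOn ℝ m (angLap f) U :=
  ContDiffOn.sum fun i _ => contDiffOn_angD hU h0 (contDiffOn_angD hU h0 hf hk i) le_rfl i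

lemma contDiffOn_gradDot (hU : IsOpen U) (h0 : (0 : E n) ∉ U) (hf : ContDiffOn ℝ k f U)
    (hg : ContDiffOn ℝ k g U) (hk : m + 1 ≤ k) : ContDiffOn ℝ m (gradDot f g) U :=
  ContDiffOn.sum fun i _ => (contDiffOn_angD hU h0 hf hk i).mul (contDiffOn_angD hU h0 hg hk i)

/-- Scalar product of two covariant angular Hessians. -/
def hessDot (f g : E n → ℝ) (x : E n) : ℝ := ∑ i, ∑ j, angHess i j f x * angHess i j g x

lemma hessDot_self (f : E n → ℝ) (x : E n) : hessDot f f x = hessSq f x := by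
  simp only [hessDot, hessSq, sq]

lemma contDiffOn_hessDot (hU : IsOpen U) (h0 : (0 : E n) ∉ U) (hf : ContDiffOn ℝ k f U)
    (hg : ContDiffOn ℝ k g U) (hk : m + 1 + 1 ≤ k) : ContDiffOn ℝ m (hessDot f g) U :=
  ContDiffOn.sum fun i _ => ContDiffOn.sum fun j _ =>
    (contDiffOn_angHess hU h0 hf hk i j).mul (contDiffOn_angHess hU h0 hg hk i j)

lemma differentiableAt_of_contDiffOn (hU : IsOpen U) (hf : ContDiffOn ℝ k f U) (hx : x ∈ U)
    (hk : k ≠ 0) : DifferentiableAt ℝ f x :=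
  (hf.contDiffAt (hU.mem_nhds hx)).differentiableAt hk

end Regularity

/-! ### The radial direction -/

lemma sum_rdir_sq (hx : x ≠ 0) : ∑ i, rdir i x ^ 2 = 1 := by
  have h : ∑ i, x i ^ 2 = ‖x‖ ^ 2 := by
    rw [EuclideanSpace.norm_sq_eq]; simp
  simp only [rdir, div_pow, ← Finset.sum_div, h]
  exact div_self (by simpa using hx)

lemma rad_eq_sum (f : E n → ℝ) (x : E n) : rad f x = ∑ i, x i * pd i f x := by
  have h : x = ∑ i, x i • EuclideanSpace.single i (1 : ℝ) := by
    ext j; simp [Pi.single_apply]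
  calc rad f x = fderiv ℝ f x (∑ i, x i • EuclideanSpace.single i (1 : ℝ)) :=
        congrArg (fderiv ℝ f x) h
    _ = _ := by simp only [map_sum, map_smul, smul_eq_mul, pd]

lemma sum_rdir_mul_angD (f : E n → ℝ) (hx : x ≠ 0) : ∑ i, rdir i x * angD i f x = 0 := by
  have hn : ‖x‖ ≠ 0 := norm_ne_zero_iff.2 hx
  have h1 : ∀ i, rdir i x * angD i f x = x i * pd i f x - rdir i x ^ 2 * rad f x := by
    intro i; simp only [angD, rdir]; field_simp
  simp only [h1, Finset.sum_sub_distrib, ← Finset.sum_mul, sum_rdir_sq hx, ← rad_eq_sum]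
  ring

lemma pd_eq (i : Fin n) (f : E n → ℝ) (hx : x ≠ 0) :
    pd i f x = (angD i f x + rdir i x * rad f x) / ‖x‖ := by
  have hn : ‖x‖ ≠ 0 := norm_ne_zero_iff.2 hx
  simp only [angD, rdir]; field_simp; ring

lemma hasFDerivAt_norm' (hx : x ≠ 0) :
    HasFDerivAt (fun y : E n => ‖y‖) (‖x‖⁻¹ • innerSL ℝ x) x := by
  have h := (hasStrictFDerivAt_norm_sq x).hasFDerivAt.sqrt (by simpa using hx)
  have e : (fun y : E n => √(‖y‖ ^ 2)) = fun y => ‖y‖ := by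
    funext y; exact Real.sqrt_sq (norm_nonneg y)
  rw [e, Real.sqrt_sq (norm_nonneg x)] at h
  refine h.congr_fderiv ?_
  ext v; simp; field_simp

lemma differentiableAt_norm' (hx : x ≠ 0) : DifferentiableAt ℝ (fun y : E n => ‖y‖) x :=
  (hasFDerivAt_norm' hx).differentiableAt

lemma rad_norm (hx : x ≠ 0) : rad (fun y : E n => ‖y‖) x = ‖x‖ := by
  have hn : ‖x‖ ≠ 0 := norm_ne_zero_iff.2 hx
  rw [rad, (hasFDerivAt_norm' hx).fderiv]
  simp; field_simp

lemma pd_norm (i : Fin n) (hx : x ≠ 0) : pd i (fun y : E n => ‖y‖) x = rdir i x := by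
  rw [pd, (hasFDerivAt_norm' hx).fderiv, rdir]
  simp [EuclideanSpace.inner_single_right]; ring

lemma pd_proj (i j : Fin n) : pd i (fun y : E n => y j) x = if i = j then 1 else 0 := by
  have : HasFDerivAt (fun y : E n => y j) (EuclideanSpace.proj j : E n →L[ℝ] ℝ) x :=
    (EuclideanSpace.proj j : E n →L[ℝ] ℝ).hasFDerivAt
  rw [pd, this.fderiv]; simp [PiLp.single_apply, eq_comm]

lemma rad_proj (j : Fin n) : rad (fun y : E n => y j) x = x j := by
  have : HasFDerivAt (fun y : E n => y j) (EuclideanSpace.proj j : E n →L[ℝ] ℝ) x :=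
    (EuclideanSpace.proj j : E n →L[ℝ] ℝ).hasFDerivAt
  rw [rad, this.fderiv]; simp

lemma differentiableAt_proj (j : Fin n) : DifferentiableAt ℝ (fun y : E n => y j) x :=
  (EuclideanSpace.proj j : E n →L[ℝ] ℝ).differentiableAt

lemma differentiableAt_rdir (j : Fin n) (hx : x ≠ 0) : DifferentiableAt ℝ (rdir j) x :=
  ((differentiableAt_proj j).mul ((differentiableAt_norm' hx).inv (norm_ne_zero_iff.2 hx))).congr_of_eventuallyEq
    (.of_forall fun _ => div_eq_mul_inv _ _)

/-- Differentiating this factorization by the product rule yields the derivatives of `rdir` from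
those of the coordinates and of the norm. -/
lemma proj_eq (j : Fin n) : (fun y : E n => y j) = fun y => ‖y‖ * rdir j y := by
  funext y
  by_cases hy : y = 0
  · simp [hy]
  · have hn : ‖y‖ ≠ 0 := norm_ne_zero_iff.2 hy
    simp only [rdir]; field_simp

lemma rad_rdir (j : Fin n) (hx : x ≠ 0) : rad (rdir j) x = 0 := by
  have hn : ‖x‖ ≠ 0 := norm_ne_zero_iff.2 hx
  have h := rad_proj (x := x) j
  rw [proj_eq j, rad_mul (differentiableAt_norm' hx) (differentiableAt_rdir j hx),
    rad_norm hx] at h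
  have e : x j = ‖x‖ * rdir j x := congrFun (proj_eq j) x
  rw [e] at h
  simpa [hx] using h

lemma angD_rdir (i j : Fin n) (hx : x ≠ 0) :
    angD i (rdir j) x = (if i = j then 1 else 0) - rdir i x * rdir j x := by
  have hn : ‖x‖ ≠ 0 := norm_ne_zero_iff.2 hx
  have h := pd_proj (x := x) i j
  rw [proj_eq j, pd_mul i (differentiableAt_norm' hx) (differentiableAt_rdir j hx),
    pd_norm i hx] at h
  rw [angD, rad_rdir j hx]
  linarith

/-! ### Commutation -/

/-- Differentiating Df(x)x produces Df applied to a basis vector and a second derivative; symmetry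
of the latter identifies it with ϑ∂ᵢf. -/
lemma pd_rad (hU : IsOpen U) (hf : ContDiffOn ℝ 2 f U) (hx : x ∈ U) (i : Fin n) :
    pd i (rad f) x = pd i f x + rad (pd i f) x := by
  have hfx : ContDiffAt ℝ 2 f x := hf.contDiffAt (hU.mem_nhds hx)
  have h1 : DifferentiableAt ℝ (fderiv ℝ f) x :=
    (hfx.fderiv_right (m := 1) (by norm_num)).differentiableAt (by norm_num)
  have hs : IsSymmSndFDerivAt ℝ f x := hfx.isSymmSndFDerivAt (by simp)
  have e1 := h1.hasFDerivAt.clm_apply (hasFDerivAt_id x)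
  have e2 := h1.hasFDerivAt.clm_apply (hasFDerivAt_const (EuclideanSpace.single i (1 : ℝ)) x)
  have e1' : fderiv ℝ (rad f) x = _ := e1.fderiv
  have e2' : fderiv ℝ (pd i f) x = _ := e2.fderiv
  have e3 := hs x (EuclideanSpace.single i 1)
  rw [pd, e1', rad, e2']
  simp [pd, e3]

lemma pd_comm (hU : IsOpen U) (hf : ContDiffOn ℝ 2 f U) (hx : x ∈ U) (i j : Fin n) :
    pd i (pd j f) x = pd j (pd i f) x := by
  have hfx : ContDiffAt ℝ 2 f x := hf.contDiffAt (hU.mem_nhds hx)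
  have h1 : DifferentiableAt ℝ (fderiv ℝ f) x :=
    (hfx.fderiv_right (m := 1) (by norm_num)).differentiableAt (by norm_num)
  have hs : IsSymmSndFDerivAt ℝ f x := hfx.isSymmSndFDerivAt (by simp)
  have e2 := fun i => h1.hasFDerivAt.clm_apply
    (hasFDerivAt_const (EuclideanSpace.single i (1 : ℝ)) x)
  have e2' : ∀ i, fderiv ℝ (pd i f) x = _ := fun i => (e2 i).fderiv
  have e3 := hs (EuclideanSpace.single i 1) (EuclideanSpace.single j 1)
  rw [pd, e2', pd, e2']
  simp [e3]

/-- The factor ‖x‖ in `angD` makes it homogeneous of degree 0: ϑ‖x‖ = ‖x‖ compensates the commutator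
of ∂ᵢ with ϑ, and the direction is constant along rays. All later exchanges of radial and angular
derivatives rest on this. -/
lemma rad_angD (hU : IsOpen U) (h0 : (0 : E n) ∉ U) (hf : ContDiffOn ℝ 2 f U) (hx : x ∈ U)
    (i : Fin n) : rad (angD i f) x = angD i (rad f) x := by
  have hx0 : x ≠ 0 := fun h => h0 (h ▸ hx)
  have hp : DifferentiableAt ℝ (pd i f) x :=
    differentiableAt_of_contDiffOn hU (contDiffOn_pd hU hf (m := 1) (by norm_num) i) hx (by simp)
  have hr : DifferentiableAt ℝ (rad f) x :=
    differentiableAt_of_contDiffOn hU (contDiffOn_rad hU hf (m := 1) (by norm_num)) hx (by simp)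
  have e : angD i f = fun y => ‖y‖ * pd i f y - rdir i y * rad f y := rfl
  rw [e, rad_sub ((differentiableAt_norm' hx0).fun_mul hp) ((differentiableAt_rdir i hx0).fun_mul hr),
    rad_mul (differentiableAt_norm' hx0) hp, rad_mul (differentiableAt_rdir i hx0) hr,
    rad_rdir i hx0, rad_norm hx0, angD, pd_rad hU hf hx, rdir]
  ring

end Calculus

/-! ### Coercivity of the dissipation density as a quadratic form on real variables. -/

section QuadraticForm

variable {n : ℕ} {p : ℝ}

/-- The squares form a triangular system: the last controls w0, the one before it then controls w1,
the second controls l and the first w2. Only half of the last two squares enters, because the other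
half is reserved for the term that couples `w` to Δu. -/
lemma exists_sq_sum_le {N d1 d2 e g g' : ℝ} (k : ℝ) (hN : 0 < N) (hg : 0 < g) (hg' : 0 < g') :
    ∃ K > 0, ∀ w0 w1 w2 l : ℝ, w0 ^ 2 + w1 ^ 2 + w2 ^ 2 + l ^ 2
      ≤ K * ((w2 + k * l) ^ 2 + 1 / N * (l + d1 * w1 - d2 * w0) ^ 2
        + 1 / 2 * (g * (w1 + e * w0) ^ 2 + g' * w0 ^ 2)) := by
  set K0 := 2 / g' with hK0
  set K1 := 4 / g + 2 * e ^ 2 * K0 with hK1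
  set K2 := 3 * N + 3 * d1 ^ 2 * K1 + 3 * d2 ^ 2 * K0 with hK2
  have hp0 : 0 < K0 := by positivity
  have hp1 : 0 < K1 := by positivity
  have hp2 : 0 < K2 := by positivity
  clear_value K0 K1 K2
  refine ⟨K0 + K1 + (2 + 2 * k ^ 2 * K2) + K2, by positivity, fun w0 w1 w2 l => ?_⟩
  set a1 := (w2 + k * l) ^ 2 with ha1
  set a2 := 1 / N * (l + d1 * w1 - d2 * w0) ^ 2 with ha2
  set a3 := g * (w1 + e * w0) ^ 2 with ha3
  set a4 := g' * w0 ^ 2 with ha4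
  have p1 : 0 ≤ a1 := by positivity
  have p2 : 0 ≤ a2 := by positivity
  have p3 : 0 ≤ a3 := by positivity
  have p4 : 0 ≤ a4 := by positivity
  set Q := a1 + a2 + 1 / 2 * (a3 + a4) with hQ
  clear_value a1 a2 a3 a4 Q
  have h0 : w0 ^ 2 ≤ K0 * Q := by
    have : w0 ^ 2 = K0 * (1 / 2 * a4) := by rw [hK0, ha4]; field_simp
    rw [this]; gcongr; linarith
  have h1' : (w1 + e * w0) ^ 2 ≤ 2 / g * Q := by
    have : (w1 + e * w0) ^ 2 = 2 / g * (1 / 2 * a3) := by rw [ha3]; field_simp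
    rw [this]; gcongr; linarith
  have h1 : w1 ^ 2 ≤ K1 * Q := by
    have h2 : w1 ^ 2 ≤ 2 * (w1 + e * w0) ^ 2 + 2 * e ^ 2 * w0 ^ 2 := by
      nlinarith [sq_nonneg (w1 + e * w0 + e * w0)]
    have h3 : 2 * e ^ 2 * w0 ^ 2 ≤ 2 * e ^ 2 * (K0 * Q) := by gcongr
    rw [hK1, show (4 / g + 2 * e ^ 2 * K0) * Q = 2 * (2 / g * Q) + 2 * e ^ 2 * (K0 * Q) by ring]
    linarith
  have h2 : l ^ 2 ≤ K2 * Q := by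
    have h3 : l ^ 2 ≤ 3 * (l + d1 * w1 - d2 * w0) ^ 2 + 3 * d1 ^ 2 * w1 ^ 2
        + 3 * d2 ^ 2 * w0 ^ 2 := by
      have h : ∀ x y z : ℝ, (x - y + z) ^ 2 ≤ 3 * x ^ 2 + 3 * y ^ 2 + 3 * z ^ 2 := fun x y z => by
        nlinarith [sq_nonneg (x + y), sq_nonneg (x - z), sq_nonneg (y + z)]
      calc l ^ 2 = (l + d1 * w1 - d2 * w0 - d1 * w1 + d2 * w0) ^ 2 := by ring
        _ ≤ _ := h _ _ _
        _ = _ := by ring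
    have h4 : (l + d1 * w1 - d2 * w0) ^ 2 ≤ N * Q := by
      have : (l + d1 * w1 - d2 * w0) ^ 2 = N * a2 := by rw [ha2]; field_simp
      rw [this]; gcongr; linarith
    have h5 : 3 * d1 ^ 2 * w1 ^ 2 ≤ 3 * d1 ^ 2 * (K1 * Q) := by gcongr
    have h6 : 3 * d2 ^ 2 * w0 ^ 2 ≤ 3 * d2 ^ 2 * (K0 * Q) := by gcongr
    rw [hK2]; linarith
  have h3 : w2 ^ 2 ≤ (2 + 2 * k ^ 2 * K2) * Q := by
    have h4 : w2 ^ 2 ≤ 2 * (w2 + k * l) ^ 2 + 2 * k ^ 2 * l ^ 2 := by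
      nlinarith [sq_nonneg (w2 + k * l + k * l)]
    have h5 : 2 * k ^ 2 * l ^ 2 ≤ 2 * k ^ 2 * (K2 * Q) := by gcongr
    have h6 : a1 ≤ Q := by linarith
    linarith
  linarith

lemma neg_mul_le_young {ε : ℝ} (hε : 0 < ε) (k s t : ℝ) :
    -(ε * s ^ 2 + k ^ 2 / (4 * ε) * t ^ 2) ≤ k * (s * t) := by
  have h : ε * s ^ 2 + k ^ 2 / (4 * ε) * t ^ 2 + k * (s * t) = (2 * ε * s + k * t) ^ 2 / (4 * ε) := by
    field_simp; ring
  have : 0 ≤ (2 * ε * s + k * t) ^ 2 / (4 * ε) := by positivity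
  linarith

/-- Completion of squares in the scalar part of the dissipation. -/
lemma psiSca_squares (hn : 3 ≤ n) {c2 c13 β : ℝ} (h2 : c2min n p β < c2) (w0 w1 w2 l : ℝ) :
    (w2 + ((n : ℝ) - 2) / ((n : ℝ) - 1) * l) ^ 2 + 1 / ((n : ℝ) - 1) * l ^ 2
      + 2 * (cH n p / aH n p + ((n : ℝ) - 2) * β) / ((n : ℝ) - 1) * (w1 * l)
      + (c2 + bH n p + aH n p * (aH n p - β)) * w1 ^ 2
      - 1 / ((n : ℝ) - 1) * (2 * ((n : ℝ) - 2) * c2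
          + (2 * aH n p - β) * (cH n p / aH n p)) * (w0 * l)
      + 2 * (β - aH n p) * c2 * (w0 * w1) + (c130 n p c2 c13 + c2 * bH n p) * w0 ^ 2
    = (w2 + ((n : ℝ) - 2) / ((n : ℝ) - 1) * l) ^ 2
      + 1 / ((n : ℝ) - 1) * (l + d1 n p β * w1 - d2 n p c2 β * w0) ^ 2
      + (c2 - c2min n p β) * (w1 + d3 n p c2 β / (c2 - c2min n p β) * w0) ^ 2
      + (c13 ^ 2 - c13sqMin n p c2 β) * w0 ^ 2 := by
  have hm := one_le_sub_two hn
  have hn1 : (n : ℝ) - 1 ≠ 0 := by linarith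
  have hg : c2 - c2min n p β ≠ 0 := by linarith
  have e2 : 2 * ((n : ℝ) - 2) * c2 + (2 * aH n p - β) * (cH n p / aH n p)
      = 2 * d2 n p c2 β := by
    unfold d2; rw [mul_comm 2 (aH n p), ← div_div]; ring
  have e3 : (c2 - c2min n p β) * (w1 + d3 n p c2 β / (c2 - c2min n p β) * w0) ^ 2
      = (c2 - c2min n p β) * w1 ^ 2 + 2 * d3 n p c2 β * (w0 * w1)
        + d3 n p c2 β ^ 2 / (c2 - c2min n p β) * w0 ^ 2 := by
    field_simp; ring
  have e4 : cH n p / aH n p + ((n : ℝ) - 2) * β = d1 n p β := rfl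
  rw [e2, e3, e4, c13sqMin, c130]
  rw [show c2 - c2min n p β = c2 - (d1 n p β ^ 2 / ((n : ℝ) - 1)
    + aH n p * (β - aH n p) - bH n p) from rfl]
  generalize d3 n p c2 β ^ 2 / (c2 - (d1 n p β ^ 2 / ((n : ℝ) - 1)
    + aH n p * (β - aH n p) - bH n p)) = q
  rw [show d3 n p c2 β = (β - aH n p) * c2 + 1 / ((n : ℝ) - 1) * d1 n p β * d2 n p c2 β from rfl]
  ring

/-- In terms of Y = √g(w1 + (e/g)w0) and Z = √g'·w0 the left side is (RZ - PY)², where P and R are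
the two summands of d₄. Cauchy–Schwarz gives the factor P² + R², and this is at most (P + R)² = d₄²
because both summands are positive. The sign of d₃ enters there. -/
lemma sq_le_d4_mul (hp : p < (n : ℝ) - 2) {c2 c13 β : ℝ} (hc2 : 0 < c2)
    (h2 : c2min n p β < c2) (h3 : c13sqMin n p c2 β < c13 ^ 2) (hd : 0 < d3 n p c2 β)
    (w0 w1 : ℝ) :
    (w0 - aH n p / c2 * w1) ^ 2 ≤ d4 n p c13 c2 β ^ 2
      * ((c2 - c2min n p β) * (w1 + d3 n p c2 β / (c2 - c2min n p β) * w0) ^ 2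
        + (c13 ^ 2 - c13sqMin n p c2 β) * w0 ^ 2) := by
  have ha := aH_pos hp
  rw [d4]
  generalize d3 n p c2 β = e at *
  have hg : 0 < c2 - c2min n p β := by linarith
  have hg' : 0 < c13 ^ 2 - c13sqMin n p c2 β := by linarith
  generalize c2 - c2min n p β = g at *
  generalize c13 ^ 2 - c13sqMin n p c2 β = g' at *
  generalize aH n p = a at *
  have hs : 0 < √g := Real.sqrt_pos.2 hg
  have hs' : 0 < √g' := Real.sqrt_pos.2 hg'
  have hss : √g ^ 2 = g := Real.sq_sqrt hg.le
  have hss' : √g' ^ 2 = g' := Real.sq_sqrt hg'.le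
  set P := a / (c2 * √g) with hP
  set R := 1 / √g' * (1 + a * e / (c2 * g)) with hR
  have hP0 : 0 < P := by positivity
  have hR0 : 0 < R := by positivity
  set Y := √g * (w1 + e / g * w0) with hY
  set Z := √g' * w0 with hZ
  have e1 : w0 - a / c2 * w1 = R * Z - P * Y := by
    rw [hR, hZ, hP, hY]; field_simp; ring
  have e2 : g * (w1 + e / g * w0) ^ 2 = Y ^ 2 := by rw [hY, mul_pow, hss]
  have e3 : g' * w0 ^ 2 = Z ^ 2 := by rw [hZ, mul_pow, hss']
  rw [e1, e2, e3]
  nlinarith [sq_nonneg (R * Y + P * Z), mul_pos hP0 hR0, mul_nonneg (mul_pos hP0 hR0).le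
    (add_nonneg (sq_nonneg Y) (sq_nonneg Z))]

/-- Coercivity of the dissipation density as a quadratic form, up to a multiple of `u²`. -/
lemma exists_quadratic_coercive (hn : 3 ≤ n) (hp : p < (n : ℝ) - 2) {c2 c13 β : ℝ}
    (hc2 : 0 < c2) (h2 : c2min n p β < c2) (h3 : c13sqMin n p c2 β < c13 ^ 2)
    (hd : 0 < d3 n p c2 β) (h6 : 0 < d6 n p c13 c2 β) :
    ∃ δ > 0, ∃ C > 0, ∀ u w0 w1 w2 lw lu T gw gw1 gu hu : ℝ, 0 ≤ T → 0 ≤ gw → 0 ≤ gw1 →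
      0 ≤ gu → 0 ≤ hu →
      δ * (w0 ^ 2 + w1 ^ 2 + w2 ^ 2 + lw ^ 2 + T + gw + gw1 + gu + hu)
        ≤ 1 / ((n : ℝ) - 1) * (T + 2 * gw1 + 2 * (c2 + 1 + aH n p) * gw)
          + ((w2 + ((n : ℝ) - 2) / ((n : ℝ) - 1) * lw) ^ 2 + 1 / ((n : ℝ) - 1) * lw ^ 2
            + 2 * (cH n p / aH n p + ((n : ℝ) - 2) * β) / ((n : ℝ) - 1) * (w1 * lw)
            + (c2 + bH n p + aH n p * (aH n p - β)) * w1 ^ 2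
            - 1 / ((n : ℝ) - 1) * (2 * ((n : ℝ) - 2) * c2
                + (2 * aH n p - β) * (cH n p / aH n p)) * (w0 * lw)
            + 2 * (β - aH n p) * c2 * (w0 * w1) + (c130 n p c2 c13 + c2 * bH n p) * w0 ^ 2)
          + (c2 * cH n p / (((n : ℝ) - 1) * aH n p) * ((w0 - aH n p / c2 * w1) * lu - lw * u)
            + c130 n p c2 c13 * (w1 * u))
          + c2 / ((n : ℝ) - 1) * (((n : ℝ) - 2) * lu ^ 2 + hu + 2 * (1 + aH n p) * gu
            - cH n p * (u * lu)) + C * u ^ 2 := by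
  have hm := one_le_sub_two hn
  have ha := aH_pos hp
  have hn1 : 0 < (n : ℝ) - 1 := by linarith
  have hm0 : 0 < (n : ℝ) - 2 := by linarith
  have hg : 0 < c2 - c2min n p β := by linarith
  have hg' : 0 < c13 ^ 2 - c13sqMin n p c2 β := by linarith
  obtain ⟨K, hK, hKle⟩ := exists_sq_sum_le (d1 := d1 n p β) (d2 := d2 n p c2 β)
    (e := d3 n p c2 β / (c2 - c2min n p β)) (((n : ℝ) - 2) / ((n : ℝ) - 1)) hn1 hg hg'
  set k := c2 * cH n p / (((n : ℝ) - 1) * aH n p) with hk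
  set θ := c2 / ((n : ℝ) - 1) * ((n : ℝ) - 2) with hθ
  have hθ0 : 0 < θ := by positivity
  -- This is d₆ ≥ 0 rewritten in terms of the coefficient k of the cross term and the coefficient θ
  -- of (Δu)².
  have hkd : k ^ 2 * d4 n p c13 c2 β ^ 2 ≤ θ := by
    have h := ((d6_pos_iff hn hc2).1 h6).le
    have : k ^ 2 * d4 n p c13 c2 β ^ 2 = c2 / ((n : ℝ) - 1)
        * (c2 * cH n p ^ 2 / (((n : ℝ) - 1) * aH n p ^ 2) * d4 n p c13 c2 β ^ 2) := by
      rw [hk]; field_simp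
    rw [this]
    exact mul_le_mul_of_nonneg_left h (by positivity)
  -- The first two squares and half of the last two amount to at least 4ε times w0² + w1² + w2² +
  -- lw². One ε is kept for coercivity, and ε·lw² and ε·w1² pay for the products with `u`.
  set ε := 1 / (4 * K) with hε
  have hε0 : 0 < ε := by positivity
  set N1 := 1 / ((n : ℝ) - 1) with hN1
  have hN10 : 0 < N1 := by positivity
  have hcN : c2 / ((n : ℝ) - 1) = c2 * N1 := by rw [hN1]; ring
  set C := k ^ 2 / (4 * ε) + c130 n p c2 c13 ^ 2 / (4 * ε)
    + (c2 * N1 * cH n p) ^ 2 / (4 * (θ / 2)) with hC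
  have hC0 : 0 ≤ C := by positivity
  refine ⟨min ε (min N1 (c2 * N1)), by positivity, C + 1, by positivity, ?_⟩
  intro u w0 w1 w2 lw lu T gw gw1 gu hu hT hgw hgw1 hgu hhu
  rw [psiSca_squares hn h2]
  set δ := min ε (min N1 (c2 * N1)) with hδ
  have hδ1 : δ ≤ ε := min_le_left _ _
  have hδ2 : δ ≤ N1 := (min_le_right _ _).trans (min_le_left _ _)
  have hδ3 : δ ≤ c2 * N1 := (min_le_right _ _).trans (min_le_right _ _)
  have hQ := hKle w0 w1 w2 lw
  have hd4 := sq_le_d4_mul hp hc2 h2 h3 hd w0 w1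
  rw [← hN1]
  set Y := (c2 - c2min n p β) * (w1 + d3 n p c2 β / (c2 - c2min n p β) * w0) ^ 2
    + (c13 ^ 2 - c13sqMin n p c2 β) * w0 ^ 2 with hY
  set S := (w2 + ((n : ℝ) - 2) / ((n : ℝ) - 1) * lw) ^ 2
    + N1 * (lw + d1 n p β * w1 - d2 n p c2 β * w0) ^ 2 with hS
  have hY0 : 0 ≤ Y := by positivity
  have hsum : 4 * ε * (w0 ^ 2 + w1 ^ 2 + w2 ^ 2 + lw ^ 2) ≤ S + 1 / 2 * Y := by
    have : 4 * ε * (K * (S + 1 / 2 * Y)) = S + 1 / 2 * Y := by rw [hε]; field_simp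
    rw [← this]; gcongr
  -- The square of k(w0 - (a/c₂)w1) + θ·lu is nonnegative, and its first part has square at most θY.
  -- The remaining θ/2·lu² is spent on the product u·lu; control of the second derivatives of `u` is
  -- left to the Hessian term `hu`.
  have hcross : -(1 / 2 * Y + θ / 2 * lu ^ 2) ≤ k * ((w0 - aH n p / c2 * w1) * lu) := by
    have h4 : (k * (w0 - aH n p / c2 * w1)) ^ 2 ≤ θ * Y := by
      rw [mul_pow]
      calc k ^ 2 * (w0 - aH n p / c2 * w1) ^ 2 ≤ k ^ 2 * (d4 n p c13 c2 β ^ 2 * Y) := by gcongr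
        _ = k ^ 2 * d4 n p c13 c2 β ^ 2 * Y := by ring
        _ ≤ θ * Y := by gcongr
    have h5 : 0 ≤ (k * (w0 - aH n p / c2 * w1) + θ * lu) ^ 2 := sq_nonneg _
    have h6 : 0 ≤ θ * (1 / 2 * Y + θ / 2 * lu ^ 2 + k * ((w0 - aH n p / c2 * w1) * lu)) := by
      linarith
    have := nonneg_of_mul_nonneg_right h6 hθ0
    linarith
  have y1 := neg_mul_le_young hε0 (-k) lw u
  have y2 := neg_mul_le_young hε0 (c130 n p c2 c13) w1 u
  have y3 := neg_mul_le_young (half_pos hθ0) (-(c2 * N1 * cH n p)) lu u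
  rw [neg_sq] at y1 y3
  have z1 : δ * (w0 ^ 2 + w1 ^ 2 + w2 ^ 2 + lw ^ 2) ≤ ε * (w0 ^ 2 + w1 ^ 2 + w2 ^ 2 + lw ^ 2) := by
    gcongr
  have z2 : δ * T ≤ N1 * T := by gcongr
  have z3 : δ * gw ≤ N1 * (2 * (c2 + 1 + aH n p) * gw) := by
    have : δ * gw ≤ N1 * gw := by gcongr
    have : 0 ≤ N1 * (2 * (c2 + aH n p) + 1) * gw := by positivity
    linarith
  have z4 : δ * gw1 ≤ N1 * (2 * gw1) := by
    have : δ * gw1 ≤ N1 * gw1 := by gcongr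
    have : 0 ≤ N1 * gw1 := by positivity
    linarith
  have z5 : δ * gu ≤ c2 * N1 * (2 * (1 + aH n p) * gu) := by
    have : δ * gu ≤ c2 * N1 * gu := by gcongr
    have : 0 ≤ c2 * N1 * (2 * aH n p + 1) * gu := by positivity
    linarith
  have z6 : δ * hu ≤ c2 * N1 * hu := by gcongr
  have z7 : 0 ≤ ε * (w0 ^ 2 + w1 ^ 2 + w2 ^ 2 + lw ^ 2) := by positivity
  have z8 : 0 ≤ ε * (w0 ^ 2 + w2 ^ 2) := by positivity
  have z9 : 0 ≤ u ^ 2 := sq_nonneg u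
  rw [hcN] at *
  have e1 : c2 * N1 * (((n : ℝ) - 2) * lu ^ 2) = θ * lu ^ 2 := by rw [hθ]; ring
  have e2 : (C + 1) * u ^ 2 = k ^ 2 / (4 * ε) * u ^ 2 + c130 n p c2 c13 ^ 2 / (4 * ε) * u ^ 2
    + (c2 * N1 * cH n p) ^ 2 / (4 * (θ / 2)) * u ^ 2 + u ^ 2 := by rw [hC]; ring
  rw [e2]
  linarith

end QuadraticForm

/-! ### Algebra of the angular gradient and Hessian, and their behaviour under ϑ. -/

section AngularAlgebra

variable {n : ℕ} {f g h : E n → ℝ} {x : E n} {U : Set (E n)}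

open Filter Topology

lemma ne_zero_of_mem (h0 : (0 : E n) ∉ U) (hx : x ∈ U) : x ≠ 0 := fun h => h0 (h ▸ hx)

lemma differentiableAt_rad (hU : IsOpen U) (hf : ContDiffOn ℝ 2 f U) (hx : x ∈ U) :
    DifferentiableAt ℝ (rad f) x :=
  differentiableAt_of_contDiffOn hU (contDiffOn_rad hU hf (m := 1) (by norm_num)) hx (by simp)

lemma differentiableAt_angD (hU : IsOpen U) (h0 : (0 : E n) ∉ U) (hf : ContDiffOn ℝ 2 f U)
    (hx : x ∈ U) (i : Fin n) : DifferentiableAt ℝ (angD i f) x :=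
  differentiableAt_of_contDiffOn hU (contDiffOn_angD hU h0 hf (m := 1) (by norm_num) i) hx (by simp)

lemma rad_comb (c : ℝ) (hf : DifferentiableAt ℝ f x) (hg : DifferentiableAt ℝ g x) :
    rad (fun y => f y + c * g y) x = rad f x + c * rad g x := by
  rw [rad_add hf (hg.const_mul c), rad_const_mul c hg]

lemma angD_comb (c : ℝ) (i : Fin n) (hf : DifferentiableAt ℝ f x) (hg : DifferentiableAt ℝ g x) :
    angD i (fun y => f y + c * g y) x = angD i f x + c * angD i g x := by
  rw [angD_add i hf (hg.const_mul c), angD_const_mul i c hg]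

lemma gradDot_comm (f g : E n → ℝ) (x : E n) : gradDot f g x = gradDot g f x := by
  simp only [gradDot, mul_comm]

lemma hessDot_comm (f g : E n → ℝ) (x : E n) : hessDot f g x = hessDot g f x := by
  simp only [hessDot, mul_comm]

lemma gradDot_comb (c : ℝ) (hf : DifferentiableAt ℝ f x) (hg : DifferentiableAt ℝ g x) :
    gradDot (fun y => f y + c * g y) h x = gradDot f h x + c * gradDot g h x := by
  simp only [gradDot, angD_comb c _ hf hg, add_mul, Finset.sum_add_distrib, Finset.mul_sum,
    mul_assoc]

lemma eventually_mem (hU : IsOpen U) (hx : x ∈ U) : ∀ᶠ y in 𝓝 x, y ∈ U := hU.mem_nhds hx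

lemma angD_angD_comb (hU : IsOpen U) (h0 : (0 : E n) ∉ U) (c : ℝ) (hf : ContDiffOn ℝ 2 f U)
    (hg : ContDiffOn ℝ 2 g U) (hx : x ∈ U) (i j : Fin n) :
    angD i (angD j fun y => f y + c * g y) x
      = angD i (angD j f) x + c * angD i (angD j g) x := by
  have e : angD j (fun y => f y + c * g y) =ᶠ[𝓝 x] fun y => angD j f y + c * angD j g y := by
    filter_upwards [eventually_mem hU hx] with y hy
    exact angD_comb c j (differentiableAt_of_contDiffOn hU hf hy (by simp))
      (differentiableAt_of_contDiffOn hU hg hy (by simp))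
  rw [(angD_congr i e).self_of_nhds]
  exact angD_comb c i (differentiableAt_angD hU h0 hf hx j) (differentiableAt_angD hU h0 hg hx j)

lemma angHess_comb (hU : IsOpen U) (h0 : (0 : E n) ∉ U) (c : ℝ) (hf : ContDiffOn ℝ 2 f U)
    (hg : ContDiffOn ℝ 2 g U) (hx : x ∈ U) (i j : Fin n) :
    angHess i j (fun y => f y + c * g y) x = angHess i j f x + c * angHess i j g x := by
  rw [angHess, angD_angD_comb hU h0 c hf hg hx,
    angD_comb c i (differentiableAt_of_contDiffOn hU hf hx (by simp))
      (differentiableAt_of_contDiffOn hU hg hx (by simp)), angHess, angHess]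
  ring

lemma angLap_comb (hU : IsOpen U) (h0 : (0 : E n) ∉ U) (c : ℝ) (hf : ContDiffOn ℝ 2 f U)
    (hg : ContDiffOn ℝ 2 g U) (hx : x ∈ U) :
    angLap (fun y => f y + c * g y) x = angLap f x + c * angLap g x := by
  simp only [angLap, angD_angD_comb hU h0 c hf hg hx, Finset.sum_add_distrib, Finset.mul_sum]

lemma hessDot_comb (hU : IsOpen U) (h0 : (0 : E n) ∉ U) (c : ℝ) (hf : ContDiffOn ℝ 2 f U)
    (hg : ContDiffOn ℝ 2 g U) (hx : x ∈ U) :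
    hessDot (fun y => f y + c * g y) h x = hessDot f h x + c * hessDot g h x := by
  simp only [hessDot, angHess_comb hU h0 c hf hg hx, add_mul, Finset.sum_add_distrib,
    Finset.mul_sum, mul_assoc]

/-- The first index comes from an outer angular derivative, which is tangential, so this slot needs
no regularity. -/
lemma sum_rdir_mul_angHess (f : E n → ℝ) (hx : x ≠ 0) (j : Fin n) :
    ∑ i, rdir i x * angHess i j f x = 0 := by
  have : ∀ i, rdir i x * angHess i j f x
      = rdir i x * angD i (angD j f) x + rdir j x * (rdir i x * angD i f x) := by
    intro i; simp only [angHess, rdir]; ring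
  simp only [this, Finset.sum_add_distrib, ← Finset.mul_sum, sum_rdir_mul_angD _ hx]
  ring

/-- Tangency in the second slot follows by differentiating the relation that the gradient is
orthogonal to the radial direction; the correction term in `angHess` is exactly what this produces.
-/
lemma sum_angHess_mul_rdir (hU : IsOpen U) (h0 : (0 : E n) ∉ U) (hf : ContDiffOn ℝ 2 f U)
    (hx : x ∈ U) (i : Fin n) : ∑ j, angHess i j f x * rdir j x = 0 := by
  have hx0 := ne_zero_of_mem h0 hx
  have h1 : angD i (fun y => ∑ j, rdir j y * angD j f y) x = 0 := by
    have e : (fun y => ∑ j, rdir j y * angD j f y) =ᶠ[𝓝 x] fun _ => 0 := by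
      filter_upwards [eventually_mem hU hx] with y hy
      exact sum_rdir_mul_angD f (ne_zero_of_mem h0 hy)
    rw [(angD_congr i e).self_of_nhds]
    simp [angD, pd, rad]
  have hd : ∀ j ∈ Finset.univ, DifferentiableAt ℝ (fun y => rdir j y * angD j f y) x := fun j _ =>
    (differentiableAt_rdir j hx0).fun_mul (differentiableAt_angD hU h0 hf hx j)
  rw [angD_sum i _ hd] at h1
  have h2 : ∀ j, angD i (fun y => rdir j y * angD j f y) x
      = (if i = j then angD j f x else 0) - rdir i x * (rdir j x * angD j f x)
        + rdir j x * angD i (angD j f) x := by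
    intro j
    rw [angD_mul i (differentiableAt_rdir j hx0) (differentiableAt_angD hU h0 hf hx j),
      angD_rdir i j hx0]
    split_ifs <;> ring
  simp only [h2, Finset.sum_add_distrib, Finset.sum_sub_distrib, ← Finset.mul_sum,
    sum_rdir_mul_angD _ hx0, Finset.sum_ite_eq, Finset.mem_univ, if_true] at h1
  have h3 : ∀ j, angHess i j f x * rdir j x
      = rdir j x * angD i (angD j f) x + rdir j x ^ 2 * angD i f x := by
    intro j; simp only [angHess, rdir]; ring
  simp only [h3, Finset.sum_add_distrib, ← Finset.sum_mul, sum_rdir_sq hx0]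
  linarith

lemma sum_angHess_self (f : E n → ℝ) (hx : x ≠ 0) : ∑ i, angHess i i f x = angLap f x := by
  have h := sum_rdir_mul_angD f hx
  simp only [rdir] at h
  simp only [angHess, angLap, Finset.sum_add_distrib, h, add_zero]

/-- Components of the metric of the unit sphere. -/
def sphMetric (i j : Fin n) (x : E n) : ℝ := (if i = j then 1 else 0) - rdir i x * rdir j x

lemma sum_sphMetric_mul_angHess (f : E n → ℝ) (hx : x ≠ 0) :
    ∑ i, ∑ j, angHess i j f x * sphMetric i j x = angLap f x := by
  have h1 : ∀ i j, angHess i j f x * sphMetric i j x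
      = (if i = j then angHess i j f x else 0) - rdir j x * (rdir i x * angHess i j f x) := by
    intro i j; simp only [sphMetric]; split_ifs <;> ring
  simp only [h1, Finset.sum_sub_distrib]
  rw [Finset.sum_comm (f := fun i j => rdir j x * (rdir i x * angHess i j f x))]
  simp only [← Finset.mul_sum, sum_rdir_mul_angHess f hx, Finset.sum_ite_eq, Finset.mem_univ,
    if_true, sum_angHess_self f hx]
  simp

lemma sum_sphMetric_self (hx : x ≠ 0) : ∑ i, sphMetric i i x = (n : ℝ) - 1 := by
  have h1 : ∀ i, sphMetric i i x = 1 - rdir i x ^ 2 := by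
    intro i; simp only [sphMetric, if_true]; ring
  simp [h1, Finset.sum_sub_distrib, sum_rdir_sq hx]

lemma sum_sphMetric_mul (x : E n) (v : Fin n → ℝ) (i : Fin n) :
    ∑ j, sphMetric i j x * v j = v i - rdir i x * ∑ j, rdir j x * v j := by
  have h1 : ∀ j, sphMetric i j x * v j
      = (if i = j then v j else 0) - rdir i x * (rdir j x * v j) := by
    intro j; simp only [sphMetric]; split_ifs <;> ring
  simp only [h1, Finset.sum_sub_distrib, ← Finset.mul_sum, Finset.sum_ite_eq, Finset.mem_univ,
    if_true]

lemma sum_sphMetric_sq (hx : x ≠ 0) : ∑ i, ∑ j, sphMetric i j x ^ 2 = (n : ℝ) - 1 := by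
  rw [← sum_sphMetric_self hx]
  refine Finset.sum_congr rfl fun i _ => ?_
  simp only [sq, sum_sphMetric_mul x]
  have : ∑ j, rdir j x * sphMetric i j x = 0 := by
    have e : ∀ j, rdir j x * sphMetric i j x = sphMetric i j x * rdir j x := fun j => mul_comm _ _
    simp only [e, sum_sphMetric_mul x, ← sq, sum_rdir_sq hx]
    ring
  rw [this]; ring

/-- Expand |A - tg|²: the metric g of the sphere has |g|² = n - 1 and pairs with the Hessian to its
trace, and t = tr A/(n-1). -/
lemma hessTracelessSq_eq (hn : (n : ℝ) - 1 ≠ 0) (f : E n → ℝ) (hx : x ≠ 0) :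
    hessTracelessSq f x = hessSq f x - angLap f x ^ 2 / ((n : ℝ) - 1) := by
  set t := angLap f x / ((n : ℝ) - 1) with ht
  have hn0 : ‖x‖ ≠ 0 := norm_ne_zero_iff.2 hx
  have h1 : ∀ i j : Fin n, (angHess i j f x - t * ((if i = j then 1 else 0) - x i * x j / ‖x‖ ^ 2)) ^ 2
      = angHess i j f x ^ 2 - 2 * t * (angHess i j f x * sphMetric i j x)
        + t ^ 2 * sphMetric i j x ^ 2 := by
    intro i j
    have : x i * x j / ‖x‖ ^ 2 = rdir i x * rdir j x := by simp only [rdir]; field_simp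
    rw [this, ← sphMetric]; ring
  simp only [hessTracelessSq, ← ht, h1, Finset.sum_add_distrib, Finset.sum_sub_distrib,
    ← Finset.mul_sum, sum_sphMetric_mul_angHess f hx, sum_sphMetric_sq hx]
  rw [hessSq, ht]; field_simp; ring

lemma hessTracelessSq_nonneg (f : E n → ℝ) (x : E n) : 0 ≤ hessTracelessSq f x :=
  Finset.sum_nonneg fun _ _ => Finset.sum_nonneg fun _ _ => sq_nonneg _

lemma hessSq_nonneg (f : E n → ℝ) (x : E n) : 0 ≤ hessSq f x :=
  Finset.sum_nonneg fun _ _ => Finset.sum_nonneg fun _ _ => sq_nonneg _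

lemma gradSq_nonneg (f : E n → ℝ) (x : E n) : 0 ≤ gradSq f x := by
  rw [gradSq, gradDot]
  exact Finset.sum_nonneg fun i _ => mul_self_nonneg _

/-- Nonnegativity of the traceless part gives the constant n - 1; the rounder n is enough. -/
lemma angLap_sq_le (hn : 3 ≤ n) (f : E n → ℝ) (hx : x ≠ 0) :
    angLap f x ^ 2 ≤ n * hessSq f x := by
  have hn1 : 0 < (n : ℝ) - 1 := by linarith [one_le_sub_two hn]
  have h := hessTracelessSq_nonneg f x
  rw [hessTracelessSq_eq hn1.ne' f hx, sub_nonneg, div_le_iff₀ hn1] at h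
  nlinarith [hessSq_nonneg f x]

/-! ### Radial derivatives of angular expressions -/

lemma rad_angD_eventually (hU : IsOpen U) (h0 : (0 : E n) ∉ U) (hf : ContDiffOn ℝ 2 f U)
    (hx : x ∈ U) (i : Fin n) : rad (angD i f) =ᶠ[𝓝 x] angD i (rad f) := by
  filter_upwards [eventually_mem hU hx] with y hy using rad_angD hU h0 hf hy i

lemma rad_angD_angD (hU : IsOpen U) (h0 : (0 : E n) ∉ U) (hf : ContDiffOn ℝ 3 f U)
    (hx : x ∈ U) (i j : Fin n) : rad (angD i (angD j f)) x = angD i (angD j (rad f)) x := by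
  rw [rad_angD hU h0 (contDiffOn_angD hU h0 hf (by norm_num) j) hx,
    (angD_congr i (rad_angD_eventually hU h0 (hf.of_le (by norm_num)) hx j)).self_of_nhds]

lemma rad_angHess (hU : IsOpen U) (h0 : (0 : E n) ∉ U) (hf : ContDiffOn ℝ 3 f U)
    (hx : x ∈ U) (i j : Fin n) : rad (angHess i j f) x = angHess i j (rad f) x := by
  have hx0 := ne_zero_of_mem h0 hx
  have hf2 : ContDiffOn ℝ 2 f U := hf.of_le (by norm_num)
  have e : angHess i j f = fun y => angD i (angD j f) y + rdir j y * angD i f y := rfl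
  rw [e, rad_add (differentiableAt_angD hU h0 (contDiffOn_angD hU h0 hf (by norm_num) j) hx i)
    ((differentiableAt_rdir j hx0).fun_mul (differentiableAt_angD hU h0 hf2 hx i)),
    rad_angD_angD hU h0 hf hx, rad_mul (differentiableAt_rdir j hx0)
      (differentiableAt_angD hU h0 hf2 hx i), rad_rdir j hx0, rad_angD hU h0 hf2 hx, angHess, rdir]
  ring

lemma rad_angLap (hU : IsOpen U) (h0 : (0 : E n) ∉ U) (hf : ContDiffOn ℝ 3 f U)
    (hx : x ∈ U) : rad (angLap f) x = angLap (rad f) x := by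
  have e : angLap f = fun y => ∑ i, angD i (angD i f) y := rfl
  rw [e, rad_sum]
  · simp only [rad_angD_angD hU h0 hf hx, angLap]
  · exact fun i _ => differentiableAt_angD hU h0 (contDiffOn_angD hU h0 hf (by norm_num) i) hx i

lemma rad_gradDot (hU : IsOpen U) (h0 : (0 : E n) ∉ U) (hf : ContDiffOn ℝ 2 f U)
    (hg : ContDiffOn ℝ 2 g U) (hx : x ∈ U) :
    rad (gradDot f g) x = gradDot (rad f) g x + gradDot f (rad g) x := by
  have e : gradDot f g = fun y => ∑ i, angD i f y * angD i g y := rfl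
  have hd := fun i => differentiableAt_angD hU h0 hf hx i
  have hd' := fun i => differentiableAt_angD hU h0 hg hx i
  rw [e, rad_sum _ fun i _ => (hd i).fun_mul (hd' i)]
  simp only [rad_mul (hd _) (hd' _), rad_angD hU h0 hf hx, rad_angD hU h0 hg hx,
    Finset.sum_add_distrib, gradDot]

lemma rad_hessDot (hU : IsOpen U) (h0 : (0 : E n) ∉ U) (hf : ContDiffOn ℝ 3 f U)
    (hg : ContDiffOn ℝ 3 g U) (hx : x ∈ U) :
    rad (hessDot f g) x = hessDot (rad f) g x + hessDot f (rad g) x := by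
  have e : hessDot f g = fun y => ∑ i, ∑ j, angHess i j f y * angHess i j g y := rfl
  have hd := fun i j => differentiableAt_of_contDiffOn hU
    (contDiffOn_angHess hU h0 hf (m := 1) (by norm_num) i j) hx (by simp)
  have hd' := fun i j => differentiableAt_of_contDiffOn hU
    (contDiffOn_angHess hU h0 hg (m := 1) (by norm_num) i j) hx (by simp)
  rw [e, rad_sum _ fun i _ => DifferentiableAt.fun_sum fun j _ => (hd i j).fun_mul (hd' i j)]
  simp only [rad_sum _ fun j _ => (hd _ j).fun_mul (hd' _ j), rad_mul (hd _ _) (hd' _ _),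
    rad_angHess hU h0 hf hx, rad_angHess hU h0 hg hx, Finset.sum_add_distrib, hessDot]

end AngularAlgebra

/-! ### Pointwise lower and upper bounds for the dissipation density by the shell densities. -/

section PointwiseCoercivity

variable {n : ℕ} {p : ℝ} {f g u : E n → ℝ} {x : E n} {U : Set (E n)}

open Filter Topology

lemma sq_add_le_two (s t : ℝ) : (s + t) ^ 2 ≤ 2 * s ^ 2 + 2 * t ^ 2 := by
  nlinarith [sq_nonneg (s - t)]

lemma gradSq_comb_le (c : ℝ) (hf : DifferentiableAt ℝ f x) (hg : DifferentiableAt ℝ g x) :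
    gradSq (fun y => f y + c * g y) x ≤ 2 * gradSq f x + 2 * c ^ 2 * gradSq g x := by
  simp only [gradSq, gradDot, angD_comb c _ hf hg, Finset.mul_sum, ← Finset.sum_add_distrib]
  refine Finset.sum_le_sum fun i _ => ?_
  nlinarith [sq_add_le_two (angD i f x) (c * angD i g x)]

lemma hessSq_comb_le (hU : IsOpen U) (h0 : (0 : E n) ∉ U) (c : ℝ) (hf : ContDiffOn ℝ 2 f U)
    (hg : ContDiffOn ℝ 2 g U) (hx : x ∈ U) :
    hessSq (fun y => f y + c * g y) x ≤ 2 * hessSq f x + 2 * c ^ 2 * hessSq g x := by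
  simp only [hessSq, angHess_comb hU h0 c hf hg hx, Finset.mul_sum, ← Finset.sum_add_distrib]
  refine Finset.sum_le_sum fun i _ => Finset.sum_le_sum fun j _ => ?_
  nlinarith [sq_add_le_two (angHess i j f x) (c * angHess i j g x)]

lemma rad_eq_harm (p : ℝ) (u : E n → ℝ) : rad u = fun y => harm p u y + (-aH n p) * u y := by
  funext y; rw [harm]; ring

lemma contDiffOn_harm {k m : WithTop ℕ∞} (hU : IsOpen U) (hu : ContDiffOn ℝ k u U)
    (hk : m + 1 ≤ k) : ContDiffOn ℝ m (harm p u) U :=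
  (contDiffOn_rad hU hu hk).add (contDiffOn_const.mul (hu.of_le (le_self_add.trans hk)))

lemma rad_harm (hU : IsOpen U) (hu : ContDiffOn ℝ 2 u U) (hx : x ∈ U) :
    rad (harm p u) x = rad (rad u) x + aH n p * rad u x :=
  rad_comb _ (differentiableAt_rad hU hu hx) (differentiableAt_of_contDiffOn hU hu hx (by simp))

lemma rad_harm_eventually (hU : IsOpen U) (hu : ContDiffOn ℝ 2 u U) (hx : x ∈ U) :
    rad (harm p u) =ᶠ[𝓝 x] fun y => rad (rad u) y + aH n p * rad u y := by
  filter_upwards [eventually_mem hU hx] with y hy using rad_harm hU hu hy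

lemma rad_rad_harm (hU : IsOpen U) (hu : ContDiffOn ℝ 3 u U) (hx : x ∈ U) :
    rad (rad (harm p u)) x = rad (rad (rad u)) x + aH n p * rad (rad u) x := by
  have hr : ContDiffOn ℝ 2 (rad u) U := contDiffOn_rad hU hu (by norm_num)
  rw [(rad_congr (rad_harm_eventually hU (hu.of_le (by norm_num)) hx)).self_of_nhds]
  exact rad_comb _ (differentiableAt_rad hU hr hx)
    (differentiableAt_of_contDiffOn hU hr hx (by simp))

lemma shellDensity_nonneg (u : E n → ℝ) (x : E n) : 0 ≤ shellDensity u x := by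
  have := gradSq_nonneg u x
  have := gradSq_nonneg (rad u) x
  have := hessSq_nonneg u x
  unfold shellDensity h2Density; positivity

/-- The density of `‖ϑu‖² + ‖u‖²` is controlled by `u` and `w = (ϑ + a)u`. -/
lemma shellDensity_le (hU : IsOpen U) (h0 : (0 : E n) ∉ U) (hu : ContDiffOn ℝ 3 u U)
    (hx : x ∈ U) :
    shellDensity (rad u) x + shellDensity u x
      ≤ 16 * (1 + aH n p ^ 2) ^ 3 * (u x ^ 2 + (harm p u x ^ 2 + rad (harm p u) x ^ 2
        + rad (rad (harm p u)) x ^ 2 + hessSq (harm p u) x + gradSq (harm p u) x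
        + gradSq (rad (harm p u)) x + gradSq u x + hessSq u x)) := by
  have hu2 : ContDiffOn ℝ 2 u U := hu.of_le (by norm_num)
  have hr : ContDiffOn ℝ 2 (rad u) U := contDiffOn_rad hU hu (by norm_num)
  have hw : ContDiffOn ℝ 2 (harm p u) U := contDiffOn_harm hU hu (by norm_num)
  have hux := differentiableAt_of_contDiffOn hU hu hx (by simp)
  have hrx := differentiableAt_of_contDiffOn hU hr hx (by simp)
  have hwx := differentiableAt_of_contDiffOn hU hw hx (by simp)
  have hwrx := differentiableAt_rad hU hw hx
  have hh1 : hessSq (rad u) x ≤ 2 * hessSq (harm p u) x + 2 * aH n p ^ 2 * hessSq u x := by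
    have := hessSq_comb_le hU h0 (-aH n p) hw hu2 hx
    rwa [← rad_eq_harm, neg_sq] at this
  have hg1 : gradSq (rad u) x ≤ 2 * gradSq (harm p u) x + 2 * aH n p ^ 2 * gradSq u x := by
    have := gradSq_comb_le (-aH n p) hwx hux
    rwa [← rad_eq_harm, neg_sq] at this
  have e2 : rad (rad u) =ᶠ[𝓝 x] fun y => rad (harm p u) y + (-aH n p) * rad u y := by
    filter_upwards [rad_harm_eventually (p := p) hU hu2 hx] with y hy
    rw [hy]; ring
  have hg2 : gradSq (rad (rad u)) x
      ≤ 2 * gradSq (rad (harm p u)) x + 2 * aH n p ^ 2 * gradSq (rad u) x := by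
    have := gradSq_comb_le (-aH n p) hwrx hrx
    rwa [← (gradSq_congr e2).self_of_nhds, neg_sq] at this
  have hu1 : rad u x = harm p u x - aH n p * u x := by rw [harm]; ring
  have hu2' : rad (rad u) x = rad (harm p u) x - aH n p * rad u x := by
    rw [rad_harm hU hu2 hx]; ring
  have hu3 : rad (rad (rad u)) x = rad (rad (harm p u)) x - aH n p * rad (rad u) x := by
    rw [rad_rad_harm hU hu hx]; ring
  unfold shellDensity h2Density
  have q := fun (s t : ℝ) => (show (s - aH n p * t) ^ 2 ≤ 2 * s ^ 2 + 2 * aH n p ^ 2 * t ^ 2 by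
    nlinarith [sq_nonneg (s + aH n p * t)])
  have q1 := q (harm p u x) (u x)
  have q2 := q (rad (harm p u) x) (rad u x)
  have q3 := q (rad (rad (harm p u)) x) (rad (rad u) x)
  rw [← hu1] at q1
  rw [← hu2'] at q2
  rw [← hu3] at q3
  have n1 := gradSq_nonneg u x
  have n2 := gradSq_nonneg (harm p u) x
  have n3 := gradSq_nonneg (rad (harm p u)) x
  have n4 := hessSq_nonneg u x
  have n5 := hessSq_nonneg (harm p u) x
  -- From here on only nonnegative quantities related by linear inequalities matter, so each becomes
  -- an atom.
  generalize gradSq u x = G0 at *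
  generalize gradSq (harm p u) x = G1 at *
  generalize gradSq (rad (harm p u)) x = G2 at *
  generalize gradSq (rad u) x = K1 at *
  generalize gradSq (rad (rad u)) x = K2 at *
  generalize hessSq u x = H0 at *
  generalize hessSq (harm p u) x = H1 at *
  generalize hessSq (rad u) x = J1 at *
  generalize rad u x ^ 2 = U1 at *
  generalize rad (rad u) x ^ 2 = U2 at *
  generalize rad (rad (rad u)) x ^ 2 = U3 at *
  have m0 := sq_nonneg (u x)
  have m1 := sq_nonneg (harm p u x)
  have m2 := sq_nonneg (rad (harm p u) x)
  have m3 := sq_nonneg (rad (rad (harm p u)) x)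
  generalize u x ^ 2 = W at *
  generalize harm p u x ^ 2 = W0 at *
  generalize rad (harm p u) x ^ 2 = W1 at *
  generalize rad (rad (harm p u)) x ^ 2 = W2 at *
  have hb : 0 ≤ aH n p ^ 2 := sq_nonneg _
  generalize aH n p ^ 2 = b at *
  set S := W + (W0 + W1 + W2 + H1 + G1 + G2 + G0 + H0) with hS
  have b1 : U1 + K1 + J1 ≤ 2 * (1 + b) * (W + W0 + H1 + G1 + G0 + H0) := by nlinarith
  have b2 : U2 + K2 ≤ 2 * W1 + 2 * G2 + 2 * b * (U1 + K1) := by nlinarith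
  have hJ : 0 ≤ 2 * (1 + b) * (W + W0 + H1 + G1 + G0 + H0) := by positivity
  have b1' : U1 + K1 ≤ 2 * (1 + b) * (W + W0 + G1 + G0) := by nlinarith
  have b1S : U1 + K1 + J1 ≤ 2 * (1 + b) * S :=
    b1.trans (mul_le_mul_of_nonneg_left (by linarith) (by positivity))
  have b1S' : U1 + K1 ≤ 2 * (1 + b) * S :=
    b1'.trans (mul_le_mul_of_nonneg_left (by linarith) (by positivity))
  have hS0 : 0 ≤ S := by positivity
  -- The bounds are iterated along u, ϑu, ϑ²u, ϑ³u: each recursion through ϑ = (ϑ + a) - a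
  -- multiplies by 2b, with b = a². Three radial derivatives lead to the power (1 + b)³.
  have b2S : U2 + K2 ≤ 2 * S + 2 * b * (2 * (1 + b) * S) := by
    have := mul_le_mul_of_nonneg_left b1S' (by positivity : 0 ≤ 2 * b)
    linarith
  have b2S' : U2 ≤ 2 * S + 2 * b * (2 * (1 + b) * S) := by
    have : U2 ≤ 2 * W1 + 2 * b * U1 := q2
    have h1 : U1 ≤ 2 * (1 + b) * S := by
      refine q1.trans ?_
      have : 2 * W0 + 2 * b * W ≤ 2 * (1 + b) * (W0 + W) := by nlinarith
      exact this.trans (mul_le_mul_of_nonneg_left (by linarith) (by positivity))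
    have := mul_le_mul_of_nonneg_left h1 (by positivity : 0 ≤ 2 * b)
    linarith
  have b3S : U3 ≤ 2 * S + 2 * b * (2 * S + 2 * b * (2 * (1 + b) * S)) := by
    have := mul_le_mul_of_nonneg_left b2S' (by positivity : 0 ≤ 2 * b)
    linarith
  have hbS : 0 ≤ b * S := by positivity
  have hbbS : 0 ≤ b * (b * S) := by positivity
  have hbbbS : 0 ≤ b * (b * (b * S)) := by positivity
  nlinarith

/-- Once the form is expanded into monomials, each product of two variables is at most B, so the sum
of the absolute coefficients serves as K. Only integrability of the dissipation density is at stake.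
-/
lemma exists_quadratic_bound (k1 k2 k3 k4 k5 k6 k7 k8 k9 k10 k11 k12 k13 k14 k15 : ℝ) :
    ∃ K : ℝ, ∀ B u w0 w1 w2 lw lu T gw gw1 gu hu : ℝ, u ^ 2 ≤ B → w0 ^ 2 ≤ B → w1 ^ 2 ≤ B →
      w2 ^ 2 ≤ B → lw ^ 2 ≤ B → lu ^ 2 ≤ B → |T| ≤ B → |gw| ≤ B → |gw1| ≤ B → |gu| ≤ B →
      |hu| ≤ B →
      |k1 * (T + 2 * gw1 + k2 * gw)
          + ((w2 + k3 * lw) ^ 2 + k1 * lw ^ 2 + k4 * (w1 * lw) + k5 * w1 ^ 2 - k6 * (w0 * lw)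
            + k7 * (w0 * w1) + k8 * w0 ^ 2)
          + (k9 * ((w0 - k10 * w1) * lu - lw * u) + k11 * (w1 * u))
          + k12 * (k13 * lu ^ 2 + hu + k14 * gu - k15 * (u * lu))| ≤ K * B := by
  have hm : ∀ B s t : ℝ, s ^ 2 ≤ B → t ^ 2 ≤ B → |s * t| ≤ B := fun B s t hs ht => by
    rw [abs_le]; constructor <;> nlinarith [sq_nonneg (s + t), sq_nonneg (s - t)]
  have hc : ∀ B k m : ℝ, |m| ≤ B → |k * m| ≤ |k| * B := fun B k m h => by
    rw [abs_mul]; exact mul_le_mul_of_nonneg_left h (abs_nonneg k)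
  refine ⟨|k1| + |2 * k1| + |k1 * k2| + |(1 : ℝ)| + |2 * k3| + |k3 ^ 2 + k1| + |k4| + |k5| + |-k6|
    + |k7| + |k8| + |k9| + |-(k9 * k10)| + |-k9| + |k11| + |k12 * k13| + |k12| + |k12 * k14|
    + |-(k12 * k15)|, ?_⟩
  intro B u w0 w1 w2 lw lu T gw gw1 gu hu h1 h2 h3 h4 h5 h6 h7 h8 h9 h10 h11
  have e : k1 * (T + 2 * gw1 + k2 * gw)
          + ((w2 + k3 * lw) ^ 2 + k1 * lw ^ 2 + k4 * (w1 * lw) + k5 * w1 ^ 2 - k6 * (w0 * lw)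
            + k7 * (w0 * w1) + k8 * w0 ^ 2)
          + (k9 * ((w0 - k10 * w1) * lu - lw * u) + k11 * (w1 * u))
          + k12 * (k13 * lu ^ 2 + hu + k14 * gu - k15 * (u * lu))
      = k1 * T + 2 * k1 * gw1 + k1 * k2 * gw + 1 * (w2 * w2) + 2 * k3 * (w2 * lw)
        + (k3 ^ 2 + k1) * (lw * lw) + k4 * (w1 * lw) + k5 * (w1 * w1) + -k6 * (w0 * lw)
        + k7 * (w0 * w1) + k8 * (w0 * w0) + k9 * (w0 * lu) + -(k9 * k10) * (w1 * lu)
        + -k9 * (lw * u) + k11 * (w1 * u) + k12 * k13 * (lu * lu) + k12 * hu + k12 * k14 * gu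
        + -(k12 * k15) * (u * lu) := by ring
  rw [e]
  simp only [add_mul _ _ B]
  refine (abs_add_le _ _).trans (add_le_add ?_ (hc _ _ _ (hm _ _ _ h1 h6)))
  refine (abs_add_le _ _).trans (add_le_add ?_ (hc _ _ _ h10))
  refine (abs_add_le _ _).trans (add_le_add ?_ (hc _ _ _ h11))
  refine (abs_add_le _ _).trans (add_le_add ?_ (hc _ _ _ (hm _ _ _ h6 h6)))
  refine (abs_add_le _ _).trans (add_le_add ?_ (hc _ _ _ (hm _ _ _ h3 h1)))
  refine (abs_add_le _ _).trans (add_le_add ?_ (hc _ _ _ (hm _ _ _ h5 h1)))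
  refine (abs_add_le _ _).trans (add_le_add ?_ (hc _ _ _ (hm _ _ _ h3 h6)))
  refine (abs_add_le _ _).trans (add_le_add ?_ (hc _ _ _ (hm _ _ _ h2 h6)))
  refine (abs_add_le _ _).trans (add_le_add ?_ (hc _ _ _ (hm _ _ _ h2 h2)))
  refine (abs_add_le _ _).trans (add_le_add ?_ (hc _ _ _ (hm _ _ _ h2 h3)))
  refine (abs_add_le _ _).trans (add_le_add ?_ (hc _ _ _ (hm _ _ _ h2 h5)))
  refine (abs_add_le _ _).trans (add_le_add ?_ (hc _ _ _ (hm _ _ _ h3 h3)))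
  refine (abs_add_le _ _).trans (add_le_add ?_ (hc _ _ _ (hm _ _ _ h3 h5)))
  refine (abs_add_le _ _).trans (add_le_add ?_ (hc _ _ _ (hm _ _ _ h5 h5)))
  refine (abs_add_le _ _).trans (add_le_add ?_ (hc _ _ _ (hm _ _ _ h4 h5)))
  refine (abs_add_le _ _).trans (add_le_add ?_ (hc _ _ _ (hm _ _ _ h4 h4)))
  refine (abs_add_le _ _).trans (add_le_add ?_ (hc _ _ _ h8))
  exact (abs_add_le _ _).trans (add_le_add (hc _ _ _ h7) (hc _ _ _ h9))

/-- The integrand of `dissipationForm`. -/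
def psiDensity (p c2 c13 β : ℝ) (u : E n → ℝ) (x : E n) : ℝ :=
  psiTen p c2 (harm p u) x + psiSca p c2 c13 β (harm p u) x
    + psiBil p c2 c13 u (harm p u) x + c2 / ((n : ℝ) - 1) * harmonicForm p u x

lemma exists_psiDensity_bound (hn : 3 ≤ n) (p c2 c13 β : ℝ) :
    ∃ K : ℝ, ∀ (U : Set (E n)), IsOpen U → (0 : E n) ∉ U → ∀ u : E n → ℝ, ContDiffOn ℝ 3 u U →
      ∀ x ∈ U, |psiDensity p c2 c13 β u x|
        ≤ K * (shellDensity (rad u) x + shellDensity u x) := by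
  obtain ⟨K, hK⟩ := exists_quadratic_bound (1 / ((n : ℝ) - 1)) (2 * (c2 + 1 + aH n p))
    (((n : ℝ) - 2) / ((n : ℝ) - 1)) (2 * (cH n p / aH n p + ((n : ℝ) - 2) * β) / ((n : ℝ) - 1))
    (c2 + bH n p + aH n p * (aH n p - β)) (1 / ((n : ℝ) - 1) * (2 * ((n : ℝ) - 2) * c2
          + (2 * aH n p - β) * (cH n p / aH n p))) (2 * (β - aH n p) * c2)
    (c130 n p c2 c13 + c2 * bH n p) (c2 * cH n p / (((n : ℝ) - 1) * aH n p)) (aH n p / c2)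
    (c130 n p c2 c13) (c2 / ((n : ℝ) - 1)) ((n : ℝ) - 2) (2 * (1 + aH n p)) (cH n p)
  -- The factor 2(1 + a²) comes from expanding w = ϑu + au in squares, and n from bounding the
  -- squared Laplacian by the squared Hessian.
  refine ⟨K * (2 * (1 + aH n p ^ 2) * n), fun U hU h0 u hu x hx => ?_⟩
  have hn1 : (1 : ℝ) ≤ n := by linarith [one_le_sub_two hn]
  have hnm : 0 < (n : ℝ) - 1 := by linarith [one_le_sub_two hn]
  have hx0 := ne_zero_of_mem h0 hx
  have hu2 : ContDiffOn ℝ 2 u U := hu.of_le (by norm_num)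
  have hr : ContDiffOn ℝ 2 (rad u) U := contDiffOn_rad hU hu (by norm_num)
  have hux := differentiableAt_of_contDiffOn hU hu hx (by simp)
  have hrx := differentiableAt_of_contDiffOn hU hr hx (by simp)
  have hrrx := differentiableAt_rad hU hr hx
  have hN : shellDensity (rad u) x + shellDensity u x = rad (rad (rad u)) x ^ 2
    + (rad (rad u) x ^ 2 + gradSq (rad (rad u)) x)
    + (rad u x ^ 2 + gradSq (rad u) x + hessSq (rad u) x) + (rad (rad u) x ^ 2
    + (rad u x ^ 2 + gradSq (rad u) x) + (u x ^ 2 + gradSq u x + hessSq u x)) := rfl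
  set N := shellDensity (rad u) x + shellDensity u x with hNdef
  have n0 := gradSq_nonneg u x
  have n1 := gradSq_nonneg (rad u) x
  have n2 := gradSq_nonneg (rad (rad u)) x
  have n3 := hessSq_nonneg u x
  have n4 := hessSq_nonneg (rad u) x
  have m0 := sq_nonneg (u x)
  have m1 := sq_nonneg (rad u x)
  have m2 := sq_nonneg (rad (rad u) x)
  have m3 := sq_nonneg (rad (rad (rad u)) x)
  have hN0 : 0 ≤ N := by rw [hN]; positivity
  set D := 2 * (1 + aH n p ^ 2) * N with hD
  have hD0 : 0 ≤ D := by positivity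
  have hDB : D ≤ 2 * (1 + aH n p ^ 2) * n * N := by
    have : D * 1 ≤ D * n := mul_le_mul_of_nonneg_left hn1 hD0
    calc D = D * 1 := (mul_one D).symm
      _ ≤ D * n := this
      _ = _ := by rw [hD]; ring
  have key : ∀ s t : ℝ, 0 ≤ s → 0 ≤ t → s ≤ N → t ≤ N → 2 * s + 2 * aH n p ^ 2 * t ≤ D := by
    intro s t _ _ hs ht
    have := mul_le_mul_of_nonneg_left ht (by positivity : 0 ≤ 2 * aH n p ^ 2)
    rw [hD]; linarith
  have le1 : ∀ s, s ≤ N → s ≤ D := by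
    intro s hs
    have : 0 ≤ aH n p ^ 2 * N := by positivity
    rw [hD]; linarith
  have q := fun (s t : ℝ) => (show (s + aH n p * t) ^ 2 ≤ 2 * s ^ 2 + 2 * aH n p ^ 2 * t ^ 2 by
    nlinarith [sq_nonneg (s - aH n p * t)])
  have hw0 : harm p u x ^ 2 ≤ D := (q _ _).trans (key _ _ m1 m0 (by linarith) (by linarith))
  have hw1 : rad (harm p u) x ^ 2 ≤ D := by
    rw [rad_harm hU hu2 hx]
    exact (q _ _).trans (key _ _ m2 m1 (by linarith) (by linarith))
  have hw2 : rad (rad (harm p u)) x ^ 2 ≤ D := by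
    rw [rad_rad_harm hU hu hx]
    exact (q _ _).trans (key _ _ m3 m2 (by linarith) (by linarith))
  have hhw : hessSq (harm p u) x ≤ D := (hessSq_comb_le hU h0 _ hr hu2 hx).trans
    (key _ _ n4 n3 (by linarith) (by linarith))
  have hgw : gradSq (harm p u) x ≤ D := (gradSq_comb_le _ hrx hux).trans
    (key _ _ n1 n0 (by linarith) (by linarith))
  have hgw1 : gradSq (rad (harm p u)) x ≤ D := by
    rw [(gradSq_congr (rad_harm_eventually hU hu2 hx)).self_of_nhds]
    exact (gradSq_comb_le _ hrrx hrx).trans (key _ _ n2 n1 (by linarith) (by linarith))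
  have hT : hessTracelessSq (harm p u) x ≤ D := by
    rw [hessTracelessSq_eq hnm.ne' _ hx0]
    have : 0 ≤ angLap (harm p u) x ^ 2 / ((n : ℝ) - 1) := by positivity
    linarith
  have hnD : (n : ℝ) * D = 2 * (1 + aH n p ^ 2) * n * N := by rw [hD]; ring
  have hlw : angLap (harm p u) x ^ 2 ≤ 2 * (1 + aH n p ^ 2) * n * N := by
    rw [← hnD]
    exact (angLap_sq_le hn _ hx0).trans (mul_le_mul_of_nonneg_left hhw (by linarith))
  have hlu : angLap u x ^ 2 ≤ 2 * (1 + aH n p ^ 2) * n * N := by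
    rw [← hnD]
    exact (angLap_sq_le hn _ hx0).trans
      (mul_le_mul_of_nonneg_left (le1 _ (by linarith)) (by linarith))
  have ab : ∀ s, 0 ≤ s → s ≤ D → |s| ≤ 2 * (1 + aH n p ^ 2) * n * N := fun s h h' => by
    rw [abs_of_nonneg h]; exact h'.trans hDB
  have := hK (2 * (1 + aH n p ^ 2) * n * N) (u x) (harm p u x) (rad (harm p u) x)
    (rad (rad (harm p u)) x) (angLap (harm p u) x) (angLap u x) (hessTracelessSq (harm p u) x)
    (gradSq (harm p u) x) (gradSq (rad (harm p u)) x) (gradSq u x) (hessSq u x)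
    ((le1 _ (by linarith)).trans hDB) (hw0.trans hDB) (hw1.trans hDB) (hw2.trans hDB) hlw hlu
    (ab _ (hessTracelessSq_nonneg _ _) hT) (ab _ (gradSq_nonneg _ _) hgw)
    (ab _ (gradSq_nonneg _ _) hgw1) (ab _ n0 (le1 _ (by linarith)))
    (ab _ n3 (le1 _ (by linarith)))
  rw [mul_assoc K]
  exact this

lemma exists_psiDensity_coercive_at (hn : 3 ≤ n) (hp : p < (n : ℝ) - 2) {c2 c13 β : ℝ}
    (hA : Admissible n p c2 c13) (hβ : β ∈ ({aH n p, 2 * aH n p} : Set ℝ)) :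
    ∃ δ > 0, ∃ C > 0, ∀ (U : Set (E n)), IsOpen U → (0 : E n) ∉ U → ∀ u : E n → ℝ,
      ContDiffOn ℝ 3 u U → ∀ x ∈ U, δ * (shellDensity (rad u) x + shellDensity u x)
        ≤ psiDensity p c2 c13 β u x + C * u x ^ 2 := by
  have hd := d3_pos hn hp (hA.2 _ (by simp : 2 * aH n p ∈ ({aH n p, 2 * aH n p} : Set ℝ))).1 hβ
  obtain ⟨h2, h3, h6⟩ := hA.2 β hβ
  have hnm : 0 < (n : ℝ) - 1 := by linarith [one_le_sub_two hn]
  obtain ⟨δ, hδ, C, hC, hle⟩ := exists_quadratic_coercive hn hp hA.1 h2 h3 hd h6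
  set K := 16 * (1 + aH n p ^ 2) ^ 3 with hK
  have hK0 : 0 < K := by positivity
  -- The comparison `shellDensity_le` has u² on its right side, while the coercive form does not
  -- control it; the extra δ supplies it.
  refine ⟨δ / K, by positivity, C + δ, by positivity, fun U hU h0 u hu x hx => ?_⟩
  have hx0 := ne_zero_of_mem h0 hx
  have h := hle (u x) (harm p u x) (rad (harm p u) x) (rad (rad (harm p u)) x)
    (angLap (harm p u) x) (angLap u x) (hessTracelessSq (harm p u) x) (gradSq (harm p u) x)
    (gradSq (rad (harm p u)) x) (gradSq u x) (hessSq u x) (hessTracelessSq_nonneg _ _)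
    (gradSq_nonneg _ _) (gradSq_nonneg _ _) (gradSq_nonneg _ _) (hessSq_nonneg _ _)
  have hs := shellDensity_le (p := p) hU h0 hu hx
  have hT := hessTracelessSq_eq hnm.ne' (harm p u) hx0
  -- For `w` the form controls the traceless Hessian and the Laplacian separately; together they
  -- bound the full Hessian.
  have hl : angLap (harm p u) x ^ 2 / ((n : ℝ) - 1) ≤ angLap (harm p u) x ^ 2 :=
    div_le_self (sq_nonneg _) (by linarith [one_le_sub_two hn])
  have hmono : shellDensity (rad u) x + shellDensity u x ≤ K * (u x ^ 2 + (harm p u x ^ 2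
      + rad (harm p u) x ^ 2 + rad (rad (harm p u)) x ^ 2 + angLap (harm p u) x ^ 2
      + hessTracelessSq (harm p u) x + gradSq (harm p u) x + gradSq (rad (harm p u)) x
      + gradSq u x + hessSq u x)) :=
    hs.trans (mul_le_mul_of_nonneg_left (by linarith) hK0.le)
  have e2 := mul_le_mul_of_nonneg_left hmono (by positivity : 0 ≤ δ / K)
  rw [← mul_assoc (δ / K), div_mul_cancel₀ _ hK0.ne'] at e2
  rw [psiDensity, psiTen, psiSca, psiBil, harmonicForm]
  linarith

end PointwiseCoercivity

/-! ### Integration over a shell, and coercivity with and without the smallness conditions. -/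

section ShellCoercivity

variable {n : ℕ} {p : ℝ} {L : Localization n} {f g u : E n → ℝ} {R r : ℝ}

open Filter Topology

lemma Localization.weight_nonneg (L : Localization n) (x : E n) : 0 ≤ L.weight x :=
  Real.rpow_nonneg (le_max_right _ _) _

lemma Localization.mass_nonneg (L : Localization n) : 0 ≤ L.mass :=
  integral_nonneg fun _ => L.weight_nonneg _

lemma Localization.zero_notMem_cone (L : Localization n) (R : ℝ) : (0 : E n) ∉ L.cone R := by
  rintro ⟨-, h, -⟩
  simp at h

lemma contDiffAt_normalize {k : WithTop ℕ∞} {x : E n} (hx : x ≠ 0) :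
    ContDiffAt ℝ k (fun y : E n => ‖y‖⁻¹ • y) x :=
  ((contDiffAt_norm ℝ hx).inv (norm_ne_zero_iff.2 hx)).smul contDiffAt_id

lemma norm_normalize {x : E n} (hx : x ≠ 0) : ‖‖x‖⁻¹ • x‖ = 1 := by
  rw [norm_smul, norm_inv, norm_norm, inv_mul_cancel₀ (norm_ne_zero_iff.2 hx)]

/-- The function `ρ(x/|x|)`. -/
def Localization.rhoHat (L : Localization n) (x : E n) : ℝ := L.rho (‖x‖⁻¹ • x)

lemma Localization.contDiffAt_rhoHat (L : Localization n) {x : E n} (hx : x ≠ 0) :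
    ContDiffAt ℝ 2 L.rhoHat x :=
  ContDiffAt.comp x (L.contDiffAt _ (norm_normalize hx)) (contDiffAt_normalize hx)

lemma Localization.isOpen_cone (L : Localization n) (R : ℝ) : IsOpen (L.cone R) := by
  rw [isOpen_iff_mem_nhds]
  rintro x ⟨hR, h1, h2⟩
  have hx : x ≠ 0 := by rintro rfl; simp at h1
  have hc := (L.contDiffAt_rhoHat hx).continuousAt
  filter_upwards [continuous_norm.continuousAt.eventually_const_lt hR, hc.eventually_const_lt h2,
    continuousAt_id.eventually_ne hx] with y hy1 hy2 hy3
  exact ⟨hy1, norm_normalize hy3, hy2⟩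

lemma normalize_sphere (ω : sphere (0 : E n) 1) : ‖(ω : E n)‖⁻¹ • (ω : E n) = ω := by
  simp

lemma norm_smul_sphere (hr : 0 < r) (ω : sphere (0 : E n) 1) : ‖r • (ω : E n)‖ = r := by
  rw [norm_smul, Real.norm_of_nonneg hr.le]; simp

lemma normalize_smul_sphere (hr : 0 < r) (ω : sphere (0 : E n) 1) :
    ‖r • (ω : E n)‖⁻¹ • (r • (ω : E n)) = ω := by
  rw [norm_smul_sphere hr, smul_smul, inv_mul_cancel₀ hr.ne', one_smul]

lemma Localization.smul_mem_cone (L : Localization n) (hR : 0 ≤ R) (hr : R < r)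
    {ω : sphere (0 : E n) 1} (hω : 0 < L.rho ω) : r • (ω : E n) ∈ L.cone R := by
  have hr0 : 0 < r := hR.trans_lt hr
  refine ⟨by rwa [norm_smul_sphere hr0], ?_⟩
  rw [normalize_smul_sphere hr0]
  exact ⟨by simp, hω⟩

lemma Localization.weight_eq_zero (L : Localization n) {ω : sphere (0 : E n) 1}
    (hω : ¬ 0 < L.rho ω) : L.weight ω = 0 := by
  have h : (0 : ℝ) < 2 * L.P := by linarith [L.two_le_P]
  rw [weight, normalize_sphere, max_eq_right (not_lt.1 hω), Real.zero_rpow h.ne']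

lemma Localization.continuous_rho (L : Localization n) :
    Continuous fun ω : sphere (0 : E n) 1 => L.rho ω :=
  continuous_iff_continuousAt.2 fun ω =>
    (L.contDiffAt ω (by simp)).continuousAt.comp continuous_subtype_val.continuousAt

lemma Localization.continuous_weight (L : Localization n) :
    Continuous fun ω : sphere (0 : E n) 1 => L.weight ω := by
  have h : (0 : ℝ) ≤ 2 * L.P := by linarith [L.two_le_P]
  have e : (fun ω : sphere (0 : E n) 1 => L.weight ω)
      = fun ω : sphere (0 : E n) 1 => max (L.rho ω) 0 ^ (2 * L.P) := by
    funext ω; rw [weight, normalize_sphere]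
  rw [e]
  exact (L.continuous_rho.max continuous_const).rpow_const fun _ => Or.inr h

/-- Nothing is known about `f` outside the cone, but there the weight is 0. The integrand thus
equals its restriction to the open set ρ > 0, on which it is continuous. -/
lemma aestronglyMeasurable_shell (hR : 0 ≤ R) (hr : R < r) (hf : ContinuousOn f (L.cone R)) :
    AEStronglyMeasurable (fun ω : sphere (0 : E n) 1 => f (r • (ω : E n)) * L.weight ω)
      (volume : Measure (E n)).toSphere := by
  set D : Set (sphere (0 : E n) 1) := {ω | 0 < L.rho ω} with hD
  have hDo : IsOpen D := isOpen_lt continuous_const L.continuous_rho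
  have e : (fun ω : sphere (0 : E n) 1 => f (r • (ω : E n)) * L.weight ω)
      = D.indicator fun ω => f (r • (ω : E n)) * L.weight ω := by
    funext ω
    by_cases h : ω ∈ D
    · rw [Set.indicator_of_mem h]
    · rw [Set.indicator_of_notMem h, L.weight_eq_zero h, mul_zero]
  rw [e, aestronglyMeasurable_indicator_iff hDo.measurableSet]
  refine ContinuousOn.aestronglyMeasurable (ContinuousOn.mul ?_ L.continuous_weight.continuousOn)
    hDo.measurableSet
  exact hf.comp (continuous_subtype_val.const_smul r).continuousOn
    fun ω hω => L.smul_mem_cone hR hr hω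

lemma mul_weight_le (hR : 0 ≤ R) (hr : R < r) (h : ∀ x ∈ L.cone R, f x ≤ g x)
    (ω : sphere (0 : E n) 1) :
    f (r • (ω : E n)) * L.weight ω ≤ g (r • (ω : E n)) * L.weight ω := by
  by_cases hω : 0 < L.rho ω
  · exact mul_le_mul_of_nonneg_right (h _ (L.smul_mem_cone hR hr hω)) (L.weight_nonneg _)
  · rw [L.weight_eq_zero hω, mul_zero, mul_zero]

lemma shellIntegrable_of_le (hR : 0 ≤ R) (hr : R < r) (hf : ContinuousOn f (L.cone R))
    (hg : L.ShellIntegrable g r) (h : ∀ x ∈ L.cone R, |f x| ≤ g x) : L.ShellIntegrable f r := by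
  refine Integrable.mono' hg (aestronglyMeasurable_shell hR hr hf) (.of_forall fun ω => ?_)
  rw [Real.norm_eq_abs, abs_mul, abs_of_nonneg (L.weight_nonneg _)]
  exact mul_weight_le hR hr (f := fun x => |f x|) h ω

lemma Localization.ShellIntegrable.add (hf : L.ShellIntegrable f r) (hg : L.ShellIntegrable g r) :
    L.ShellIntegrable (fun x => f x + g x) r := by
  have := Integrable.add hf hg
  refine this.congr (.of_forall fun ω => ?_)
  simp only [Pi.add_apply]; ring

lemma Localization.ShellIntegrable.const_mul (c : ℝ) (hf : L.ShellIntegrable f r) :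
    L.ShellIntegrable (fun x => c * f x) r := by
  have := Integrable.const_mul hf c
  refine this.congr (.of_forall fun ω => ?_)
  ring

lemma avg_add (hf : L.ShellIntegrable f r) (hg : L.ShellIntegrable g r) :
    L.avg (fun x => f x + g x) r = L.avg f r + L.avg g r := by
  simp only [Localization.avg, add_mul]
  rw [integral_add hf hg, add_div]

lemma avg_const_mul (c : ℝ) (f : E n → ℝ) (r : ℝ) :
    L.avg (fun x => c * f x) r = c * L.avg f r := by
  simp only [Localization.avg, mul_assoc]
  rw [integral_const_mul, mul_div_assoc]

lemma avg_mono (hR : 0 ≤ R) (hr : R < r) (hf : L.ShellIntegrable f r)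
    (hg : L.ShellIntegrable g r) (h : ∀ x ∈ L.cone R, f x ≤ g x) : L.avg f r ≤ L.avg g r :=
  div_le_div_of_nonneg_right (integral_mono hf hg fun ω => mul_weight_le hR hr h ω) L.mass_nonneg

lemma avg_congr (h : ∀ ω : sphere (0 : E n) 1, 0 < L.rho ω → f (r • (ω : E n)) = g (r • (ω : E n))) :
    L.avg f r = L.avg g r := by
  rw [Localization.avg, Localization.avg]
  congr 2
  funext ω
  by_cases hω : 0 < L.rho ω
  · rw [h ω hω]
  · rw [L.weight_eq_zero hω, mul_zero, mul_zero]

lemma avg_nonneg (h : ∀ x, 0 ≤ f x) : 0 ≤ L.avg f r :=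
  div_nonneg (integral_nonneg fun _ => mul_nonneg (h _) (L.weight_nonneg _)) L.mass_nonneg

lemma contDiffOn_hessTracelessSq {k m : WithTop ℕ∞} {U : Set (E n)} (hU : IsOpen U)
    (h0 : (0 : E n) ∉ U) (hf : ContDiffOn ℝ k f U) (hk : m + 1 + 1 ≤ k) :
    ContDiffOn ℝ m (hessTracelessSq f) U := by
  have e : hessTracelessSq f = fun x => ∑ i, ∑ j, (angHess i j f x
    - angLap f x / ((n : ℝ) - 1) * ((if i = j then 1 else 0) - x i * x j / ‖x‖ ^ 2)) ^ 2 := rfl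
  rw [e]
  refine ContDiffOn.sum fun i _ => ContDiffOn.sum fun j _ => ContDiffOn.pow ?_ 2
  refine (contDiffOn_angHess hU h0 hf hk i j).sub
    (((contDiffOn_angLap hU h0 hf hk).div_const _).mul (contDiffOn_const.sub ?_))
  exact ((contDiffOn_proj i).mul (contDiffOn_proj j)).div ((contDiffOn_norm' h0).pow 2)
    fun x hx => pow_ne_zero 2 (norm_ne_zero_iff.2 (ne_zero_of_mem h0 hx))

lemma contDiffOn_hessSq {k m : WithTop ℕ∞} {U : Set (E n)} (hU : IsOpen U)
    (h0 : (0 : E n) ∉ U) (hf : ContDiffOn ℝ k f U) (hk : m + 1 + 1 ≤ k) :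
    ContDiffOn ℝ m (hessSq f) U :=
  ContDiffOn.sum fun i _ => ContDiffOn.sum fun j _ =>
    (contDiffOn_angHess hU h0 hf hk i j).pow 2

lemma continuousOn_psiDensity {U : Set (E n)} (hU : IsOpen U) (h0 : (0 : E n) ∉ U)
    (hu : ContDiffOn ℝ 3 u U) (c2 c13 β : ℝ) : ContinuousOn (psiDensity p c2 c13 β u) U := by
  have hw : ContDiffOn ℝ 2 (harm p u) U := contDiffOn_harm hU hu (by norm_num)
  have hw1 : ContDiffOn ℝ 1 (rad (harm p u)) U := contDiffOn_rad hU hw (by norm_num)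
  have c1 := hu.continuousOn
  have c2 := hw.continuousOn
  have c3 := hw1.continuousOn
  have c4 : ContinuousOn (rad (rad (harm p u))) U :=
    (contDiffOn_rad (m := 0) hU hw1 (by norm_num)).continuousOn
  have c5 : ContinuousOn (angLap u) U :=
    (contDiffOn_angLap (m := 0) hU h0 hu (by norm_num)).continuousOn
  have c6 : ContinuousOn (angLap (harm p u)) U :=
    (contDiffOn_angLap (m := 0) hU h0 hw (by norm_num)).continuousOn
  have c7 : ContinuousOn (hessTracelessSq (harm p u)) U :=
    (contDiffOn_hessTracelessSq (m := 0) hU h0 hw (by norm_num)).continuousOn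
  have c8 : ContinuousOn (gradSq (harm p u)) U :=
    (contDiffOn_gradDot (m := 0) hU h0 hw hw (by norm_num)).continuousOn
  have c9 : ContinuousOn (gradSq (rad (harm p u))) U :=
    (contDiffOn_gradDot (m := 0) hU h0 hw1 hw1 (by norm_num)).continuousOn
  have c10 : ContinuousOn (gradSq u) U :=
    (contDiffOn_gradDot (m := 0) hU h0 hu hu (by norm_num)).continuousOn
  have c11 : ContinuousOn (hessSq u) U :=
    (contDiffOn_hessSq (m := 0) hU h0 hu (by norm_num)).continuousOn
  unfold psiDensity psiTen psiSca psiBil harmonicForm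
  fun_prop

lemma dissipationForm_eq (p c2 c13 β : ℝ) (u : E n → ℝ) (r : ℝ) :
    dissipationForm L p c2 c13 β u r = L.avg (psiDensity p c2 c13 β u) r := rfl

lemma shellIntegrable_shellDensity (hfin : FiniteShellNorm L u r) :
    L.ShellIntegrable (fun x => shellDensity (rad u) x + shellDensity u x) r :=
  hfin.1.add hfin.2

lemma shellIntegrable_psiDensity (hn : 3 ≤ n) (hR : 0 ≤ R) (hr : R < r)
    (hu : ContDiffOn ℝ 3 u (L.cone R)) (hfin : FiniteShellNorm L u r) (p c2 c13 β : ℝ) :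
    L.ShellIntegrable (psiDensity p c2 c13 β u) r := by
  obtain ⟨K, hK⟩ := exists_psiDensity_bound hn p c2 c13 β
  exact shellIntegrable_of_le hR hr
    (continuousOn_psiDensity (L.isOpen_cone R) (L.zero_notMem_cone R) hu c2 c13 β)
    ((shellIntegrable_shellDensity hfin).const_mul K)
    fun x hx => hK _ (L.isOpen_cone R) (L.zero_notMem_cone R) u hu x hx

lemma sq_le_shellDensity (u : E n → ℝ) (x : E n) : u x ^ 2 ≤ shellDensity u x := by
  have := gradSq_nonneg u x
  have := gradSq_nonneg (rad u) x
  have := hessSq_nonneg u x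
  unfold shellDensity h2Density; nlinarith [sq_nonneg (rad (rad u) x), sq_nonneg (rad u x)]

lemma shellIntegrable_sq (hR : 0 ≤ R) (hr : R < r) (hu : ContDiffOn ℝ 3 u (L.cone R))
    (hfin : FiniteShellNorm L u r) : L.ShellIntegrable (fun x => u x ^ 2) r :=
  shellIntegrable_of_le hR hr (hu.continuousOn.pow 2) hfin.2 fun x _ => by
    rw [abs_of_nonneg (sq_nonneg _)]; exact sq_le_shellDensity u x

/-- Coercivity of the dissipation modulo `⨍ u²`, for one value of `β`. -/
lemma exists_coercive_at (hn : 3 ≤ n) (hp : p < (n : ℝ) - 2) {c2 c13 β : ℝ}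
    (hA : Admissible n p c2 c13) (hβ : β ∈ ({aH n p, 2 * aH n p} : Set ℝ)) :
    ∃ δ > 0, ∃ C > 0, ∀ (L : Localization n) (R : ℝ), 0 < R → ∀ u : E n → ℝ,
      ContDiffOn ℝ 3 u (L.cone R) → ∀ r : ℝ, R < r → FiniteShellNorm L u r →
        δ * (shellNormSq L (rad u) r + shellNormSq L u r)
          ≤ dissipationForm L p c2 c13 β u r + C * L.avg (fun x => u x ^ 2) r := by
  obtain ⟨δ, hδ, C, hC, h⟩ := exists_psiDensity_coercive_at hn hp hA hβ
  refine ⟨δ, hδ, C, hC, fun L R hR u hu r hr hfin => ?_⟩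
  have hψ := shellIntegrable_psiDensity hn hR.le hr hu hfin p c2 c13 β
  have hq := shellIntegrable_sq hR.le hr hu hfin
  rw [shellNormSq, shellNormSq, ← avg_add hfin.1 hfin.2, ← avg_const_mul, ← avg_const_mul,
    dissipationForm_eq, ← avg_add hψ (hq.const_mul C)]
  exact avg_mono hR.le hr ((shellIntegrable_shellDensity hfin).const_mul δ)
    (hψ.add (hq.const_mul C))
    fun x hx => h _ (L.isOpen_cone R) (L.zero_notMem_cone R) u hu x hx

theorem exists_coercive (hn : 3 ≤ n) (hp : p < (n : ℝ) - 2) {c2 c13 : ℝ}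
    (hA : Admissible n p c2 c13) :
    ∃ c > 0, ∃ δ > 0, ∀ (L : Localization n) (R : ℝ), 0 < R → ∀ u : E n → ℝ,
      ContDiffOn ℝ 3 u (L.cone R) → ∀ r : ℝ, R < r → FiniteShellNorm L u r →
        ∀ β ∈ ({aH n p, 2 * aH n p} : Set ℝ),
          δ * (shellNormSq L (rad u) r + shellNormSq L u r)
            ≤ c * dissipationForm L p c2 c13 β u r + L.avg (fun x => u x ^ 2) r := by
  obtain ⟨δ₁, hδ₁, C₁, hC₁, h₁⟩ := exists_coercive_at hn hp hA (β := aH n p) (by simp)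
  obtain ⟨δ₂, hδ₂, C₂, hC₂, h₂⟩ := exists_coercive_at hn hp hA (β := 2 * aH n p) (by simp)
  have hC : 0 < max C₁ C₂ := lt_max_of_lt_left hC₁
  have hδ : 0 < min δ₁ δ₂ := lt_min hδ₁ hδ₂
  -- The worse constants of the two values of β are taken, and dividing by the larger C normalizes
  -- the coefficient of ⨍u² to 1.
  refine ⟨1 / max C₁ C₂, by positivity, min δ₁ δ₂ / max C₁ C₂, by positivity,
    fun L R hR u hu r hr hfin β hβ => ?_⟩
  have hN : 0 ≤ shellNormSq L (rad u) r + shellNormSq L u r :=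
    add_nonneg (avg_nonneg (shellDensity_nonneg _)) (avg_nonneg (shellDensity_nonneg _))
  have hq : 0 ≤ L.avg (fun x => u x ^ 2) r := avg_nonneg fun _ => sq_nonneg _
  have key : min δ₁ δ₂ * (shellNormSq L (rad u) r + shellNormSq L u r)
      ≤ dissipationForm L p c2 c13 β u r + max C₁ C₂ * L.avg (fun x => u x ^ 2) r := by
    rcases hβ with rfl | rfl
    · exact (mul_le_mul_of_nonneg_right (min_le_left _ _) hN).trans ((h₁ L R hR u hu r hr hfin).trans
        (add_le_add le_rfl (mul_le_mul_of_nonneg_right (le_max_left _ _) hq)))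
    · exact (mul_le_mul_of_nonneg_right (min_le_right _ _) hN).trans ((h₂ L R hR u hu r hr hfin).trans
        (add_le_add le_rfl (mul_le_mul_of_nonneg_right (le_max_right _ _) hq)))
  have := mul_le_mul_of_nonneg_left key (by positivity : 0 ≤ 1 / max C₁ C₂)
  rw [mul_add (1 / max C₁ C₂), ← mul_assoc _ (max C₁ C₂), one_div_mul_cancel hC.ne', one_mul]
    at this
  calc _ = 1 / max C₁ C₂ * (min δ₁ δ₂ * (shellNormSq L (rad u) r + shellNormSq L u r)) := by ring
    _ ≤ _ := this

/-! ### Coercivity under smallness conditions -/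

/-- Poincaré constants are defined on the unit sphere. The radial and angular operators commute with
dilations, so an inequality at radius 1 transfers to the shell of radius `r`. -/
lemma rad_comp_smul (r : ℝ) (u : E n → ℝ) :
    rad (fun y => u (r • y)) = fun y => rad u (r • y) := by
  funext y
  unfold rad
  rw [fderiv_comp_smul, map_smul]; rfl

lemma angD_comp_smul (hr : 0 < r) (i : Fin n) (u : E n → ℝ) :
    angD i (fun y => u (r • y)) = fun y => angD i u (r • y) := by
  funext y
  have h1 : pd i (fun y => u (r • y)) y = r * pd i u (r • y) := by
    unfold pd; rw [fderiv_comp_smul]; rfl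
  have h2 : (r • y) i / ‖r • y‖ = y i / ‖y‖ := by
    rw [norm_smul, Real.norm_of_nonneg hr.le, PiLp.smul_apply, smul_eq_mul,
      mul_div_mul_left _ _ hr.ne']
  rw [angD, angD, h1, h2, rad_comp_smul, norm_smul, Real.norm_of_nonneg hr.le]
  ring

lemma angHess_comp_smul (hr : 0 < r) (i j : Fin n) (u : E n → ℝ) :
    angHess i j (fun y => u (r • y)) = fun y => angHess i j u (r • y) := by
  funext y
  have h2 : (r • y) j / ‖r • y‖ = y j / ‖y‖ := by
    rw [norm_smul, Real.norm_of_nonneg hr.le, PiLp.smul_apply, smul_eq_mul,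
      mul_div_mul_left _ _ hr.ne']
  simp only [angHess, angD_comp_smul hr, h2]

lemma angLap_comp_smul (hr : 0 < r) (u : E n → ℝ) (x : E n) :
    angLap (fun y => u (r • y)) x = angLap u (r • x) := by
  simp only [angLap, angD_comp_smul hr]

lemma gradSq_comp_smul (hr : 0 < r) (u : E n → ℝ) (x : E n) :
    gradSq (fun y => u (r • y)) x = gradSq u (r • x) := by
  simp only [gradSq, gradDot, angD_comp_smul hr]

lemma h2Density_comp_smul (hr : 0 < r) (u : E n → ℝ) (x : E n) :
    h2Density (fun y => u (r • y)) x = h2Density u (r • x) := by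
  simp only [h2Density, gradSq_comp_smul hr, hessSq, angHess_comp_smul hr]

lemma avg_comp_smul (f : E n → ℝ) (r : ℝ) : L.avg (fun y => f (r • y)) 1 = L.avg f r := by
  simp only [Localization.avg, one_smul]

lemma shellIntegrable_comp_smul_iff (f : E n → ℝ) (r : ℝ) :
    L.ShellIntegrable (fun y => f (r • y)) 1 ↔ L.ShellIntegrable f r := by
  simp only [Localization.ShellIntegrable, one_smul]

lemma avg_fluct_sq_comp_smul (hr : 0 < r) (u : E n → ℝ) :
    L.avg (fun x => L.fluct (fun y => u (r • y)) x ^ 2) 1 = L.avg (fun x => L.fluct u x ^ 2) r := by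
  refine (avg_congr fun ω _ => ?_).trans (avg_comp_smul (fun x => L.fluct u x ^ 2) r)
  simp only [Localization.fluct, one_smul, norm_smul_sphere hr]
  rw [show ‖(ω : E n)‖ = 1 by simp, avg_comp_smul]

lemma shellIntegrable_one (L : Localization n) (r : ℝ) : L.ShellIntegrable (fun _ => 1) r := by
  have h : Continuous fun ω : sphere (0 : E n) 1 => (1 : ℝ) * L.weight ω :=
    continuous_const.mul L.continuous_weight
  exact h.integrable_of_hasCompactSupport (HasCompactSupport.of_compactSpace _)

/-- The usual decomposition into squared mean and variance, by expanding (u - ⟨u⟩)². -/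
lemma avg_sq_eq (hr : 0 < r) (hu : L.ShellIntegrable u r)
    (hu2 : L.ShellIntegrable (fun x => u x ^ 2) r) :
    L.avg (fun x => u x ^ 2) r = L.avg u r ^ 2 + L.avg (fun x => L.fluct u x ^ 2) r := by
  -- For total mass 0 every average is 0 by the convention on division, so positivity of the mass
  -- need not be established.
  by_cases hm : L.mass = 0
  · simp [Localization.avg, hm]
  have h1 : L.avg (fun _ => 1) r = 1 := by
    simp only [Localization.avg, one_mul]; exact div_self hm
  have h2 : L.avg (fun x => L.fluct u x ^ 2) r
      = L.avg (fun x => (u x ^ 2 + (-2 * L.avg u r) * u x) + L.avg u r ^ 2 * 1) r := by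
    refine avg_congr fun ω _ => ?_
    simp only [Localization.fluct, norm_smul_sphere hr]; ring
  rw [h2, avg_add (hu2.add (hu.const_mul _)) ((shellIntegrable_one L r).const_mul _),
    avg_add hu2 (hu.const_mul _), avg_const_mul, avg_const_mul, h1]
  ring

lemma exists_poincare {Q : (E n → ℝ) → E n → ℝ} {ε : ℝ}
    (h : poincareConst L Q < ENNReal.ofReal ε) :
    ∃ η : ℝ, 0 ≤ η ∧ η < ε ∧ ∀ v : E n → ℝ, (∀ x ∈ L.dom, ContDiffAt ℝ 2 v x) →
      L.ShellIntegrable (h2Density v) 1 →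
      L.avg (fun x => L.fluct v x ^ 2) 1 ≤ η * L.avg (Q v) 1 := by
  obtain ⟨C, hC⟩ := iInf_lt_iff.1 h
  obtain ⟨hP, hC⟩ := iInf_lt_iff.1 hC
  refine ⟨C, C.2, ?_, hP⟩
  rw [← ENNReal.ofReal_coe_nnreal] at hC
  exact (ENNReal.ofReal_lt_ofReal_iff_of_nonneg C.2).1 hC

/-- The Poincaré inequality is applied to y ↦ u(ry) on the unit sphere. `Q` stands for either of the
two right-hand sides; both are invariant under dilation and bounded by the shell density. -/
lemma avg_fluct_sq_le (hR : 0 < R) (hr : R < r) (hu : ContDiffOn ℝ 3 u (L.cone R))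
    (hfin : FiniteShellNorm L u r) {Q : (E n → ℝ) → E n → ℝ} {K η : ℝ} (hη : 0 ≤ η)
    (hQ : ∀ x, Q (fun y => u (r • y)) x = Q u (r • x)) (hQi : L.ShellIntegrable (Q u) r)
    (hQle : ∀ x ∈ L.cone R, Q u x ≤ K * shellDensity u x)
    (hP : ∀ v : E n → ℝ, (∀ x ∈ L.dom, ContDiffAt ℝ 2 v x) →
      L.ShellIntegrable (h2Density v) 1 →
      L.avg (fun x => L.fluct v x ^ 2) 1 ≤ η * L.avg (Q v) 1) :
    L.avg (fun x => L.fluct u x ^ 2) r ≤ η * (K * shellNormSq L u r) := by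
  have hr0 : 0 < r := hR.trans hr
  have h1 : ∀ x ∈ L.dom, ContDiffAt ℝ 2 (fun y => u (r • y)) x := fun x hx => by
    have hm : r • x ∈ L.cone R := L.smul_mem_cone hR.le hr (ω := ⟨x, by simpa using hx.1⟩) hx.2
    exact ((hu.contDiffAt ((L.isOpen_cone R).mem_nhds hm)).of_le (by norm_num)).comp x
      (contDiff_const_smul r).contDiffAt
  have h2 : L.ShellIntegrable (h2Density fun y => u (r • y)) 1 := by
    rw [funext (h2Density_comp_smul hr0 u), shellIntegrable_comp_smul_iff]
    have hc : ContinuousOn (h2Density u) (L.cone R) :=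
      ((hu.continuousOn.pow 2).add (contDiffOn_gradDot (m := 0) (L.isOpen_cone R)
        (L.zero_notMem_cone R) hu hu (by norm_num)).continuousOn).add
        (contDiffOn_hessSq (m := 0) (L.isOpen_cone R) (L.zero_notMem_cone R) hu
          (by norm_num)).continuousOn
    refine shellIntegrable_of_le hR.le hr hc hfin.2 fun x _ => ?_
    have := gradSq_nonneg u x
    have := gradSq_nonneg (rad u) x
    have := hessSq_nonneg u x
    have h0 : 0 ≤ h2Density u x := by unfold h2Density; positivity
    rw [abs_of_nonneg h0, shellDensity]
    nlinarith [sq_nonneg (rad (rad u) x), sq_nonneg (rad u x)]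
  have h3 := hP _ h1 h2
  rw [avg_fluct_sq_comp_smul hr0, funext hQ, avg_comp_smul] at h3
  refine h3.trans (mul_le_mul_of_nonneg_left ?_ hη)
  rw [shellNormSq, ← avg_const_mul]
  exact avg_mono hR.le hr hQi (hfin.2.const_mul K) hQle

lemma angLap_sq_add_gradSq_le (hn : 3 ≤ n) (u : E n → ℝ) {x : E n} (hx : x ≠ 0) :
    angLap u x ^ 2 + gradSq u x ≤ n * shellDensity u x := by
  have hn1 : (1 : ℝ) ≤ n := by linarith [one_le_sub_two hn]
  have h := angLap_sq_le hn u hx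
  have h1 := gradSq_nonneg u x
  have h2 := gradSq_nonneg (rad u) x
  have h3 : gradSq u x ≤ n * gradSq u x := le_mul_of_one_le_left h1 hn1
  have h4 : (n : ℝ) * (hessSq u x + gradSq u x) ≤ n * shellDensity u x := by
    refine mul_le_mul_of_nonneg_left ?_ (by linarith)
    unfold shellDensity h2Density
    nlinarith [sq_nonneg (rad (rad u) x), sq_nonneg (rad u x), sq_nonneg (u x)]
  linarith

lemma shellIntegrable_of_sq (hR : 0 ≤ R) (hr : R < r) (hu : ContinuousOn u (L.cone R))
    (hu2 : L.ShellIntegrable (fun x => u x ^ 2) r) : L.ShellIntegrable u r :=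
  shellIntegrable_of_le hR hr hu (hu2.add (shellIntegrable_one L r)) fun x _ => by
    rw [abs_le]; constructor <;> nlinarith [sq_nonneg (u x + 1), sq_nonneg (u x - 1)]

/-- Partial coercivity leaves the error ⨍u² = ⟨u⟩² + ⨍ũ². The mean appears in the conclusion; the
fluctuation and gK² are both small multiples of the shell norms. -/
theorem exists_coercive_of_small (hn : 3 ≤ n) (hp : p < (n : ℝ) - 2) {c2 c13 : ℝ}
    (hA : Admissible n p c2 c13) :
    ∃ C > 0, ∃ ε > 0, ∃ δ > 0, ∀ (L : Localization n) (R : ℝ), 0 < R →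
      (poincareConst L (fun v x => angLap v x ^ 2) < ENNReal.ofReal ε ∨
        poincareConst L (fun v x => angLap v x ^ 2 + gradSq v x) < ENNReal.ofReal ε) →
      ∀ ν : E n → ℝ, IsNormalizedKernel L p ν → ∀ g > 0, ∀ κ : ℝ,
      (∀ u : E n → ℝ, ContDiffOn ℝ 3 u (L.cone R) → ∀ r : ℝ, R < r → FiniteShellNorm L u r →
        fluctOp L p ν u r ^ 2 ≤ κ ^ 2 * (shellNormSq L (rad u) r + shellNormSq L u r)) →
      g * κ ^ 2 < ε →
      ∀ u : E n → ℝ, ContDiffOn ℝ 3 u (L.cone R) → ∀ r : ℝ, R < r → FiniteShellNorm L u r →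
        ∀ β ∈ ({aH n p, 2 * aH n p} : Set ℝ),
          δ * (shellNormSq L (rad u) r + shellNormSq L u r)
            ≤ C * dissipationForm L p c2 c13 β u r + L.avg u r ^ 2
              - g * fluctOp L p ν u r ^ 2 := by
  obtain ⟨C, hC, δ, hδ, h⟩ := exists_coercive hn hp hA
  have hn1 : (1 : ℝ) ≤ n := by linarith [one_le_sub_two hn]
  -- The Poincaré inequality costs nε and the fluctuation operator costs ε. With this ε their sum is
  -- δ/2, so half of the coercivity is left.
  refine ⟨C, hC, δ / (2 * (n + 1)), by positivity, δ / 2, by positivity, ?_⟩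
  intro L R hR hPoin ν _ g hg κ hK hgκ u hu r hr hfin β hβ
  set ε := δ / (2 * (n + 1)) with hε
  have hr0 : 0 < r := hR.trans hr
  have hO := L.isOpen_cone R
  have h0 := L.zero_notMem_cone R
  have hcl : ContinuousOn (angLap u) (L.cone R) :=
    (contDiffOn_angLap (m := 0) hO h0 hu (by norm_num)).continuousOn
  have hcg : ContinuousOn (gradSq u) (L.cone R) :=
    (contDiffOn_gradDot (m := 0) hO h0 hu hu (by norm_num)).continuousOn
  have hN1 : 0 ≤ shellNormSq L (rad u) r := avg_nonneg (shellDensity_nonneg _)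
  have hN2 : 0 ≤ shellNormSq L u r := avg_nonneg (shellDensity_nonneg _)
  have hle : ∀ x ∈ L.cone R, angLap u x ^ 2 + gradSq u x ≤ n * shellDensity u x :=
    fun x hx => angLap_sq_add_gradSq_le hn u (ne_zero_of_mem h0 hx)
  have hle' : ∀ x ∈ L.cone R, angLap u x ^ 2 ≤ n * shellDensity u x :=
    fun x hx => (le_add_of_nonneg_right (gradSq_nonneg u x)).trans (hle x hx)
  have hfl : L.avg (fun x => L.fluct u x ^ 2) r ≤ ε * (n * shellNormSq L u r) := by
    rcases hPoin with hPoin | hPoin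
    · obtain ⟨η, hη0, hη, hP⟩ := exists_poincare hPoin
      refine (avg_fluct_sq_le hR hr hu hfin hη0 (fun x => ?_) ?_ hle' hP).trans
        (mul_le_mul_of_nonneg_right hη.le (by positivity))
      · rw [angLap_comp_smul hr0]
      · exact shellIntegrable_of_le hR.le hr (hcl.pow 2) (hfin.2.const_mul n) fun x hx => by
          rw [abs_of_nonneg (sq_nonneg _)]; exact hle' x hx
    · obtain ⟨η, hη0, hη, hP⟩ := exists_poincare hPoin
      refine (avg_fluct_sq_le hR hr hu hfin hη0 (fun x => ?_) ?_ hle hP).trans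
        (mul_le_mul_of_nonneg_right hη.le (by positivity))
      · rw [angLap_comp_smul hr0, gradSq_comp_smul hr0]
      · exact shellIntegrable_of_le hR.le hr ((hcl.pow 2).add hcg) (hfin.2.const_mul n)
          fun x hx => by
            rw [abs_of_nonneg (add_nonneg (sq_nonneg _) (gradSq_nonneg u x))]; exact hle x hx
  have hsq := shellIntegrable_sq hR.le hr hu hfin
  have hav := avg_sq_eq hr0 (shellIntegrable_of_sq hR.le hr hu.continuousOn hsq) hsq
  have hmain := h L R hR u hu r hr hfin β hβ
  have hgK : g * fluctOp L p ν u r ^ 2 ≤ ε * (shellNormSq L (rad u) r + shellNormSq L u r) := by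
    refine (mul_le_mul_of_nonneg_left (hK u hu r hr hfin) hg.le).trans ?_
    rw [← mul_assoc]
    exact mul_le_mul_of_nonneg_right hgκ.le (add_nonneg hN1 hN2)
  have hsum : ε * (n * shellNormSq L u r) + ε * (shellNormSq L (rad u) r + shellNormSq L u r)
      ≤ δ / 2 * (shellNormSq L (rad u) r + shellNormSq L u r) := by
    have hε' : ε * (n + 1) = δ / 2 := by rw [hε]; field_simp
    have : 0 ≤ ε * (n * shellNormSq L (rad u) r) := by positivity
    rw [← hε']; linarith
  linarith

end ShellCoercivity

/-! ### Integrals over spheres: differentiation in the radius and the divergence theorem. -/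

section SphereCalculus

variable {n : ℕ} {f g : E n → ℝ} {r : ℝ}

open Filter Topology

/-- Integral over the unit sphere of `ω ↦ F (r ω)`. -/
def sphInt (F : E n → ℝ) (r : ℝ) : ℝ :=
  ∫ ω : sphere (0 : E n) 1, F (r • (ω : E n)) ∂(volume : Measure (E n)).toSphere

lemma sphInt_congr (hr : 0 < r) (h : ∀ x : E n, x ≠ 0 → f x = g x) : sphInt f r = sphInt g r := by
  unfold sphInt
  congr 1; funext ω
  refine h _ fun h0 => ?_
  have := norm_smul_sphere hr ω
  rw [h0, norm_zero] at this
  exact hr.ne this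

lemma smul_sphere_ne_zero (hr : 0 < r) (ω : sphere (0 : E n) 1) : r • (ω : E n) ≠ 0 := fun h => by
  have := norm_smul_sphere hr ω
  rw [h, norm_zero] at this
  exact hr.ne this

lemma continuous_smul_sphere (hr : 0 < r) (hf : ContinuousOn f {0}ᶜ) :
    Continuous fun ω : sphere (0 : E n) 1 => f (r • (ω : E n)) :=
  hf.comp_continuous (continuous_subtype_val.const_smul r) fun ω => smul_sphere_ne_zero hr ω

lemma integrable_smul_sphere (hr : 0 < r) (hf : ContinuousOn f {0}ᶜ) :
    Integrable (fun ω : sphere (0 : E n) 1 => f (r • (ω : E n)))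
      (volume : Measure (E n)).toSphere :=
  (continuous_smul_sphere hr hf).integrable_of_hasCompactSupport
    (HasCompactSupport.of_compactSpace _)

lemma sphInt_add (hr : 0 < r) (hf : ContinuousOn f {0}ᶜ) (hg : ContinuousOn g {0}ᶜ) :
    sphInt (fun x => f x + g x) r = sphInt f r + sphInt g r :=
  integral_add (integrable_smul_sphere hr hf) (integrable_smul_sphere hr hg)

lemma sphInt_sub (hr : 0 < r) (hf : ContinuousOn f {0}ᶜ) (hg : ContinuousOn g {0}ᶜ) :
    sphInt (fun x => f x - g x) r = sphInt f r - sphInt g r :=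
  integral_sub (integrable_smul_sphere hr hf) (integrable_smul_sphere hr hg)

lemma sphInt_const_mul (c : ℝ) (f : E n → ℝ) (r : ℝ) :
    sphInt (fun x => c * f x) r = c * sphInt f r :=
  integral_const_mul c _

lemma sphInt_sum (hr : 0 < r) {ι : Type*} (s : Finset ι) {F : ι → E n → ℝ}
    (h : ∀ i ∈ s, ContinuousOn (F i) {0}ᶜ) :
    sphInt (fun x => ∑ i ∈ s, F i x) r = ∑ i ∈ s, sphInt (F i) r :=
  integral_finsetSum s fun i hi => integrable_smul_sphere hr (h i hi)

lemma isOpen_compl_zero : IsOpen ({0}ᶜ : Set (E n)) := isOpen_compl_singleton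

lemma zero_notMem_compl : (0 : E n) ∉ ({0}ᶜ : Set (E n)) := by simp

/-- Differentiation under the integral sign. The dominating constant comes from compactness of [r/2,
2r] × sphere, which stays away from the origin where `f` may be singular. -/
lemma hasDerivAt_sphInt (hr : 0 < r) (hf : ContDiffOn ℝ 1 f {0}ᶜ) :
    HasDerivAt (sphInt f) (sphInt (rad f) r / r) r := by
  have hfd : ContinuousOn (fderiv ℝ f) {0}ᶜ :=
    (hf.fderiv_of_isOpen isOpen_compl_zero (m := 0) (by norm_num)).continuousOn
  set F' : ℝ → sphere (0 : E n) 1 → ℝ := fun t ω => fderiv ℝ f (t • (ω : E n)) ω with hF'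
  set s : Set ℝ := Set.Icc (r / 2) (2 * r) with hs
  have hs0 : ∀ t ∈ s, 0 < t := fun t ht => (by positivity : 0 < r / 2).trans_le ht.1
  have hcont : ContinuousOn (fun q : ℝ × sphere (0 : E n) 1 => F' q.1 q.2) (s ×ˢ Set.univ) := by
    refine ContinuousOn.clm_apply (hfd.comp ?_ ?_) ?_
    · fun_prop
    · rintro ⟨t, ω⟩ ⟨ht, -⟩
      exact smul_sphere_ne_zero (hs0 t ht) ω
    · fun_prop
  obtain ⟨C, hC⟩ := ((isCompact_Icc.prod isCompact_univ).image_of_continuousOn hcont).isBounded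
    |>.exists_norm_le
  have hmem : s ∈ 𝓝 r := Icc_mem_nhds (by linarith) (by linarith)
  have hcf : ContinuousOn f {0}ᶜ := hf.continuousOn
  have hev : ∀ᶠ t in 𝓝 r, 0 < t := eventually_gt_nhds hr
  have key := hasDerivAt_integral_of_dominated_loc_of_deriv_le (μ := (volume : Measure (E n)).toSphere)
    (F := fun t (ω : sphere (0 : E n) 1) => f (t • (ω : E n))) (F' := F') (bound := fun _ => C)
    (x₀ := r) hmem
    (hev.mono fun t ht => (continuous_smul_sphere ht hcf).aestronglyMeasurable)
    (integrable_smul_sphere hr hcf)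
    (by
      refine Continuous.aestronglyMeasurable ?_
      exact hcont.comp_continuous (by fun_prop : Continuous fun ω : sphere (0 : E n) 1 => (r, ω))
        fun ω => ⟨mem_of_mem_nhds hmem, trivial⟩)
    (.of_forall fun ω t ht => hC _ ⟨(t, ω), ⟨ht, trivial⟩, rfl⟩)
    (integrable_const C)
    (.of_forall fun ω t ht => by
      have hx := smul_sphere_ne_zero (hs0 t ht) ω
      have hd := (differentiableAt_of_contDiffOn isOpen_compl_zero hf (x := t • (ω : E n)) hx
        (by simp)).hasFDerivAt
      have h2 : HasDerivAt (fun t : ℝ => t • (ω : E n)) (ω : E n) t := by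
        simpa using (hasDerivAt_id t).smul_const (ω : E n)
      exact hd.comp_hasDerivAt t h2)
  refine key.2.congr_deriv ?_
  unfold sphInt
  rw [eq_div_iff hr.ne', mul_comm, ← integral_const_mul]
  congr 1; funext ω
  simp only [rad, hF', map_smul, smul_eq_mul]

lemma radR_sphInt (hr : 0 < r) (hf : ContDiffOn ℝ 1 f {0}ᶜ) :
    radR (sphInt f) r = sphInt (rad f) r := by
  rw [radR, (hasDerivAt_sphInt hr hf).deriv, mul_div_cancel₀ _ hr.ne']

/-! ### Integration by parts on spheres -/

lemma nontrivial_E (hn : 3 ≤ n) : Nontrivial (E n) := by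
  have : Nonempty (Fin n) := ⟨⟨0, by omega⟩⟩
  infer_instance

/-- Integration in polar coordinates of a product of a radial and an angular function. -/
lemma integral_radial_mul_angular (hn : 3 ≤ n) (η : ℝ → ℝ) (h : E n → ℝ) :
    ∫ x : E n, η ‖x‖ * h (‖x‖⁻¹ • x)
      = sphInt h 1 * ∫ y in Set.Ioi (0 : ℝ), y ^ (n - 1) * η y := by
  have := nontrivial_E hn
  have hdim : Module.finrank ℝ (E n) = n := finrank_euclideanSpace_fin
  have hmp := (volume : Measure (E n)).measurePreserving_homeomorphUnitSphereProd
  rw [hdim] at hmp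
  calc ∫ x : E n, η ‖x‖ * h (‖x‖⁻¹ • x)
      = ∫ x : ({0}ᶜ : Set (E n)), η ‖(x : E n)‖ * h (‖(x : E n)‖⁻¹ • (x : E n))
          ∂((volume : Measure (E n)).comap Subtype.val) := by
        -- The origin is a null set, so it can be removed before passing to polar coordinates.
        rw [integral_subtype_comap (measurableSet_singleton _).compl
          fun x : E n => η ‖x‖ * h (‖x‖⁻¹ • x), restrict_compl_singleton]
    _ = ∫ q : sphere (0 : E n) 1 × Set.Ioi (0 : ℝ), h q.1 * η q.2
          ∂((volume : Measure (E n)).toSphere.prod (.volumeIoiPow (n - 1))) := by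
        have := hmp.integral_comp (Homeomorph.measurableEmbedding _)
          (fun q : sphere (0 : E n) 1 × Set.Ioi (0 : ℝ) => h q.1 * η q.2)
        rw [← this]
        congr 1; funext x
        rw [homeomorphUnitSphereProd_apply_snd_coe, homeomorphUnitSphereProd_apply_fst_coe, mul_comm]
    _ = (∫ ω : sphere (0 : E n) 1, h ω ∂(volume : Measure (E n)).toSphere)
          * ∫ y : Set.Ioi (0 : ℝ), η y ∂.volumeIoiPow (n - 1) :=
        integral_prod_mul (fun ω : sphere (0 : E n) 1 => h ω) fun y : Set.Ioi (0 : ℝ) => η y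
    _ = _ := by
        congr 1
        · simp only [sphInt, one_smul]
        · simp only [Measure.volumeIoiPow, ENNReal.ofReal]
          rw [integral_withDensity_eq_integral_smul
              ((measurable_subtype_coe.pow_const _).real_toNNReal),
            integral_subtype_comap measurableSet_Ioi fun a => Real.toNNReal (a ^ (n - 1)) • η a,
            setIntegral_congr_fun measurableSet_Ioi fun x hx => ?_]
          rw [NNReal.smul_def, Real.coe_toNNReal _ (pow_nonneg (le_of_lt hx) _), smul_eq_mul]

/-- A smooth bump function on the line, supported in `[1, 3]`. -/
def shellBump : ContDiffBump (2 : ℝ) := ⟨1 / 2, 1, by norm_num, by norm_num⟩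

lemma shellBump_eq_zero {t : ℝ} (ht : t ≤ 1 ∨ 3 ≤ t) : shellBump t = 0 := by
  refine shellBump.zero_of_le_dist ?_
  rw [Real.dist_eq, le_abs']
  change t - 2 ≤ -1 ∨ 1 ≤ t - 2
  rcases ht with h | h
  · left; linarith
  · right; linarith

lemma shellBump_eventuallyEq_zero {t : ℝ} (ht : t < 1 ∨ 3 < t) :
    (shellBump : ℝ → ℝ) =ᶠ[𝓝 t] fun _ => 0 := by
  rcases ht with h | h
  · filter_upwards [eventually_lt_nhds h] with s hs using shellBump_eq_zero (Or.inl hs.le)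
  · filter_upwards [eventually_gt_nhds h] with s hs using shellBump_eq_zero (Or.inr hs.le)

lemma deriv_shellBump_eq_zero {t : ℝ} (ht : t < 1 ∨ 3 < t) : deriv shellBump t = 0 := by
  rw [(shellBump_eventuallyEq_zero ht).deriv_eq]; simp

lemma integral_pow_mul_shellBump_pos (k : ℕ) :
    0 < ∫ y in Set.Ioi (0 : ℝ), y ^ k * shellBump y := by
  have h0 : ∀ y : ℝ, y ∉ Set.Ioi (0 : ℝ) → y ^ k * shellBump y = 0 := fun y hy => by
    rw [shellBump_eq_zero (Or.inl ((not_lt.1 (Set.mem_Ioi.not.1 hy)).trans zero_le_one)), mul_zero]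
  rw [setIntegral_eq_integral_of_forall_compl_eq_zero h0]
  refine Continuous.integral_pos_of_hasCompactSupport_nonneg_nonzero (x := 2)
    ((continuous_pow k).mul shellBump.continuous) shellBump.hasCompactSupport.mul_left ?_ ?_
  · intro y
    by_cases hy : y ∈ Set.Ioi (0 : ℝ)
    · exact mul_nonneg (pow_nonneg (le_of_lt hy) _) shellBump.nonneg
    · exact (h0 y hy).ge
  · have : 0 < shellBump (2 : ℝ) := shellBump.pos_of_mem_ball (mem_ball_self shellBump.rOut_pos)
    positivity

lemma integral_pow_mul_deriv_shellBump {k : ℕ} (hk : k ≠ 0) :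
    ∫ y in Set.Ioi (0 : ℝ), y ^ k * deriv shellBump y
      = -(k * ∫ y in Set.Ioi (0 : ℝ), y ^ (k - 1) * shellBump y) := by
  have hcd : ContDiff ℝ 1 fun y : ℝ => y ^ k * shellBump y :=
    (contDiff_id.pow k).mul shellBump.contDiff
  have hcs : HasCompactSupport fun y : ℝ => y ^ k * shellBump y :=
    shellBump.hasCompactSupport.mul_left
  have h := hcs.integral_Ioi_deriv_eq hcd 0
  rw [zero_pow hk, zero_mul, neg_zero] at h
  have hd : Differentiable ℝ shellBump := shellBump.contDiff.differentiable (n := 1) (by simp)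
  have e : ∀ y : ℝ, deriv (fun y : ℝ => y ^ k * shellBump y) y
      = k * (y ^ (k - 1) * shellBump y) + y ^ k * deriv shellBump y := fun y => by
    rw [deriv_fun_mul (differentiableAt_pow k) (hd y), deriv_pow_field]; ring
  have hcd' : Continuous (deriv shellBump) := shellBump.contDiff.continuous_deriv (n := 1) le_rfl
  have hcs' : HasCompactSupport (deriv shellBump) := shellBump.hasCompactSupport.deriv
  have i1 : Integrable fun y : ℝ => k * (y ^ (k - 1) * shellBump y) :=
    (((continuous_pow _).mul shellBump.continuous).integrable_of_hasCompactSupport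
      shellBump.hasCompactSupport.mul_left).const_mul _
  have i2 : Integrable fun y : ℝ => y ^ k * deriv shellBump y :=
    ((continuous_pow _).mul hcd').integrable_of_hasCompactSupport hcs'.mul_left
  simp only [e] at h
  rw [integral_add i1.integrableOn i2.integrableOn, integral_const_mul] at h
  linarith

lemma hasFDerivAt_normalize {x : E n} (hx : x ≠ 0) :
    HasFDerivAt (fun y : E n => ‖y‖⁻¹ • y)
      (‖x‖⁻¹ • ContinuousLinearMap.id ℝ (E n)
        + (-(‖x‖ ^ 2)⁻¹ • (‖x‖⁻¹ • innerSL ℝ x)).smulRight x) x :=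
  ((hasDerivAt_inv (norm_ne_zero_iff.2 hx)).comp_hasFDerivAt x (hasFDerivAt_norm' hx)).smul
    (hasFDerivAt_id x)

/-- The composed function is constant along rays, so its gradient at `x` is the tangential gradient
of `f` at the projected point, scaled by 1/‖x‖. -/
lemma pd_comp_normalize (hr : 0 < r) (hf : ContDiffOn ℝ 1 f {0}ᶜ) {x : E n} (hx : x ≠ 0)
    (i : Fin n) :
    pd i (fun y => f (r • (‖y‖⁻¹ • y))) x = angD i f (r • (‖x‖⁻¹ • x)) / ‖x‖ := by
  have hn : ‖x‖ ≠ 0 := norm_ne_zero_iff.2 hx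
  have hz0 : r • (‖x‖⁻¹ • x) ≠ 0 := smul_ne_zero hr.ne' (smul_ne_zero (inv_ne_zero hn) hx)
  have hd := (differentiableAt_of_contDiffOn isOpen_compl_zero hf (x := r • (‖x‖⁻¹ • x)) hz0
    (by simp)).hasFDerivAt
  have h := hd.comp x ((hasFDerivAt_normalize hx).const_smul r)
  have hnz : ‖r • (‖x‖⁻¹ • x)‖ = r := by
    rw [norm_smul, norm_normalize hx, Real.norm_of_nonneg hr.le, mul_one]
  have e : fderiv ℝ (fun y : E n => f (r • (‖y‖⁻¹ • y))) x = _ := h.fderiv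
  rw [angD, hnz, pd, e, pd, rad]
  simp only [ContinuousLinearMap.comp_apply, smul_apply, add_apply, ContinuousLinearMap.id_apply,
    ContinuousLinearMap.smulRight_apply, innerSL_apply_apply, map_smul, map_add, smul_eq_mul,
    EuclideanSpace.inner_single_right, PiLp.smul_apply]
  simp
  field_simp
  ring

lemma continuous_radial_mul {ζ : ℝ → ℝ} (hζ : Continuous ζ) (h0 : ∀ t < 1, ζ t = 0)
    (hf : ContinuousOn f {0}ᶜ) : Continuous fun x => ζ ‖x‖ * f x := by
  rw [continuous_iff_continuousAt]
  intro x
  by_cases hx : x = 0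
  · have : (fun x : E n => ζ ‖x‖ * f x) =ᶠ[𝓝 x] fun _ => 0 := by
      have h1 : ‖x‖ < 1 := by rw [hx, norm_zero]; exact one_pos
      filter_upwards [continuous_norm.continuousAt.eventually_lt_const h1] with y hy
      rw [h0 _ hy, zero_mul]
    exact continuousAt_const.congr this.symm
  · exact (hζ.comp continuous_norm).continuousAt.mul
      (hf.continuousAt (isOpen_compl_zero.mem_nhds hx))

lemma contDiff_radial_mul {ζ : ℝ → ℝ} (hζ : ContDiff ℝ 1 ζ) (h0 : ∀ t < 1, ζ t = 0)
    (hf : ContDiffOn ℝ 1 f {0}ᶜ) : ContDiff ℝ 1 fun x => ζ ‖x‖ * f x := by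
  rw [contDiff_iff_contDiffAt]
  intro x
  by_cases hx : x = 0
  · have : (fun x : E n => ζ ‖x‖ * f x) =ᶠ[𝓝 x] fun _ => 0 := by
      have h1 : ‖x‖ < 1 := by rw [hx, norm_zero]; exact one_pos
      filter_upwards [continuous_norm.continuousAt.eventually_lt_const h1] with y hy
      rw [h0 _ hy, zero_mul]
    exact contDiffAt_const.congr_of_eventuallyEq this
  · exact (hζ.contDiffAt.comp x (contDiffAt_norm ℝ hx)).mul
      (hf.contDiffAt (isOpen_compl_zero.mem_nhds hx))

lemma hasCompactSupport_radial_mul {ζ : ℝ → ℝ} (h0 : ∀ t, 3 < t → ζ t = 0) (f : E n → ℝ) :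
    HasCompactSupport fun x => ζ ‖x‖ * f x := by
  refine HasCompactSupport.intro (isCompact_closedBall (0 : E n) 3) fun x hx => ?_
  rw [mem_closedBall, dist_zero_right, not_le] at hx
  rw [h0 _ hx, zero_mul]

/-- Integration by parts against the constant 1. -/
lemma integral_pd_eq_zero {F : E n → ℝ} (hF : ContDiff ℝ 1 F) (hc : HasCompactSupport F)
    (i : Fin n) : ∫ x, pd i F x = 0 := by
  have hcf : HasCompactSupport (fderiv ℝ F) := hc.fderiv ℝ
  have i1 : Integrable fun x => pd i F x := by
    refine Continuous.integrable_of_hasCompactSupport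
      ((hF.continuous_fderiv (by simp)).clm_apply continuous_const) ?_
    exact hcf.mono fun x hx h => hx (by simp [pd, h])
  have h := integral_mul_fderiv_eq_neg_fderiv_mul_of_integrable (μ := (volume : Measure (E n)))
    (f := fun _ : E n => (1 : ℝ)) (g := F) (v := EuclideanSpace.single i 1) (by simp)
    (by simpa [pd] using i1) (by simpa using hF.continuous.integrable_of_hasCompactSupport hc)
    (fun x _ => differentiableAt_const _) (fun x _ => hF.differentiable (by simp) x)
  simpa [pd] using h

/-- The divergence theorem on spheres. -/
theorem sphInt_angD (hn : 3 ≤ n) (hr : 0 < r) (hf : ContDiffOn ℝ 1 f {0}ᶜ) (i : Fin n) :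
    sphInt (angD i f) r = ((n : ℝ) - 1) * sphInt (fun x => rdir i x * f x) r := by
  set f0 : E n → ℝ := fun x => f (r • (‖x‖⁻¹ • x)) with hf0
  have hf0c : ContDiffOn ℝ 1 f0 {0}ᶜ := fun x hx => by
    have hz0 : r • (‖x‖⁻¹ • x) ≠ 0 :=
      smul_ne_zero hr.ne' (smul_ne_zero (inv_ne_zero (norm_ne_zero_iff.2 hx)) hx)
    exact ((hf.contDiffAt (isOpen_compl_zero.mem_nhds hz0)).comp x
      ((contDiffAt_normalize hx).const_smul r)).contDiffWithinAt
  have hz : ∀ t < 1, shellBump t = 0 := fun t ht => shellBump_eq_zero (Or.inl ht.le)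
  have hz' : ∀ t, 3 < t → shellBump t = 0 := fun t ht => shellBump_eq_zero (Or.inr ht.le)
  have hF := contDiff_radial_mul shellBump.contDiff hz hf0c
  have hFc := hasCompactSupport_radial_mul hz' f0
  have hbd : Differentiable ℝ shellBump := shellBump.contDiff.differentiable (n := 1) (by simp)
  have hb' : Continuous (deriv shellBump) := shellBump.contDiff.continuous_deriv (n := 1) le_rfl
  -- The theorem is deduced from the flat one: `f` on the sphere of radius `r` is extended
  -- constantly along rays and multiplied by a radial bump. The integral of ∂ᵢ of this function over
  -- ℝⁿ is 0, and its two terms separate in polar coordinates.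
  have hpd : ∀ x : E n, pd i (fun x => shellBump ‖x‖ * f0 x) x
      = deriv shellBump ‖x‖ * (rdir i x * f0 x)
        + shellBump ‖x‖ / ‖x‖ * angD i f (r • (‖x‖⁻¹ • x)) := by
    intro x
    by_cases hx : x = 0
    · have h1 : ‖x‖ < 1 := by rw [hx, norm_zero]; exact one_pos
      have h2 : (fun x : E n => shellBump ‖x‖ * f0 x) =ᶠ[𝓝 x] fun _ => 0 := by
        filter_upwards [continuous_norm.continuousAt.eventually_lt_const h1] with y hy
        rw [hz _ hy, zero_mul]
      rw [(pd_congr i h2).self_of_nhds, deriv_shellBump_eq_zero (Or.inl h1), hz _ h1]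
      simp [pd]
    · have h1 : pd i (fun y : E n => shellBump ‖y‖) x = deriv shellBump ‖x‖ * rdir i x := by
        have h := (hbd ‖x‖).hasDerivAt.comp_hasFDerivAt x (hasFDerivAt_norm' hx)
        have e : fderiv ℝ (fun y : E n => shellBump ‖y‖) x = _ := h.fderiv
        rw [← pd_norm i hx, pd, e, pd, (hasFDerivAt_norm' hx).fderiv]
        rfl
      rw [pd_mul (f := fun y : E n => shellBump ‖y‖) i ((hbd _).comp x (differentiableAt_norm' hx))
        (differentiableAt_of_contDiffOn isOpen_compl_zero hf0c hx (by simp)), h1,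
        pd_comp_normalize hr hf hx]
      ring
  have hint := integral_pd_eq_zero hF hFc i
  have c1 : Continuous fun x : E n => deriv shellBump ‖x‖ * (rdir i x * f0 x) :=
    continuous_radial_mul hb' (fun t ht => deriv_shellBump_eq_zero (Or.inl ht))
      ((contDiffOn_rdir (m := 0) zero_notMem_compl i).continuousOn.mul hf0c.continuousOn)
  have i1 := c1.integrable_of_hasCompactSupport (μ := volume) (hasCompactSupport_radial_mul
    (ζ := deriv shellBump) (fun t ht => deriv_shellBump_eq_zero (Or.inr ht)) fun x => rdir i x * f0 x)
  have c2 : Continuous fun x : E n => shellBump ‖x‖ / ‖x‖ * angD i f (r • (‖x‖⁻¹ • x)) := by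
    -- Continuity, including at the origin, is inherited from the other two terms of `hpd`.
    have e : (fun x : E n => shellBump ‖x‖ / ‖x‖ * angD i f (r • (‖x‖⁻¹ • x)))
        = fun x => pd i (fun x => shellBump ‖x‖ * f0 x) x
          - deriv shellBump ‖x‖ * (rdir i x * f0 x) := by
      funext x; rw [hpd]; ring
    rw [e]
    exact ((hF.continuous_fderiv (by simp)).clm_apply continuous_const).sub c1
  have i2 := c2.integrable_of_hasCompactSupport (μ := volume) (hasCompactSupport_radial_mul
    (ζ := fun t => shellBump t / t) (fun t ht => by simp only [hz' t ht, zero_div])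
    fun x : E n => angD i f (r • (‖x‖⁻¹ • x)))
  simp only [hpd] at hint
  rw [integral_add i1 i2] at hint
  have p1 : ∫ x : E n, deriv shellBump ‖x‖ * (rdir i x * f0 x)
      = sphInt (fun x => rdir i x * f x) r
        * ∫ y in Set.Ioi (0 : ℝ), y ^ (n - 1) * deriv shellBump y := by
    have h := integral_radial_mul_angular hn (deriv shellBump) fun x => rdir i x * f (r • x)
    have e : sphInt (fun x => rdir i x * f (r • x)) 1 = sphInt (fun x => rdir i x * f x) r := by
      unfold sphInt
      congr 1; funext ω
      have : rdir i (r • (ω : E n)) = rdir i (ω : E n) := by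
        rw [rdir, norm_smul_sphere hr, rdir, PiLp.smul_apply, smul_eq_mul,
          mul_div_cancel_left₀ _ hr.ne']
        simp
      simp only [one_smul, this]
    rw [e] at h
    rw [← h]
    congr 1; funext x
    by_cases hx : x = 0
    · simp [hx, rdir]
    · have : rdir i (‖x‖⁻¹ • x) = rdir i x := by
        rw [rdir, norm_normalize hx, rdir, PiLp.smul_apply, smul_eq_mul]; field_simp
      rw [this]
  have p2 : ∫ x : E n, shellBump ‖x‖ / ‖x‖ * angD i f (r • (‖x‖⁻¹ • x))
      = sphInt (angD i f) r * ∫ y in Set.Ioi (0 : ℝ), y ^ (n - 2) * shellBump y := by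
    have h := integral_radial_mul_angular hn (fun t => shellBump t / t) fun x => angD i f (r • x)
    have e : sphInt (fun x => angD i f (r • x)) 1 = sphInt (angD i f) r := by
      simp only [sphInt, one_smul]
    rw [e] at h
    rw [h]
    congr 1
    refine setIntegral_congr_fun measurableSet_Ioi fun y hy => ?_
    have hy0 : y ≠ 0 := ne_of_gt hy
    have : n - 1 = n - 2 + 1 := by omega
    simp only [this, pow_succ]; field_simp
  -- Integrating by parts in the radius turns ∫yⁿ⁻¹η' into -(n-1)∫yⁿ⁻²η, for the bump η. Both terms
  -- then carry the same positive factor, which cancels and leaves n - 1.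
  have hJ := integral_pow_mul_shellBump_pos (n - 2)
  rw [p1, p2, integral_pow_mul_deriv_shellBump (by omega), show n - 1 - 1 = n - 2 by omega,
    Nat.cast_sub (by omega), Nat.cast_one] at hint
  generalize (∫ y in Set.Ioi (0 : ℝ), y ^ (n - 2) * shellBump y) = J at hint hJ
  have : J * (sphInt (angD i f) r - ((n : ℝ) - 1) * sphInt (fun x => rdir i x * f x) r) = 0 := by
    linarith
  rcases mul_eq_zero.1 this with h | h
  · exact absurd h hJ.ne'
  · linarith

end SphereCalculus

/-! ### The Euclidean Hessian in polar form and its contractions. -/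

section PolarHessian

variable {n : ℕ} {f g φ u : E n → ℝ} {x : E n} {r : ℝ}

open Filter Topology

/-- Components `r² ∂_i ∂_j f` of the rescaled Euclidean Hessian. -/
def scaledHess (i j : Fin n) (f : E n → ℝ) (x : E n) : ℝ := ‖x‖ ^ 2 * pd i (pd j f) x

lemma scaledHess_comm (hf : ContDiffOn ℝ 2 f {0}ᶜ) (hx : x ≠ 0) (i j : Fin n) :
    scaledHess i j f x = scaledHess j i f x := by
  rw [scaledHess, pd_comm isOpen_compl_zero hf hx, scaledHess]

lemma pd_eventually (i : Fin n) (f : E n → ℝ) (hx : x ≠ 0) :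
    pd i f =ᶠ[𝓝 x] fun y => (angD i f y + rdir i y * rad f y) * ‖y‖⁻¹ := by
  filter_upwards [continuousAt_id.eventually_ne hx] with y hy
  rw [pd_eq i f (show y ≠ 0 from hy), div_eq_mul_inv]

lemma pd_inv_norm (i : Fin n) (hx : x ≠ 0) :
    pd i (fun y : E n => ‖y‖⁻¹) x = -(rdir i x * (‖x‖ ^ 2)⁻¹) := by
  have h := (hasDerivAt_inv (norm_ne_zero_iff.2 hx)).comp_hasFDerivAt x (hasFDerivAt_norm' hx)
  have e : fderiv ℝ (fun y : E n => ‖y‖⁻¹) x = _ := h.fderiv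
  rw [← pd_norm i hx, pd, e, pd, (hasFDerivAt_norm' hx).fderiv]
  simp only [smul_apply, smul_eq_mul]; ring

lemma differentiableAt_inv_norm (hx : x ≠ 0) : DifferentiableAt ℝ (fun y : E n => ‖y‖⁻¹) x :=
  (differentiableAt_norm' hx).inv (norm_ne_zero_iff.2 hx)

/-- The Euclidean Hessian in polar form. -/
lemma scaledHess_eq (hf : ContDiffOn ℝ 2 f {0}ᶜ) (hx : x ≠ 0) (i j : Fin n) :
    scaledHess i j f x = angHess i j f x + sphMetric i j x * rad f x
      + rdir j x * (angD i (rad f) x - angD i f x) + rdir i x * (angD j (rad f) x - angD j f x)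
      + rdir i x * rdir j x * (rad (rad f) x - rad f x) := by
  have hn : ‖x‖ ≠ 0 := norm_ne_zero_iff.2 hx
  have hO := isOpen_compl_zero (n := n)
  have h0 := zero_notMem_compl (n := n)
  have d1 := differentiableAt_angD hO h0 hf hx j
  have d2 := differentiableAt_rdir j hx
  have d3 := differentiableAt_rad hO hf hx
  have d4 := d2.fun_mul d3
  rw [scaledHess, (pd_congr i (pd_eventually j f hx)).self_of_nhds,
    pd_mul i (d1.fun_add d4) (differentiableAt_inv_norm hx), pd_inv_norm i hx,
    pd_eq i _ hx, angD_add i d1 d4, angD_mul i d2 d3, angD_rdir i j hx,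
    rad_add d1 d4, rad_mul d2 d3, rad_rdir j hx, rad_angD hO h0 hf hx, angHess, sphMetric]
  simp only [rdir]
  field_simp
  ring

/-- The Euclidean Hessian is symmetric, and in its polar form all terms other than the angular
Hessian are visibly symmetric together. -/
lemma angHess_comm (hf : ContDiffOn ℝ 2 f {0}ᶜ) (hx : x ≠ 0) (i j : Fin n) :
    angHess i j f x = angHess j i f x := by
  have h := scaledHess_comm hf hx i j
  have hs : sphMetric i j x = sphMetric j i x := by
    simp only [sphMetric, eq_comm (a := i), mul_comm]
  rw [scaledHess_eq hf hx, scaledHess_eq hf hx, hs] at h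
  linarith

lemma contDiffOn_scaledHess {k m : WithTop ℕ∞} (hf : ContDiffOn ℝ k f {0}ᶜ) (hk : m + 1 + 1 ≤ k)
    (i j : Fin n) : ContDiffOn ℝ m (scaledHess i j f) {0}ᶜ :=
  ((contDiffOn_norm' zero_notMem_compl).pow 2).mul
    (contDiffOn_pd isOpen_compl_zero (contDiffOn_pd isOpen_compl_zero hf hk j) le_rfl i)

lemma rad_norm_sq (hx : x ≠ 0) : rad (fun y : E n => ‖y‖ ^ 2) x = 2 * ‖x‖ ^ 2 := by
  have e : (fun y : E n => ‖y‖ ^ 2) = fun y => ‖y‖ * ‖y‖ := by funext y; ring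
  rw [e, rad_mul (differentiableAt_norm' hx) (differentiableAt_norm' hx), rad_norm hx]; ring

/-- Each partial derivative contributes one commutator with ϑ, and ϑ‖x‖² = 2‖x‖² cancels the two. -/
lemma rad_scaledHess (hf : ContDiffOn ℝ 3 f {0}ᶜ) (hx : x ≠ 0) (i j : Fin n) :
    rad (scaledHess i j f) x = scaledHess i j (rad f) x := by
  have hO := isOpen_compl_zero (n := n)
  have hf2 : ContDiffOn ℝ 2 f {0}ᶜ := hf.of_le (by norm_num)
  have hp : ContDiffOn ℝ 2 (pd j f) {0}ᶜ := contDiffOn_pd hO hf (by norm_num) j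
  have hpp : ContDiffOn ℝ 1 (pd i (pd j f)) {0}ᶜ := contDiffOn_pd hO hp (by norm_num) i
  have d0 := differentiableAt_of_contDiffOn hO hp hx (by simp)
  have d1 := differentiableAt_of_contDiffOn hO hpp hx (by simp)
  have d2 := differentiableAt_of_contDiffOn hO
    ((contDiffOn_norm' (m := 1) (zero_notMem_compl (n := n))).pow 2) hx (by simp)
  have d3 := differentiableAt_rad hO hp hx
  have e1 : pd j (rad f) =ᶠ[𝓝 x] fun y => pd j f y + rad (pd j f) y := by
    filter_upwards [eventually_mem hO hx] with y hy using pd_rad hO hf2 hy j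
  have e : scaledHess i j f = fun y => ‖y‖ ^ 2 * pd i (pd j f) y := rfl
  rw [e, rad_mul d2 d1, rad_norm_sq hx, scaledHess, (pd_congr i e1).self_of_nhds,
    pd_add i d0 d3, pd_rad hO hp hx]
  ring

/-! ### Contractions of the polar Hessian -/

lemma sum_sphMetric_mul_scaledHess (hf : ContDiffOn ℝ 2 f {0}ᶜ) (hx : x ≠ 0) :
    ∑ i, ∑ j, sphMetric i j x * scaledHess i j f x = angLap f x + ((n : ℝ) - 1) * rad f x := by
  have hg : ∀ i, ∑ j, sphMetric i j x * rdir j x = 0 := fun i => by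
    rw [sum_sphMetric_mul]; simp only [← sq, sum_rdir_sq hx]; ring
  have hg' : ∀ j, ∑ i, sphMetric i j x * rdir i x = 0 := fun j => by
    simpa only [sphMetric, eq_comm (a := j), mul_comm (rdir j x)] using hg j
  have h1 : ∀ i j, sphMetric i j x * scaledHess i j f x
      = angHess i j f x * sphMetric i j x + sphMetric i j x ^ 2 * rad f x
        + (angD i (rad f) x - angD i f x + rdir i x * (rad (rad f) x - rad f x))
          * (sphMetric i j x * rdir j x)
        + (angD j (rad f) x - angD j f x) * (sphMetric i j x * rdir i x) := by
    intro i j; rw [scaledHess_eq hf hx]; ring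
  simp only [h1, Finset.sum_add_distrib, ← Finset.mul_sum, ← Finset.sum_mul, hg, mul_zero,
    Finset.sum_const_zero, sum_sphMetric_mul_angHess f hx, sum_sphMetric_sq hx]
  rw [Finset.sum_comm]
  simp only [← Finset.mul_sum, hg', mul_zero, Finset.sum_const_zero]
  ring

lemma sum_rdir_mul_scaledHess (hf : ContDiffOn ℝ 2 f {0}ᶜ) (hx : x ≠ 0) (i : Fin n) :
    ∑ j, rdir j x * scaledHess i j f x
      = angD i (rad f) x - angD i f x + rdir i x * (rad (rad f) x - rad f x) := by
  have hg : ∀ i, ∑ j, sphMetric i j x * rdir j x = 0 := fun i => by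
    rw [sum_sphMetric_mul]; simp only [← sq, sum_rdir_sq hx]; ring
  have h1 : ∀ j, rdir j x * scaledHess i j f x
      = angHess i j f x * rdir j x + rad f x * (sphMetric i j x * rdir j x)
        + (angD i (rad f) x - angD i f x + rdir i x * (rad (rad f) x - rad f x)) * rdir j x ^ 2
        + rdir i x * (rdir j x * angD j (rad f) x) - rdir i x * (rdir j x * angD j f x) := by
    intro j; rw [scaledHess_eq hf hx]; ring
  simp only [h1, Finset.sum_add_distrib, Finset.sum_sub_distrib, ← Finset.mul_sum, hg,
    sum_rdir_sq hx, sum_rdir_mul_angD _ hx,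
    sum_angHess_mul_rdir isOpen_compl_zero zero_notMem_compl hf hx]
  ring

lemma sum_rdir_rdir_mul_scaledHess (hf : ContDiffOn ℝ 2 f {0}ᶜ) (hx : x ≠ 0) :
    ∑ i, ∑ j, rdir i x * rdir j x * scaledHess i j f x = rad (rad f) x - rad f x := by
  have h1 : ∀ i, rdir i x * (angD i (rad f) x - angD i f x
        + rdir i x * (rad (rad f) x - rad f x))
      = rdir i x * angD i (rad f) x - rdir i x * angD i f x
        + rdir i x ^ 2 * (rad (rad f) x - rad f x) := by intro i; ring
  simp only [mul_assoc, ← Finset.mul_sum, sum_rdir_mul_scaledHess hf hx, h1,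
    Finset.sum_add_distrib, Finset.sum_sub_distrib, sum_rdir_mul_angD _ hx, ← Finset.sum_mul,
    sum_rdir_sq hx]
  ring

lemma sum_angD_rdir_mul_scaledHess (φ : E n → ℝ) (hf : ContDiffOn ℝ 2 f {0}ᶜ) (hx : x ≠ 0) :
    ∑ i, ∑ j, rdir j x * angD i φ x * scaledHess i j f x
      = gradDot φ (rad f) x - gradDot φ f x := by
  have h0 : ∀ i j, rdir j x * angD i φ x * scaledHess i j f x
      = angD i φ x * (rdir j x * scaledHess i j f x) := by intro i j; ring
  have h1 : ∀ i, angD i φ x * (angD i (rad f) x - angD i f x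
        + rdir i x * (rad (rad f) x - rad f x))
      = angD i φ x * angD i (rad f) x - angD i φ x * angD i f x
        + rdir i x * angD i φ x * (rad (rad f) x - rad f x) := by intro i; ring
  simp only [h0, ← Finset.mul_sum, sum_rdir_mul_scaledHess hf hx, h1, Finset.sum_add_distrib,
    Finset.sum_sub_distrib, ← Finset.sum_mul, sum_rdir_mul_angD _ hx, gradDot]
  ring

lemma sum_rdir_angD_mul_scaledHess (φ : E n → ℝ) (hf : ContDiffOn ℝ 2 f {0}ᶜ) (hx : x ≠ 0) :
    ∑ i, ∑ j, rdir i x * angD j φ x * scaledHess i j f x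
      = gradDot φ (rad f) x - gradDot φ f x := by
  rw [← sum_angD_rdir_mul_scaledHess φ hf hx, Finset.sum_comm]
  refine Finset.sum_congr rfl fun i _ => Finset.sum_congr rfl fun j _ => ?_
  rw [scaledHess_comm hf hx]

/-- Iterated angular derivatives differ from the covariant Hessian by a radial term, whose
contraction is the gradient difference on the right. The covariant part pairs only with the
tangential components of the Euclidean Hessian. -/
lemma sum_angD_angD_mul_scaledHess (hφ : ContDiffOn ℝ 2 φ {0}ᶜ) (hf : ContDiffOn ℝ 2 f {0}ᶜ)
    (hx : x ≠ 0) :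
    ∑ i, ∑ j, angD j (angD i φ) x * scaledHess i j f x
      = hessDot φ f x + angLap φ x * rad f x - (gradDot φ (rad f) x - gradDot φ f x) := by
  have h1 : ∀ i j, angD j (angD i φ) x * scaledHess i j f x
      = angHess i j φ x * angHess i j f x + rad f x * (angHess i j φ x * sphMetric i j x)
        + (angD i (rad f) x - angD i f x + rdir i x * (rad (rad f) x - rad f x))
          * (angHess i j φ x * rdir j x)
        + (angD j (rad f) x - angD j f x) * (rdir i x * angHess i j φ x)
        - rdir i x * angD j φ x * scaledHess i j f x := by
    intro i j
    have e : angD j (angD i φ) x = angHess i j φ x - rdir i x * angD j φ x := by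
      rw [angHess_comm hφ hx, angHess, rdir]; ring
    rw [e, sub_mul]
    conv_lhs => rw [scaledHess_eq hf hx i j]
    rw [scaledHess_eq hf hx i j]; ring
  simp only [h1, Finset.sum_add_distrib, Finset.sum_sub_distrib]
  rw [sum_rdir_angD_mul_scaledHess φ hf hx]
  rw [Finset.sum_comm (f := fun i j =>
    (angD j (rad f) x - angD j f x) * (rdir i x * angHess i j φ x))]
  simp only [← Finset.mul_sum, sum_rdir_mul_angHess φ hx,
    sum_angHess_mul_rdir isOpen_compl_zero zero_notMem_compl hφ hx,
    sum_sphMetric_mul_angHess φ hx, mul_zero, Finset.sum_const_zero, hessDot]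
  ring

/-- `r² Δ f` -/
def scaledLap (f : E n → ℝ) (x : E n) : ℝ := ‖x‖ ^ 2 * lap f x

lemma scaledLap_eq_sum (f : E n → ℝ) (x : E n) : scaledLap f x = ∑ i, scaledHess i i f x := by
  simp only [scaledLap, lap, scaledHess, Finset.mul_sum]

lemma contDiffOn_scaledLap {k m : WithTop ℕ∞} (hf : ContDiffOn ℝ k f {0}ᶜ) (hk : m + 1 + 1 ≤ k) :
    ContDiffOn ℝ m (scaledLap f) {0}ᶜ := by
  rw [funext (scaledLap_eq_sum f)]
  exact ContDiffOn.sum fun i _ => contDiffOn_scaledHess hf hk i i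

lemma scaledLap_eq (hf : ContDiffOn ℝ 2 f {0}ᶜ) (hx : x ≠ 0) :
    scaledLap f x = rad (rad f) x + ((n : ℝ) - 2) * rad f x + angLap f x := by
  have h1 : ∀ i, scaledHess i i f x = angHess i i f x + sphMetric i i x * rad f x
      + 2 * (rdir i x * angD i (rad f) x) - 2 * (rdir i x * angD i f x)
      + rdir i x ^ 2 * (rad (rad f) x - rad f x) := by
    intro i; rw [scaledHess_eq hf hx]; ring
  simp only [scaledLap_eq_sum, h1, Finset.sum_add_distrib, Finset.sum_sub_distrib,
    ← Finset.mul_sum, ← Finset.sum_mul, sum_rdir_sq hx, sum_rdir_mul_angD _ hx,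
    sum_angHess_self f hx, sum_sphMetric_self hx]
  ring

lemma rad_scaledLap (hf : ContDiffOn ℝ 3 f {0}ᶜ) (hx : x ≠ 0) :
    rad (scaledLap f) x = scaledLap (rad f) x := by
  rw [funext (scaledLap_eq_sum f), rad_sum, scaledLap_eq_sum]
  · simp only [rad_scaledHess hf hx]
  · exact fun i _ => differentiableAt_of_contDiffOn isOpen_compl_zero
      (contDiffOn_scaledHess (m := 1) hf (by norm_num) i i) hx (by simp)

end PolarHessian

/-! ### Double divergences integrated by parts twice on a sphere. -/

section WeakForm

variable {n : ℕ} {f g φ u W T : E n → ℝ} {x : E n} {r s a : ℝ}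

open Filter Topology

lemma differentiableAt_norm_rpow (s : ℝ) (hx : x ≠ 0) :
    DifferentiableAt ℝ (fun y : E n => ‖y‖ ^ s) x :=
  (differentiableAt_norm' hx).rpow_const (Or.inl (norm_ne_zero_iff.2 hx))

lemma contDiffOn_norm_rpow {k : WithTop ℕ∞} (s : ℝ) :
    ContDiffOn ℝ k (fun y : E n => ‖y‖ ^ s) {0}ᶜ :=
  (contDiffOn_norm' zero_notMem_compl).rpow_const_of_ne fun _ hx => norm_ne_zero_iff.2 hx

lemma pd_norm_rpow (s : ℝ) (i : Fin n) (hx : x ≠ 0) :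
    pd i (fun y : E n => ‖y‖ ^ s) x = ‖x‖ ^ (s - 1) * (s * rdir i x) := by
  have h := (hasFDerivAt_norm' hx).rpow_const (p := s) (Or.inl (norm_ne_zero_iff.2 hx))
  have e : fderiv ℝ (fun y : E n => ‖y‖ ^ s) x = _ := h.fderiv
  rw [← pd_norm i hx, pd, e, pd, (hasFDerivAt_norm' hx).fderiv]
  simp only [smul_apply, smul_eq_mul]; ring

lemma pd_rpow_mul (s : ℝ) (hf : DifferentiableAt ℝ f x) (hx : x ≠ 0) (i : Fin n) :
    pd i (fun y => ‖y‖ ^ s * f y) x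
      = ‖x‖ ^ (s - 1) * (angD i f x + rdir i x * (rad f x + s * f x)) := by
  have hn : 0 < ‖x‖ := norm_pos_iff.2 hx
  rw [pd_mul i (differentiableAt_norm_rpow s hx) hf, pd_norm_rpow s i hx, pd_eq i f hx,
    Real.rpow_sub_one hn.ne']
  field_simp
  ring

/-- The flux of `∂_j (r^s Q)`. -/
def flux (s : ℝ) (j : Fin n) (Q : E n → ℝ) (x : E n) : ℝ :=
  angD j Q x + rdir j x * (rad Q x + s * Q x)

lemma pd_pd_rpow_mul {Q : E n → ℝ} (s : ℝ) (hQ : ContDiffOn ℝ 2 Q {0}ᶜ) (hx : x ≠ 0)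
    (i j : Fin n) :
    pd i (pd j fun y => ‖y‖ ^ s * Q y) x = ‖x‖ ^ (s - 2) * flux (s - 1) i (flux s j Q) x := by
  have hO := isOpen_compl_zero (n := n)
  have e : pd j (fun y => ‖y‖ ^ s * Q y) =ᶠ[𝓝 x] fun y => ‖y‖ ^ (s - 1) * flux s j Q y := by
    filter_upwards [eventually_mem hO hx] with y hy
    exact pd_rpow_mul s (differentiableAt_of_contDiffOn hO hQ hy (by simp)) hy j
  have hF : DifferentiableAt ℝ (flux s j Q) x :=
    (differentiableAt_angD hO zero_notMem_compl hQ hx j).fun_add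
      ((differentiableAt_rdir j hx).fun_mul ((differentiableAt_rad hO hQ hx).fun_add
        ((differentiableAt_of_contDiffOn hO hQ hx (by simp)).const_mul s)))
  rw [(pd_congr i e).self_of_nhds, pd_rpow_mul (s - 1) hF hx i, sub_sub, one_add_one_eq_two]
  rfl

/-- Two functions that differ by angular divergences have the same integral over spheres. -/
lemma sphInt_eq_of_div (hn : 3 ≤ n) (hr : 0 < r) {G₁ G₂ : E n → ℝ} {i j : Fin n}
    (hg : ContinuousOn g {0}ᶜ) (h1 : ContDiffOn ℝ 1 G₁ {0}ᶜ) (h2 : ContDiffOn ℝ 1 G₂ {0}ᶜ)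
    (h : ∀ x, x ≠ 0 → f x = g x + (angD i G₁ x - ((n : ℝ) - 1) * (rdir i x * G₁ x))
      + (angD j G₂ x - ((n : ℝ) - 1) * (rdir j x * G₂ x))) :
    sphInt f r = sphInt g r := by
  have hO := isOpen_compl_zero (n := n)
  have h0 := zero_notMem_compl (n := n)
  have hd : ∀ (k : Fin n) (G : E n → ℝ), ContDiffOn ℝ 1 G {0}ᶜ →
      ContinuousOn (fun x => angD k G x - ((n : ℝ) - 1) * (rdir k x * G x)) {0}ᶜ ∧
      sphInt (fun x => angD k G x - ((n : ℝ) - 1) * (rdir k x * G x)) r = 0 := by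
    intro k G hG
    have c1 : ContinuousOn (angD k G) {0}ᶜ := (contDiffOn_angD (m := 0) hO h0 hG (by simp) k).continuousOn
    have c2 : ContinuousOn (fun x => ((n : ℝ) - 1) * (rdir k x * G x)) {0}ᶜ :=
      continuousOn_const.mul ((contDiffOn_rdir (m := 0) h0 k).continuousOn.mul hG.continuousOn)
    exact ⟨c1.sub c2, by rw [sphInt_sub hr c1 c2, sphInt_const_mul, sphInt_angD hn hr hG k, sub_self]⟩
  obtain ⟨c1, e1⟩ := hd i G₁ h1
  obtain ⟨c2, e2⟩ := hd j G₂ h2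
  have s2 := sphInt_add hr hg c1
  have s1 := sphInt_add (f := fun x => g x + (angD i G₁ x - ((n : ℝ) - 1) * (rdir i x * G₁ x)))
    hr (hg.add c1) c2
  rw [sphInt_congr hr h, s1, s2, e1, e2, add_zero, add_zero]

/-- Density of the weak form of `r^{2-s} ∂_i ∂_j (r^s W T)`, `s = a + 2 - n`, tested on `φ`. -/
def weakDensity (a : ℝ) (i j : Fin n) (φ T : E n → ℝ) (x : E n) : ℝ :=
  angD j (angD i φ) x * T x - rdir j x * angD i φ x * (rad T x + (a + 1) * T x)
    - (rdir i x * angD j φ x + φ x * sphMetric i j x) * (rad T x + a * T x)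
    + φ x * (rdir i x * rdir j x) * (rad (rad T) x + (2 * a + 1) * rad T x + a * (a + 1) * T x)

lemma continuousOn_weakDensity (hφ : ContDiffOn ℝ 2 φ {0}ᶜ) (hT : ContDiffOn ℝ 2 T {0}ᶜ)
    (a : ℝ) (i j : Fin n) : ContinuousOn (weakDensity a i j φ T) {0}ᶜ := by
  have hO := isOpen_compl_zero (n := n)
  have h0 := zero_notMem_compl (n := n)
  have c2 := hφ.continuousOn
  have c3 := hT.continuousOn
  have hT1 : ContDiffOn ℝ 1 (rad T) {0}ᶜ := contDiffOn_rad hO hT (by norm_num)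
  have c4 := hT1.continuousOn
  have c5 : ContinuousOn (rad (rad T)) {0}ᶜ :=
    (contDiffOn_rad (m := 0) hO hT1 (by simp)).continuousOn
  have hφA : ∀ k, ContDiffOn ℝ 1 (angD k φ) {0}ᶜ := contDiffOn_angD hO h0 hφ (by norm_num)
  have c6i := (hφA i).continuousOn
  have c6j := (hφA j).continuousOn
  have c7 : ContinuousOn (angD j (angD i φ)) {0}ᶜ :=
    (contDiffOn_angD (m := 0) hO h0 (hφA i) (by simp) j).continuousOn
  have c8i := (contDiffOn_rdir (m := 0) h0 i).continuousOn
  have c8j := (contDiffOn_rdir (m := 0) h0 j).continuousOn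
  unfold weakDensity sphMetric
  fun_prop

/-- Two integrations by parts leave no angular derivative on `W`, and its radial derivative is 0, so
`W` comes out as a factor. With s = a + 2 - n, the exponent s - 1 of the outer flux and the n - 1 of
the divergence theorem add up to a. -/
lemma sphInt_flux_flux (hn : 3 ≤ n) (hr : 0 < r) (hφ : ContDiffOn ℝ 2 φ {0}ᶜ)
    (hW : ContDiffOn ℝ 2 W {0}ᶜ) (hWr : ∀ x, x ≠ 0 → rad W x = 0)
    (hT : ContDiffOn ℝ 2 T {0}ᶜ) (i j : Fin n) :
    sphInt (fun x => φ x * flux (a + 2 - n - 1) i (flux (a + 2 - n) j fun y => W y * T y) x) r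
      = sphInt (fun x => W x * weakDensity a i j φ T x) r := by
  have hO := isOpen_compl_zero (n := n)
  have h0 := zero_notMem_compl (n := n)
  set s : ℝ := a + 2 - n with hs
  set Q : E n → ℝ := fun y => W y * T y with hQ
  have hQ2 : ContDiffOn ℝ 2 Q {0}ᶜ := hW.mul hT
  have hT1 : ContDiffOn ℝ 1 (rad T) {0}ᶜ := contDiffOn_rad hO hT (by norm_num)
  have hTA1 : ContDiffOn ℝ 1 (angD j T) {0}ᶜ := contDiffOn_angD hO h0 hT (by norm_num) j
  have hW1 : ContDiffOn ℝ 1 W {0}ᶜ := hW.of_le (by norm_num)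
  have hWA1 : ContDiffOn ℝ 1 (angD j W) {0}ᶜ := contDiffOn_angD hO h0 hW (by norm_num) j
  have hQr : ∀ y, y ≠ 0 → rad Q y = W y * rad T y := fun y hy => by
    rw [hQ, rad_mul (differentiableAt_of_contDiffOn hO hW hy (by simp))
      (differentiableAt_of_contDiffOn hO hT hy (by simp)), hWr y hy]; ring
  have hQ1 : ContDiffOn ℝ 1 (rad Q) {0}ᶜ := contDiffOn_rad hO hQ2 (by norm_num)
  have hA1 : ∀ k, ContDiffOn ℝ 1 (angD k Q) {0}ᶜ := contDiffOn_angD hO h0 hQ2 (by norm_num)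
  have hφ1 : ContDiffOn ℝ 1 φ {0}ᶜ := hφ.of_le (by norm_num)
  have hφA : ∀ k, ContDiffOn ℝ 1 (angD k φ) {0}ᶜ := contDiffOn_angD hO h0 hφ (by norm_num)
  have hrd : ∀ k, ContDiffOn ℝ 1 (rdir k) ({0}ᶜ : Set (E n)) := contDiffOn_rdir h0
  have hQ1' : ContDiffOn ℝ 1 Q {0}ᶜ := hQ2.of_le (by norm_num)
  have hF : ContDiffOn ℝ 1 (flux s j Q) {0}ᶜ :=
    (hA1 j).add ((hrd j).mul (hQ1.add (contDiffOn_const.mul hQ1')))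
  have hQ' : ContDiffOn ℝ 1 (fun y => rad Q y + a * Q y) {0}ᶜ := hQ1.add (contDiffOn_const.mul hQ1')
  -- The two integrated divergences: the first removes the outer derivative with index i, the second
  -- removes the angular derivatives with index j that remain on Q = WT.
  have hG1 : ContDiffOn ℝ 1 (fun y => φ y * flux s j Q y) {0}ᶜ := hφ1.mul hF
  have hG2 : ContDiffOn ℝ 1 (fun y => φ y * rdir i y * (rad Q y + a * Q y) - angD i φ y * Q y)
      {0}ᶜ := ((hφ1.mul (hrd i)).mul hQ').sub ((hφA i).mul hQ1')
  refine sphInt_eq_of_div hn hr (i := i) (j := j) (hg := ?_) hG1 hG2 fun x hx => ?_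
  · exact hW.continuousOn.mul (continuousOn_weakDensity hφ hT a i j)
  · have dd : ∀ {h : E n → ℝ}, ContDiffOn ℝ 1 h {0}ᶜ → DifferentiableAt ℝ h x := fun hh =>
      differentiableAt_of_contDiffOn hO hh hx (by simp)
    have eAQ : angD j Q x = angD j W x * T x + W x * angD j T x :=
      angD_mul j (dd hW1) (dd (hT.of_le (by norm_num)))
    have eRQ := hQr x hx
    have ev : rad Q =ᶠ[𝓝 x] fun y => W y * rad T y := by
      filter_upwards [eventually_mem hO hx] with y hy using hQr y hy
    have eRRQ : rad (rad Q) x = W x * rad (rad T) x := by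
      rw [(rad_congr ev).self_of_nhds, rad_mul (dd hW1) (dd hT1), hWr x hx]; ring
    have eRAQ : rad (angD j Q) x = angD j (rad Q) x := rad_angD hO h0 hQ2 hx j
    have eF : rad (flux s j Q) x
        = angD j (rad Q) x + rdir j x * (rad (rad Q) x + s * rad Q x) := by
      have e : flux s j Q = fun y => angD j Q y + rdir j y * (rad Q y + s * Q y) := rfl
      rw [e, rad_add (dd (hA1 j)) ((dd (hrd j)).fun_mul ((dd hQ1).fun_add ((dd hQ1').const_mul s))),
        rad_mul (dd (hrd j)) ((dd hQ1).fun_add ((dd hQ1').const_mul s)),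
        rad_comb s (dd hQ1) (dd hQ1'), rad_rdir j hx, eRAQ]
      ring
    have eG1 : angD i (fun y => φ y * flux s j Q y) x
        = angD i φ x * flux s j Q x + φ x * angD i (flux s j Q) x := angD_mul i (dd hφ1) (dd hF)
    have eG2 : angD j (fun y => φ y * rdir i y * (rad Q y + a * Q y) - angD i φ y * Q y) x
        = (angD j φ x * rdir i x + φ x * angD j (rdir i) x) * (rad Q x + a * Q x)
          + φ x * rdir i x * (angD j (rad Q) x + a * angD j Q x)
          - (angD j (angD i φ) x * Q x + angD i φ x * angD j Q x) := by
      rw [angD_sub j (((dd hφ1).fun_mul (dd (hrd i))).fun_mul (dd hQ')) ((dd (hφA i)).fun_mul (dd hQ1')),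
        angD_mul j ((dd hφ1).fun_mul (dd (hrd i))) (dd hQ'), angD_mul j (dd hφ1) (dd (hrd i)),
        angD_comb a j (dd hQ1) (dd hQ1'), angD_mul j (dd (hφA i)) (dd hQ1')]
    have eM : angD j (rdir i) x = sphMetric i j x := by
      rw [angD_rdir j i hx, sphMetric]; simp only [eq_comm (a := j), mul_comm]
    rw [eG1, eG2, eM]
    change φ x * (angD i (flux s j Q) x + rdir i x * (rad (flux s j Q) x + (s - 1) * flux s j Q x)) = _
    rw [eF, show flux s j Q x = angD j Q x + rdir j x * (rad Q x + s * Q x) from rfl, eRRQ, eRQ,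
      show Q x = W x * T x from rfl, hs, weakDensity]
    ring

/-! ### The weak form of the Hamiltonian operator -/

lemma sum_weakDensity_diag (hx : x ≠ 0) (a : ℝ) : ∑ i, weakDensity a i i φ T x
      = angLap φ x * T x
        + φ x * (rad (rad T) x + (2 * a + 2 - n) * rad T x + a * (a + 2 - n) * T x) := by
  have h1 : ∀ i, weakDensity a i i φ T x = angD i (angD i φ) x * T x
      - rdir i x * angD i φ x * (2 * rad T x + (2 * a + 1) * T x)
      - sphMetric i i x * (φ x * (rad T x + a * T x))
      + rdir i x ^ 2 * (φ x * (rad (rad T) x + (2 * a + 1) * rad T x + a * (a + 1) * T x)) := by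
    intro i; rw [weakDensity]; ring
  simp only [h1, Finset.sum_add_distrib, Finset.sum_sub_distrib, ← Finset.sum_mul,
    sum_rdir_mul_angD φ hx, sum_sphMetric_self hx, sum_rdir_sq hx, angLap]
  ring

lemma rad_rad_scaledHess (hu : ContDiffOn ℝ 4 u {0}ᶜ) (hx : x ≠ 0) (i j : Fin n) :
    rad (rad (scaledHess i j u)) x = scaledHess i j (rad (rad u)) x := by
  have hO := isOpen_compl_zero (n := n)
  have e : rad (scaledHess i j u) =ᶠ[𝓝 x] scaledHess i j (rad u) := by
    filter_upwards [eventually_mem hO hx] with y hy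
    exact rad_scaledHess (hu.of_le (by norm_num)) hy i j
  rw [(rad_congr e).self_of_nhds, rad_scaledHess (contDiffOn_rad hO hu (by norm_num)) hx]

/-- Since ϑ commutes with the rescaled Hessian, every term is a contraction of the Hessian of u, ϑu
or ϑ²u already evaluated in polar form. -/
lemma sum_weakDensity_scaledHess (hφ : ContDiffOn ℝ 2 φ {0}ᶜ) (hu : ContDiffOn ℝ 4 u {0}ᶜ)
    (hx : x ≠ 0) (a : ℝ) : ∑ i, ∑ j, weakDensity a i j φ (scaledHess i j u) x
      = hessDot φ u x + angLap φ x * rad u x - (gradDot φ (rad u) x - gradDot φ u x)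
        - 2 * (gradDot φ (rad (rad u)) x - gradDot φ (rad u) x)
        - (2 * a + 1) * (gradDot φ (rad u) x - gradDot φ u x)
        - φ x * (angLap (rad u) x + ((n : ℝ) - 1) * rad (rad u) x
          + a * (angLap u x + ((n : ℝ) - 1) * rad u x))
        + φ x * (rad (rad (rad (rad u))) x - rad (rad (rad u)) x
          + (2 * a + 1) * (rad (rad (rad u)) x - rad (rad u) x)
          + a * (a + 1) * (rad (rad u) x - rad u x)) := by
  have hO := isOpen_compl_zero (n := n)
  have hu3 : ContDiffOn ℝ 3 u {0}ᶜ := hu.of_le (by norm_num)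
  have hu2 : ContDiffOn ℝ 2 u {0}ᶜ := hu.of_le (by norm_num)
  have hu1 : ContDiffOn ℝ 3 (rad u) {0}ᶜ := contDiffOn_rad hO hu (by norm_num)
  have hu12 : ContDiffOn ℝ 2 (rad u) {0}ᶜ := hu1.of_le (by norm_num)
  have hu22 : ContDiffOn ℝ 2 (rad (rad u)) {0}ᶜ := contDiffOn_rad hO hu1 (by norm_num)
  have h1 : ∀ i j, weakDensity a i j φ (scaledHess i j u) x
      = angD j (angD i φ) x * scaledHess i j u x
        - rdir j x * angD i φ x * scaledHess i j (rad u) x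
        - (a + 1) * (rdir j x * angD i φ x * scaledHess i j u x)
        - rdir i x * angD j φ x * scaledHess i j (rad u) x
        - a * (rdir i x * angD j φ x * scaledHess i j u x)
        - φ x * (sphMetric i j x * scaledHess i j (rad u) x)
        - φ x * a * (sphMetric i j x * scaledHess i j u x)
        + φ x * (rdir i x * rdir j x * scaledHess i j (rad (rad u)) x)
        + φ x * (2 * a + 1) * (rdir i x * rdir j x * scaledHess i j (rad u) x)
        + φ x * (a * (a + 1)) * (rdir i x * rdir j x * scaledHess i j u x) := by
    intro i j
    rw [weakDensity, rad_scaledHess hu3 hx, rad_rad_scaledHess hu hx]; ring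
  simp only [h1, Finset.sum_add_distrib, Finset.sum_sub_distrib, ← Finset.mul_sum,
    sum_angD_angD_mul_scaledHess hφ hu2 hx, sum_angD_rdir_mul_scaledHess φ hu2 hx,
    sum_angD_rdir_mul_scaledHess φ hu12 hx, sum_rdir_angD_mul_scaledHess φ hu2 hx,
    sum_rdir_angD_mul_scaledHess φ hu12 hx, sum_sphMetric_mul_scaledHess hu2 hx,
    sum_sphMetric_mul_scaledHess hu12 hx, sum_rdir_rdir_mul_scaledHess hu2 hx,
    sum_rdir_rdir_mul_scaledHess hu12 hx, sum_rdir_rdir_mul_scaledHess hu22 hx]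
  ring

end WeakForm

/-! ### Regularity of the weight and radial derivatives of shell averages. -/

section Weight

variable {n : ℕ} {f g φ u T : E n → ℝ} {x : E n} {r s a p : ℝ} {L : Localization n}

open Filter Topology

/-- Away from 0 the function is locally 0 or a power. At 0 the derivative is obtained as the limit
of the derivatives nearby. -/
lemma hasDerivAt_max_rpow (hs : 1 < s) (t : ℝ) :
    HasDerivAt (fun t : ℝ => max t 0 ^ s) (s * max t 0 ^ (s - 1)) t := by
  have hc : ∀ {q : ℝ}, 0 < q → Continuous fun t : ℝ => max t 0 ^ q := fun hq =>
    (continuous_id.max continuous_const).rpow_const fun _ => Or.inr hq.le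
  have hne : ∀ t : ℝ, t ≠ 0 → HasDerivAt (fun t : ℝ => max t 0 ^ s) (s * max t 0 ^ (s - 1)) t := by
    intro t ht
    rcases ht.lt_or_gt with h | h
    · have e : (fun t : ℝ => max t 0 ^ s) =ᶠ[𝓝 t] fun _ => 0 := by
        filter_upwards [eventually_lt_nhds h] with y hy
        rw [max_eq_right hy.le, Real.zero_rpow (by linarith)]
      rw [max_eq_right h.le, Real.zero_rpow (by linarith), mul_zero]
      exact (hasDerivAt_const t (0 : ℝ)).congr_of_eventuallyEq e
    · have e : (fun t : ℝ => max t 0 ^ s) =ᶠ[𝓝 t] fun t => t ^ s := by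
        filter_upwards [eventually_gt_nhds h] with y hy
        rw [max_eq_left hy.le]
      rw [max_eq_left h.le]
      exact (Real.hasDerivAt_rpow_const (Or.inl h.ne')).congr_of_eventuallyEq e
  by_cases ht : t = 0
  · subst ht
    exact hasDerivAt_of_hasDerivAt_of_ne (fun y hy => hne y hy)
      (hc (by linarith)).continuousAt (continuous_const.mul (hc (by linarith))).continuousAt
  · exact hne t ht

/-- Applied with s = 2P ≥ 4, this makes the weight C² across ∂Λ, which lets the integrations by
parts run over the whole sphere. -/
lemma contDiff_max_rpow (hs : 2 < s) : ContDiff ℝ 2 fun t : ℝ => max t 0 ^ s := by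
  have h1 : ∀ {q : ℝ}, 1 < q → deriv (fun t : ℝ => max t 0 ^ q) = fun t => q * max t 0 ^ (q - 1) :=
    fun hq => funext fun t => (hasDerivAt_max_rpow hq t).deriv
  have hd : ∀ {q : ℝ}, 1 < q → Differentiable ℝ (fun t : ℝ => max t 0 ^ q) :=
    fun hq t => (hasDerivAt_max_rpow hq t).differentiableAt
  have hC : ∀ {q : ℝ}, 1 < q → ContDiff ℝ 1 fun t : ℝ => max t 0 ^ q := fun {q} hq => by
    rw [contDiff_one_iff_deriv, h1 hq]
    exact ⟨hd hq, continuous_const.mul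
      ((continuous_id.max continuous_const).rpow_const fun _ => Or.inr (by linarith))⟩
  rw [show (2 : WithTop ℕ∞) = 1 + 1 from rfl, contDiff_succ_iff_deriv, h1 (by linarith)]
  exact ⟨hd (by linarith), by simp, contDiff_const.mul (hC (by linarith))⟩

lemma pd_comp {m : ℝ → ℝ} {m' : ℝ} (i : Fin n) (hm : HasDerivAt m m' (f x))
    (hf : DifferentiableAt ℝ f x) : pd i (fun y => m (f y)) x = m' * pd i f x := by
  have := (hm.comp_hasFDerivAt x hf.hasFDerivAt).fderiv
  rw [pd, show (fun y => m (f y)) = m ∘ f from rfl, this]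
  rfl

lemma Localization.contDiffOn_rhoHat (L : Localization n) : ContDiffOn ℝ 2 L.rhoHat {0}ᶜ :=
  fun _ hx => (L.contDiffAt_rhoHat hx).contDiffWithinAt

lemma Localization.contDiffOn_weight (L : Localization n) : ContDiffOn ℝ 2 L.weight {0}ᶜ :=
  (contDiff_max_rpow (by linarith [L.two_le_P])).comp_contDiffOn L.contDiffOn_rhoHat

lemma Localization.weight_smul (hr : 0 < r) (x : E n) : L.weight (r • x) = L.weight x := by
  rw [weight, weight, norm_smul, Real.norm_of_nonneg hr.le, mul_inv, smul_smul,
    mul_right_comm, inv_mul_cancel₀ hr.ne', one_mul]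

lemma Localization.rad_weight (L : Localization n) (hx : x ≠ 0) : rad L.weight x = 0 := by
  have hd := differentiableAt_of_contDiffOn isOpen_compl_zero L.contDiffOn_weight hx (by simp)
  have h1 : HasDerivAt (fun t : ℝ => t • x) x 1 := by
    simpa using (hasDerivAt_id (1 : ℝ)).smul_const x
  have h2 : HasDerivAt (fun t : ℝ => L.weight (t • x)) (rad L.weight x) 1 := by
    have hd' : HasFDerivAt L.weight (fderiv ℝ L.weight x) ((1 : ℝ) • x) := by
      rw [one_smul]; exact hd.hasFDerivAt
    exact hd'.comp_hasDerivAt 1 h1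
  have e : (fun t : ℝ => L.weight (t • x)) =ᶠ[𝓝 1] fun _ => L.weight x := by
    filter_upwards [eventually_gt_nhds one_pos] with t ht using L.weight_smul ht x
  exact h2.unique ((hasDerivAt_const (1 : ℝ) _).congr_of_eventuallyEq e)

/-- The weight vanishes to second order on its zero set. -/
lemma Localization.pd_pd_weight_mul (hT : ContDiffOn ℝ 2 T {0}ᶜ) (hx : x ≠ 0)
    (hw : L.weight x = 0) (i j : Fin n) : pd i (pd j fun y => L.weight y * T y) x = 0 := by
  have hO := isOpen_compl_zero (n := n)
  have hP := L.two_le_P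
  have dd : ∀ {h : E n → ℝ} {y : E n}, ContDiffOn ℝ 1 h {0}ᶜ → y ≠ 0 → DifferentiableAt ℝ h y :=
    fun hh hy => differentiableAt_of_contDiffOn hO hh hy (by simp)
  have hR := L.contDiffOn_rhoHat
  have hR1 : ContDiffOn ℝ 1 L.rhoHat {0}ᶜ := hR.of_le (by norm_num)
  have hW1 : ContDiffOn ℝ 1 L.weight {0}ᶜ := L.contDiffOn_weight.of_le (by norm_num)
  have hT1 : ContDiffOn ℝ 1 T {0}ᶜ := hT.of_le (by norm_num)
  have hpT : ContDiffOn ℝ 1 (pd j T) {0}ᶜ := contDiffOn_pd hO hT (by norm_num) j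
  have hpR : ContDiffOn ℝ 1 (pd j L.rhoHat) {0}ᶜ := contDiffOn_pd hO hR (by norm_num) j
  have hpW : ContDiffOn ℝ 1 (pd j L.weight) {0}ᶜ :=
    contDiffOn_pd hO L.contDiffOn_weight (by norm_num) j
  have hz : max (L.rhoHat x) 0 = 0 :=
    (Real.rpow_eq_zero (le_max_right _ _) (by linarith)).1 hw
  have e1 : ∀ (k : Fin n) (y : E n), y ≠ 0 → pd k L.weight y
      = 2 * L.P * max (L.rhoHat y) 0 ^ (2 * L.P - 1) * pd k L.rhoHat y := fun k y hy =>
    pd_comp k (hasDerivAt_max_rpow (by linarith) _) (dd hR1 hy)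
  have e1' : ∀ k, pd k L.weight x = 0 := fun k => by
    rw [e1 k x hx, hz, Real.zero_rpow (by linarith)]; ring
  have e2 : pd i (pd j L.weight) x = 0 := by
    have ev : pd j L.weight =ᶠ[𝓝 x]
        fun y => 2 * L.P * max (L.rhoHat y) 0 ^ (2 * L.P - 1) * pd j L.rhoHat y := by
      filter_upwards [eventually_mem hO hx] with y hy using e1 j y hy
    have hm := (hasDerivAt_max_rpow (s := 2 * L.P - 1) (by linarith) (L.rhoHat x)).const_mul
      (2 * L.P)
    have hd : DifferentiableAt ℝ
        (fun y => 2 * L.P * max (L.rhoHat y) 0 ^ (2 * L.P - 1)) x :=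
      (hm.comp_hasFDerivAt x (dd hR1 hx).hasFDerivAt).differentiableAt
    rw [(pd_congr i ev).self_of_nhds, pd_mul i hd (dd hpR hx), pd_comp i hm (dd hR1 hx), hz,
      Real.zero_rpow (by linarith), Real.zero_rpow (by linarith)]
    ring
  have ev : (pd j fun y => L.weight y * T y) =ᶠ[𝓝 x]
      fun y => pd j L.weight y * T y + L.weight y * pd j T y := by
    filter_upwards [eventually_mem hO hx] with y hy using pd_mul j (dd hW1 hy) (dd hT1 hy)
  rw [(pd_congr i ev).self_of_nhds, pd_add i ((dd hpW hx).fun_mul (dd hT1 hx))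
    ((dd hW1 hx).fun_mul (dd hpT hx)), pd_mul i (dd hpW hx) (dd hT1 hx),
    pd_mul i (dd hW1 hx) (dd hpT hx), e1', e1', e2, hw]
  ring

/-! ### Shell averages of smooth functions -/

lemma avg_eq_sphInt (hr : 0 < r) (g : E n → ℝ) :
    L.avg g r = sphInt (fun x => L.weight x * g x) r / L.mass := by
  rw [Localization.avg, sphInt]
  congr 2
  funext ω
  rw [L.weight_smul hr, mul_comm]

/-- The weight is constant along rays, so only `g` is differentiated. -/
lemma radR_avg (hr : 0 < r) (hg : ContDiffOn ℝ 1 g {0}ᶜ) :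
    radR (L.avg g) r = L.avg (rad g) r := by
  have hO := isOpen_compl_zero (n := n)
  have hW1 : ContDiffOn ℝ 1 L.weight {0}ᶜ := L.contDiffOn_weight.of_le (by norm_num)
  have h1 : ContDiffOn ℝ 1 (fun x => L.weight x * g x) {0}ᶜ := hW1.mul hg
  have ev : L.avg g =ᶠ[𝓝 r] fun t => sphInt (fun x => L.weight x * g x) t / L.mass := by
    filter_upwards [eventually_gt_nhds hr] with t ht using avg_eq_sphInt ht g
  have h2 := radR_sphInt hr h1
  rw [radR] at h2
  rw [radR, ev.deriv_eq, deriv_div_const, ← mul_div_assoc, h2, avg_eq_sphInt hr]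
  congr 1
  refine sphInt_congr hr fun x hx => ?_
  rw [rad_mul (differentiableAt_of_contDiffOn hO hW1 hx (by simp))
    (differentiableAt_of_contDiffOn hO hg hx (by simp)), L.rad_weight hx]
  ring

lemma radR_congr {F G : ℝ → ℝ} (h : F =ᶠ[𝓝 r] G) : radR F r = radR G r := by
  rw [radR, radR, h.deriv_eq]

end Weight

/-! ### Weak form of the localized Hamiltonian operator. -/

section WeakHamiltonian

variable {n : ℕ} {f g φ u T : E n → ℝ} {x : E n} {r s a p : ℝ} {L : Localization n}

open Filter Topology

lemma contDiffOn_flux {k m : WithTop ℕ∞} (hf : ContDiffOn ℝ k f {0}ᶜ) (hk : m + 1 ≤ k) (s : ℝ)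
    (j : Fin n) : ContDiffOn ℝ m (flux s j f) {0}ᶜ :=
  (contDiffOn_angD isOpen_compl_zero zero_notMem_compl hf hk j).add
    ((contDiffOn_rdir zero_notMem_compl j).mul
      ((contDiffOn_rad isOpen_compl_zero hf hk).add
        (contDiffOn_const.mul (hf.of_le (le_self_add.trans hk)))))

/-- Multiplying by the weight undoes the division by ω² in the operator and leaves an expression
that is regular on the whole sphere. -/
lemma sum_pd_pd_omegaSq (hT : ContDiffOn ℝ 2 T {0}ᶜ) {T₀ : E n → ℝ}
    (hT₀ : ∀ y, T y = ‖y‖ ^ 2 * T₀ y) (hx : x ≠ 0) (i j : Fin n) :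
    L.weight x * (‖x‖ ^ 4 * ((L.omegaSq p x)⁻¹ * pd i (pd j fun y => L.omegaSq p y * T₀ y) x))
      = flux (aH n p + 2 - n - 1) i (flux (aH n p + 2 - n) j fun y => L.weight y * T y) x := by
  have hO := isOpen_compl_zero (n := n)
  have hn : 0 < ‖x‖ := norm_pos_iff.2 hx
  set s : ℝ := aH n p + 2 - n with hs
  have hQ : ContDiffOn ℝ 2 (fun y => L.weight y * T y) {0}ᶜ := L.contDiffOn_weight.mul hT
  -- The two surplus powers of r turn T₀ into T = r²T₀.
  have hsp : (n : ℝ) - 2 * p = s + 2 := by rw [hs, aH]; ring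
  have ev : (fun y => L.omegaSq p y * T₀ y) =ᶠ[𝓝 x] fun y => ‖y‖ ^ s * (L.weight y * T y) := by
    filter_upwards [eventually_mem hO hx] with y hy
    have hy' : 0 < ‖y‖ := norm_pos_iff.2 hy
    rw [Localization.omegaSq, hsp, Real.rpow_add hy', hT₀ y, Real.rpow_two]
    ring
  have e := (pd_congr i (pd_congr j ev)).self_of_nhds
  rw [e]
  -- Outside Λ the left side vanishes with the weight. The right side does too, since the weight
  -- vanishes there together with its first and second derivatives.
  by_cases hw : L.weight x = 0
  · rw [hw, zero_mul]
    have ev' : (fun y => ‖y‖ ^ s * (L.weight y * T y)) = fun y => L.weight y * (‖y‖ ^ s * T y) := by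
      funext y; ring
    have h1 := pd_pd_rpow_mul s hQ hx i j
    rw [ev', L.pd_pd_weight_mul ((contDiffOn_norm_rpow s).mul hT) hx hw i j] at h1
    exact ((mul_eq_zero.1 h1.symm).resolve_left (Real.rpow_pos_of_pos hn _).ne').symm
  · clear_value s
    rw [pd_pd_rpow_mul s hQ hx i j, Localization.omegaSq, hsp, Real.rpow_add hn,
      Real.rpow_sub hn, Real.rpow_two]
    have : ‖x‖ ^ s ≠ 0 := (Real.rpow_pos_of_pos hn _).ne'
    field_simp

lemma weight_mul_hamOp (hu : ContDiffOn ℝ 4 u {0}ᶜ) (hx : x ≠ 0) :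
    L.weight x * (‖x‖ ^ 4 * L.hamOp p u x)
      = ((n : ℝ) - 2) * ∑ i, flux (aH n p + 2 - n - 1) i
          (flux (aH n p + 2 - n) i fun y => L.weight y * scaledLap u y) x
        + ∑ i, ∑ j, flux (aH n p + 2 - n - 1) i
          (flux (aH n p + 2 - n) j fun y => L.weight y * scaledHess i j u y) x := by
  have h1 : ∀ i, _ := fun i => sum_pd_pd_omegaSq (L := L) (p := p) (T := scaledLap u)
    (T₀ := lap u) (contDiffOn_scaledLap hu (by norm_num)) (fun _ => rfl) hx i i
  have h2 : ∀ i j, _ := fun i j => sum_pd_pd_omegaSq (L := L) (p := p) (T := scaledHess i j u)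
    (T₀ := pd i (pd j u)) (contDiffOn_scaledHess hu (by norm_num) i j) (fun _ => rfl) hx i j
  simp only [← h1, ← h2, ← Finset.mul_sum]
  rw [Localization.hamOp, lap]
  ring

/-- Density of the weak form of `r⁴ H^λ[u]` tested on `φ`. -/
def weakHam (p : ℝ) (φ u : E n → ℝ) (x : E n) : ℝ :=
  ((n : ℝ) - 2) * (∑ i, weakDensity (aH n p) i i φ (scaledLap u) x)
    + ∑ i, ∑ j, weakDensity (aH n p) i j φ (scaledHess i j u) x

lemma continuousOn_weakHam (hφ : ContDiffOn ℝ 2 φ {0}ᶜ) (hu : ContDiffOn ℝ 4 u {0}ᶜ) :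
    ContinuousOn (weakHam p φ u) {0}ᶜ :=
  (continuousOn_const.mul (continuousOn_finsetSum _ fun i _ =>
    continuousOn_weakDensity hφ (contDiffOn_scaledLap hu (by norm_num)) _ i i)).add
  (continuousOn_finsetSum _ fun i _ => continuousOn_finsetSum _ fun j _ =>
    continuousOn_weakDensity hφ (contDiffOn_scaledHess hu (by norm_num) i j) _ i j)

/-- The integral over Λ is an integral over the whole sphere with a C² weight, so the double
divergences are moved onto φ one index pair at a time, without boundary terms. -/
lemma avg_mul_hamOp (hn : 3 ≤ n) (hr : 0 < r) (hφ : ContDiffOn ℝ 2 φ {0}ᶜ)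
    (hu : ContDiffOn ℝ 4 u {0}ᶜ) :
    L.avg (fun x => φ x * (‖x‖ ^ 4 * L.hamOp p u x)) r = L.avg (weakHam p φ u) r := by
  have hW := L.contDiffOn_weight
  have hl : ContDiffOn ℝ 2 (scaledLap u) {0}ᶜ := contDiffOn_scaledLap hu (by norm_num)
  have hh : ∀ i j, ContDiffOn ℝ 2 (scaledHess i j u) {0}ᶜ :=
    contDiffOn_scaledHess hu (by norm_num)
  have hF : ∀ {T : E n → ℝ}, ContDiffOn ℝ 2 T {0}ᶜ → ∀ (s : ℝ) (i j : Fin n),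
      ContinuousOn (fun x => φ x * flux (s - 1) i (flux s j fun y => L.weight y * T y) x) {0}ᶜ :=
    fun hT s i j => hφ.continuousOn.mul (contDiffOn_flux (m := 0)
      (contDiffOn_flux (m := 1) (hW.mul hT) (by norm_num) s j) (by norm_num) _ i).continuousOn
  have hD : ∀ {T : E n → ℝ}, ContDiffOn ℝ 2 T {0}ᶜ → ∀ (s : ℝ) (i j : Fin n),
      ContinuousOn (fun x => L.weight x * weakDensity s i j φ T x) {0}ᶜ := fun hT s i j =>
    hW.continuousOn.mul (continuousOn_weakDensity hφ hT s i j)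
  have hc : ∀ {s : Finset (Fin n)} {F : Fin n → E n → ℝ}, (∀ i, ContinuousOn (F i) {0}ᶜ) →
      ContinuousOn (fun x => ∑ i ∈ s, F i x) {0}ᶜ :=
    fun h => continuousOn_finsetSum _ fun i _ => h i
  have hm : ∀ {F : E n → ℝ} {k : ℝ}, ContinuousOn F {0}ᶜ →
      ContinuousOn (fun x => k * F x) {0}ᶜ := fun h => continuousOn_const.mul h
  rw [avg_eq_sphInt hr, avg_eq_sphInt hr]
  congr 1
  have e1 : ∀ x : E n, x ≠ 0 → L.weight x * (φ x * (‖x‖ ^ 4 * L.hamOp p u x))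
      = ((n : ℝ) - 2) * ∑ i, φ x * flux (aH n p + 2 - n - 1) i
          (flux (aH n p + 2 - n) i fun y => L.weight y * scaledLap u y) x
        + ∑ i, ∑ j, φ x * flux (aH n p + 2 - n - 1) i
          (flux (aH n p + 2 - n) j fun y => L.weight y * scaledHess i j u y) x := fun x hx => by
    have := weight_mul_hamOp (L := L) (p := p) hu hx
    simp only [← Finset.mul_sum]
    rw [mul_left_comm, this]
    ring
  have e2 : ∀ x : E n, x ≠ 0 → L.weight x * weakHam p φ u x
      = ((n : ℝ) - 2) * ∑ i, L.weight x * weakDensity (aH n p) i i φ (scaledLap u) x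
        + ∑ i, ∑ j, L.weight x * weakDensity (aH n p) i j φ (scaledHess i j u) x := fun x _ => by
    simp only [← Finset.mul_sum]
    rw [weakHam]
    ring
  rw [sphInt_congr hr e1, sphInt_congr hr e2,
    sphInt_add hr (hm (hc fun i => hF hl _ i i))
      (hc fun i => hc fun j => hF (hh i j) _ i j),
    sphInt_add hr (hm (hc fun i => hD hl _ i i))
      (hc fun i => hc fun j => hD (hh i j) _ i j),
    sphInt_const_mul, sphInt_const_mul, sphInt_sum hr _ fun i _ => hF hl _ i i,
    sphInt_sum hr _ fun i _ => hD hl _ i i,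
    sphInt_sum hr _ fun i _ => hc fun j => hF (hh i j) _ i j,
    sphInt_sum hr _ fun i _ => hc fun j => hD (hh i j) _ i j]
  congr 1
  · congr 1
    exact Finset.sum_congr rfl fun i _ =>
      sphInt_flux_flux hn hr hφ hW (fun x hx => L.rad_weight hx) hl i i
  · refine Finset.sum_congr rfl fun i _ => ?_
    rw [sphInt_sum hr _ fun j _ => hF (hh i j) _ i j, sphInt_sum hr _ fun j _ => hD (hh i j) _ i j]
    exact Finset.sum_congr rfl fun j _ =>
      sphInt_flux_flux hn hr hφ hW (fun x hx => L.rad_weight hx) (hh i j) i j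

lemma rad_rad_scaledLap (hu : ContDiffOn ℝ 4 u {0}ᶜ) (hx : x ≠ 0) :
    rad (rad (scaledLap u)) x = scaledLap (rad (rad u)) x := by
  have hO := isOpen_compl_zero (n := n)
  have e : rad (scaledLap u) =ᶠ[𝓝 x] scaledLap (rad u) := by
    filter_upwards [eventually_mem hO hx] with y hy
    exact rad_scaledLap (hu.of_le (by norm_num)) hy
  rw [(rad_congr e).self_of_nhds, rad_scaledLap (contDiffOn_rad hO hu (by norm_num)) hx]

lemma weakHam_eq (hφ : ContDiffOn ℝ 2 φ {0}ᶜ) (hu : ContDiffOn ℝ 4 u {0}ᶜ) (hx : x ≠ 0) :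
    weakHam p φ u x = ((n : ℝ) - 2) * (angLap φ x * (rad (rad u) x + (n - 2) * rad u x + angLap u x)
        + φ x * ((rad (rad (rad (rad u))) x + (n - 2) * rad (rad (rad u)) x + angLap (rad (rad u)) x)
          + (2 * aH n p + 2 - n) * (rad (rad (rad u)) x + (n - 2) * rad (rad u) x + angLap (rad u) x)
          + aH n p * (aH n p + 2 - n) * (rad (rad u) x + (n - 2) * rad u x + angLap u x)))
      + (hessDot φ u x + angLap φ x * rad u x - (gradDot φ (rad u) x - gradDot φ u x)
        - 2 * (gradDot φ (rad (rad u)) x - gradDot φ (rad u) x)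
        - (2 * aH n p + 1) * (gradDot φ (rad u) x - gradDot φ u x)
        - φ x * (angLap (rad u) x + ((n : ℝ) - 1) * rad (rad u) x
          + aH n p * (angLap u x + ((n : ℝ) - 1) * rad u x))
        + φ x * (rad (rad (rad (rad u))) x - rad (rad (rad u)) x
          + (2 * aH n p + 1) * (rad (rad (rad u)) x - rad (rad u) x)
          + aH n p * (aH n p + 1) * (rad (rad u) x - rad u x))) := by
  have hO := isOpen_compl_zero (n := n)
  have hu3 : ContDiffOn ℝ 3 u {0}ᶜ := hu.of_le (by norm_num)
  have hu1 : ContDiffOn ℝ 3 (rad u) {0}ᶜ := contDiffOn_rad hO hu (by norm_num)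
  have hu2 : ContDiffOn ℝ 2 (rad (rad u)) {0}ᶜ := contDiffOn_rad hO hu1 (by norm_num)
  rw [weakHam, sum_weakDensity_diag hx, sum_weakDensity_scaledHess hφ hu hx,
    rad_rad_scaledLap hu hx, rad_scaledLap hu3 hx, scaledLap_eq hu2 hx,
    scaledLap_eq (hu1.of_le (by norm_num)) hx, scaledLap_eq (hu.of_le (by norm_num)) hx]

end WeakHamiltonian

/-- The variables stand for u_j = ϑʲu, L_j = Δϑʲu, and G_ij, H_ij the scalar products of gradients
and Hessians of ϑⁱu and ϑʲu. The left side is the density of Ψ_β after the weak form has been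
inserted. The coefficients of Φ are tuned for cancellation against M: c₉² and c₁₁² combine to
(n-2)/(n-1) in front of (Δu)², which removes L0·L2 and H02, while c₁₂² removes G02 and the leading
square removes the terms with u4. With Υ included, c₁₀ removes u0·L2. -/
lemma jet_identity {n a b c c2 c13 β D : ℝ} (hn : n - 1 ≠ 0) (hD : D ≠ 0) (ha : a ≠ 0)
    (hc2 : c2 ≠ 0) (hDn : D = n ^ 2 - 3 * n + 3) (hb : b = 2 + (n - 3) * (n - 2 - a))
    (hc : c = a * (1 + (n - 2) * (n - 2 - a)))
    (u0 u1 u2 u3 u4 L0 L1 L2 G00 G01 G02 G11 G12 G22 H00 H01 H02 H11 : ℝ) :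
    1 / 2 * (2 * (u3 + a * u2 - c2 * u1) ^ 2 + 2 * (u2 + a * u1 - c2 * u0) * (u4 + a * u3 - c2 * u2)
        + 2 * (D / (n - 1) ^ 2) * ((L1 + -((n - 1) / D) * (c + (n - 2) * c2) * u1) ^ 2
          + (L0 + -((n - 1) / D) * (c + (n - 2) * c2) * u0)
            * (L2 + -((n - 1) / D) * (c + (n - 2) * c2) * u2))
        + 2 * (1 / (n - 1)) * (H11 + H02 - (L1 ^ 2 + L0 * L2) / (n - 1))
        + 2 * (2 / (n - 1) * (1 + a + c2)) * (G11 + G02) + 2 * c13 ^ 2 * (u1 ^ 2 + u0 * u2))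
      + 3 * a * (1 / 2 * (2 * (u2 + a * u1 - c2 * u0) * (u3 + a * u2 - c2 * u1)
        + 2 * (D / (n - 1) ^ 2) * ((L0 + -((n - 1) / D) * (c + (n - 2) * c2) * u0)
            * (L1 + -((n - 1) / D) * (c + (n - 2) * c2) * u1))
        + 2 * (1 / (n - 1)) * (H01 - L0 * L1 / (n - 1))
        + 2 * (2 / (n - 1) * (1 + a + c2)) * G01 + 2 * c13 ^ 2 * (u0 * u1)))
      + 2 * a ^ 2 * (1 / 2 * ((u2 + a * u1 - c2 * u0) ^ 2
        + (D / (n - 1) ^ 2) * (L0 + -((n - 1) / D) * (c + (n - 2) * c2) * u0) ^ 2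
        + (1 / (n - 1)) * (H00 - L0 ^ 2 / (n - 1))
        + (2 / (n - 1) * (1 + a + c2)) * G00 + c13 ^ 2 * u0 ^ 2))
      + -(1 / (n - 1)) * ((n - 2) * ((L2 + a * L1 - c2 * L0) * (u2 + (n - 2) * u1 + L0)
          + (u2 + a * u1 - c2 * u0) * ((u4 + (n - 2) * u3 + L2)
            + (2 * a + 2 - n) * (u3 + (n - 2) * u2 + L1)
            + a * (a + 2 - n) * (u2 + (n - 2) * u1 + L0)))
        + ((H02 + a * H01 - c2 * H00) + (L2 + a * L1 - c2 * L0) * u1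
          - ((G12 + a * G11 - c2 * G01) - (G02 + a * G01 - c2 * G00))
          - 2 * ((G22 + a * G12 - c2 * G02) - (G12 + a * G11 - c2 * G01))
          - (2 * a + 1) * ((G12 + a * G11 - c2 * G01) - (G02 + a * G01 - c2 * G00))
          - (u2 + a * u1 - c2 * u0) * (L1 + (n - 1) * u2 + a * (L0 + (n - 1) * u1))
          + (u2 + a * u1 - c2 * u0) * (u4 - u3 + (2 * a + 1) * (u3 - u2) + a * (a + 1) * (u2 - u1))))
      - ((-(2 * ((n - 2) / (n - 1)) * (u3 + a * u2) + c / ((n - 1) * a) * (u2 + a * u1)) * (L1 + a * L0)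
          - (2 * ((n - 2) / (n - 1)) * (u2 + a * u1) + c / ((n - 1) * a) * (u1 + a * u0)) * (L2 + a * L1)
          + 2 * a * ((u2 + a * u1) * (u3 + a * u2))
          - 2 * c2 * ((u2 + a * u1) ^ 2 + (u1 + a * u0) * (u3 + a * u2)))
        + β * (-(2 * ((n - 2) / (n - 1)) * (u2 + a * u1) + c / ((n - 1) * a) * (u1 + a * u0))
            * (L1 + a * L0) + a * (u2 + a * u1) ^ 2 - 2 * c2 * ((u1 + a * u0) * (u2 + a * u1))))
    = 1 / (n - 1) * ((H11 + 2 * a * H01 + a ^ 2 * H00 - (L1 + a * L0) ^ 2 / (n - 1))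
        + 2 * (G22 + 2 * a * G12 + a ^ 2 * G11)
        + 2 * (c2 + 1 + a) * (G11 + 2 * a * G01 + a ^ 2 * G00))
      + ((u3 + a * u2 + (n - 2) / (n - 1) * (L1 + a * L0)) ^ 2
        + 1 / (n - 1) * (L1 + a * L0) ^ 2
        + 2 * (c / a + (n - 2) * β) / (n - 1) * ((u2 + a * u1) * (L1 + a * L0))
        + (c2 + b + a * (a - β)) * (u2 + a * u1) ^ 2
        - 1 / (n - 1) * (2 * (n - 2) * c2 + (2 * a - β) * (c / a)) * ((u1 + a * u0) * (L1 + a * L0))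
        + 2 * (β - a) * c2 * ((u1 + a * u0) * (u2 + a * u1))
        + (c13 ^ 2 + 1 / D * (c + (n - 2) * c2) ^ 2 - c2 * (b - c2) + c2 * b) * (u1 + a * u0) ^ 2)
      + (c2 * c / ((n - 1) * a) * ((u1 + a * u0 - a / c2 * (u2 + a * u1)) * L0 - (L1 + a * L0) * u0)
        + (c13 ^ 2 + 1 / D * (c + (n - 2) * c2) ^ 2 - c2 * (b - c2)) * ((u2 + a * u1) * u0))
      + c2 / (n - 1) * ((n - 2) * L0 ^ 2 + H00 + 2 * (1 + a) * G00 - c * (u0 * L0)) := by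
  -- Writing n = N + 1 and c = ae turns the denominators n - 1, a and D into atoms; D is expanded
  -- only after they are cleared.
  obtain ⟨N, rfl⟩ : ∃ N, n = N + 1 := ⟨n - 1, by ring⟩
  obtain ⟨e, rfl⟩ : ∃ e, c = a * e := ⟨_, hc⟩
  have he := mul_left_cancel₀ ha hc
  simp only [add_sub_cancel_right] at hn ⊢
  rw [hb, he]
  field_simp
  rw [hDn]
  ring

/-! ### Radial derivatives of the densities of Φ and Υ. -/

section RadialJets

variable {n : ℕ} {f g φ u w : E n → ℝ} {x : E n} {f' g' c r p : ℝ} {L : Localization n}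

open Filter Topology

/-- `f` is differentiable at `x` with radial derivative `f'`. -/
def HasRad (f : E n → ℝ) (f' : ℝ) (x : E n) : Prop := DifferentiableAt ℝ f x ∧ rad f x = f'

lemma hasRad_rad (h : ContDiffOn ℝ 1 f {0}ᶜ) (hx : x ≠ 0) : HasRad f (rad f x) x :=
  ⟨differentiableAt_of_contDiffOn isOpen_compl_zero h hx (by simp), rfl⟩

/-- These rules assemble the radial derivative of a density term by term, with differentiability
carried along. -/
lemma HasRad.add (hf : HasRad f f' x) (hg : HasRad g g' x) :
    HasRad (fun y => f y + g y) (f' + g') x :=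
  ⟨hf.1.fun_add hg.1, by rw [rad_add hf.1 hg.1, hf.2, hg.2]⟩

lemma HasRad.sub (hf : HasRad f f' x) (hg : HasRad g g' x) :
    HasRad (fun y => f y - g y) (f' - g') x :=
  ⟨hf.1.fun_sub hg.1, by rw [rad_sub hf.1 hg.1, hf.2, hg.2]⟩

lemma HasRad.mul (hf : HasRad f f' x) (hg : HasRad g g' x) :
    HasRad (fun y => f y * g y) (f' * g x + f x * g') x :=
  ⟨hf.1.fun_mul hg.1, by rw [rad_mul hf.1 hg.1, hf.2, hg.2]⟩

lemma HasRad.const_mul (c : ℝ) (hf : HasRad f f' x) : HasRad (fun y => c * f y) (c * f') x :=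
  ⟨hf.1.const_mul c, by rw [rad_const_mul c hf.1, hf.2]⟩

lemma HasRad.sq (hf : HasRad f f' x) : HasRad (fun y => f y ^ 2) (2 * (f x * f')) x := by
  have := hf.mul hf
  simp only [← pow_two] at this
  convert this using 1
  ring

lemma HasRad.congr_val (hf : HasRad f f' x) (h : f' = g') : HasRad f g' x := h ▸ hf

lemma hasRad_angLap (h : ContDiffOn ℝ 3 f {0}ᶜ) (hx : x ≠ 0) :
    HasRad (angLap f) (angLap (rad f) x) x :=
  ⟨differentiableAt_of_contDiffOn isOpen_compl_zero
    (contDiffOn_angLap (m := 1) isOpen_compl_zero zero_notMem_compl h (by norm_num)) hx (by simp),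
    rad_angLap isOpen_compl_zero zero_notMem_compl h hx⟩

lemma hasRad_gradDot (hf : ContDiffOn ℝ 2 f {0}ᶜ) (hg : ContDiffOn ℝ 2 g {0}ᶜ) (hx : x ≠ 0) :
    HasRad (gradDot f g) (gradDot (rad f) g x + gradDot f (rad g) x) x :=
  ⟨differentiableAt_of_contDiffOn isOpen_compl_zero
    (contDiffOn_gradDot (m := 1) isOpen_compl_zero zero_notMem_compl hf hg (by norm_num)) hx
      (by simp), rad_gradDot isOpen_compl_zero zero_notMem_compl hf hg hx⟩

lemma hasRad_hessDot (hf : ContDiffOn ℝ 3 f {0}ᶜ) (hg : ContDiffOn ℝ 3 g {0}ᶜ) (hx : x ≠ 0) :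
    HasRad (hessDot f g) (hessDot (rad f) g x + hessDot f (rad g) x) x :=
  ⟨differentiableAt_of_contDiffOn isOpen_compl_zero
    (contDiffOn_hessDot (m := 1) isOpen_compl_zero zero_notMem_compl hf hg (by norm_num)) hx
      (by simp), rad_hessDot isOpen_compl_zero zero_notMem_compl hf hg hx⟩

lemma contDiffOn_rad_compl {k m : WithTop ℕ∞} (hf : ContDiffOn ℝ k f {0}ᶜ) (hk : m + 1 ≤ k) :
    ContDiffOn ℝ m (rad f) {0}ᶜ := contDiffOn_rad isOpen_compl_zero hf hk

/-- The density of the shell energy, in terms of its coefficients. -/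
def energyDensity (a c2 k9 c10 k11 k12 k13 : ℝ) (u : E n → ℝ) (x : E n) : ℝ :=
  (rad (rad u) x + a * rad u x - c2 * u x) ^ 2 + k9 * (angLap u x + c10 * u x) ^ 2
    + k11 * (hessDot u u x - 1 / ((n : ℝ) - 1) * angLap u x ^ 2)
    + k12 * gradDot u u x + k13 * u x ^ 2

/-- The radial derivative of `energyDensity`. -/
def energyDensity₁ (a c2 k9 c10 k11 k12 k13 : ℝ) (u : E n → ℝ) (x : E n) : ℝ :=
  2 * ((rad (rad u) x + a * rad u x - c2 * u x)
      * (rad (rad (rad u)) x + a * rad (rad u) x - c2 * rad u x))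
    + k9 * (2 * ((angLap u x + c10 * u x) * (angLap (rad u) x + c10 * rad u x)))
    + k11 * (2 * hessDot u (rad u) x - 1 / ((n : ℝ) - 1) * (2 * (angLap u x * angLap (rad u) x)))
    + k12 * (2 * gradDot u (rad u) x) + k13 * (2 * (u x * rad u x))

/-- The second radial derivative of `energyDensity`. -/
def energyDensity₂ (a c2 k9 c10 k11 k12 k13 : ℝ) (u : E n → ℝ) (x : E n) : ℝ :=
  2 * ((rad (rad (rad u)) x + a * rad (rad u) x - c2 * rad u x) ^ 2
      + (rad (rad u) x + a * rad u x - c2 * u x)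
        * (rad (rad (rad (rad u))) x + a * rad (rad (rad u)) x - c2 * rad (rad u) x))
    + k9 * (2 * ((angLap (rad u) x + c10 * rad u x) ^ 2
      + (angLap u x + c10 * u x) * (angLap (rad (rad u)) x + c10 * rad (rad u) x)))
    + k11 * (2 * (hessDot (rad u) (rad u) x + hessDot u (rad (rad u)) x)
      - 1 / ((n : ℝ) - 1) * (2 * (angLap (rad u) x ^ 2 + angLap u x * angLap (rad (rad u)) x)))
    + k12 * (2 * (gradDot (rad u) (rad u) x + gradDot u (rad (rad u)) x))
    + k13 * (2 * (rad u x ^ 2 + u x * rad (rad u) x))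

variable {a c2 k9 c10 k11 k12 k13 : ℝ}

lemma hasRad_energyDensity (hu : ContDiffOn ℝ 4 u {0}ᶜ) (hx : x ≠ 0) :
    HasRad (energyDensity a c2 k9 c10 k11 k12 k13 u)
      (energyDensity₁ a c2 k9 c10 k11 k12 k13 u x) x := by
  have hu1 : ContDiffOn ℝ 3 (rad u) {0}ᶜ := contDiffOn_rad_compl hu (by norm_num)
  have hu2 : ContDiffOn ℝ 2 (rad (rad u)) {0}ᶜ := contDiffOn_rad_compl hu1 (by norm_num)
  have hu' : ContDiffOn ℝ 3 u {0}ᶜ := hu.of_le (by norm_num)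
  have r0 := hasRad_rad (hu.of_le (by norm_num)) hx
  have r1 := hasRad_rad (hu1.of_le (by norm_num)) hx
  have r2 := hasRad_rad (hu2.of_le (by norm_num)) hx
  have l0 := hasRad_angLap hu' hx
  have g0 := hasRad_gradDot (hu'.of_le (by norm_num)) (hu'.of_le (by norm_num)) hx
  have h0 := hasRad_hessDot hu' hu' hx
  refine (((((((r2.add (r1.const_mul a)).sub (r0.const_mul c2)).sq).add
    ((l0.add (r0.const_mul c10)).sq.const_mul k9)).add
    ((h0.sub (l0.sq.const_mul _)).const_mul k11)).add (g0.const_mul k12)).add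
    (r0.sq.const_mul k13)).congr_val ?_
  rw [energyDensity₁, hessDot_comm (rad u) u, gradDot_comm (rad u) u]
  ring

lemma hasRad_energyDensity₁ (hu : ContDiffOn ℝ 4 u {0}ᶜ) (hx : x ≠ 0) :
    HasRad (energyDensity₁ a c2 k9 c10 k11 k12 k13 u)
      (energyDensity₂ a c2 k9 c10 k11 k12 k13 u x) x := by
  have hu1 : ContDiffOn ℝ 3 (rad u) {0}ᶜ := contDiffOn_rad_compl hu (by norm_num)
  have hu2 : ContDiffOn ℝ 2 (rad (rad u)) {0}ᶜ := contDiffOn_rad_compl hu1 (by norm_num)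
  have hu3 : ContDiffOn ℝ 1 (rad (rad (rad u))) {0}ᶜ := contDiffOn_rad_compl hu2 (by norm_num)
  have hu' : ContDiffOn ℝ 3 u {0}ᶜ := hu.of_le (by norm_num)
  have r0 := hasRad_rad (hu.of_le (by norm_num)) hx
  have r1 := hasRad_rad (hu1.of_le (by norm_num)) hx
  have r2 := hasRad_rad (hu2.of_le (by norm_num)) hx
  have r3 := hasRad_rad hu3 hx
  have l0 := hasRad_angLap hu' hx
  have l1 := hasRad_angLap hu1 hx
  have g0 := hasRad_gradDot (hu'.of_le (by norm_num)) (hu1.of_le (by norm_num)) hx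
  have h0 := hasRad_hessDot hu' hu1 hx
  refine ((((((((r2.add (r1.const_mul a)).sub (r0.const_mul c2)).mul
    ((r3.add (r2.const_mul a)).sub (r1.const_mul c2))).const_mul 2).add
    ((((l0.add (r0.const_mul c10)).mul (l1.add (r1.const_mul c10))).const_mul 2).const_mul k9)).add
    (((h0.const_mul 2).sub (((l0.mul l1).const_mul 2).const_mul _)).const_mul k11)).add
    ((g0.const_mul 2).const_mul k12)).add
    (((r0.mul r1).const_mul 2).const_mul k13)).congr_val ?_
  rw [energyDensity₂]
  ring

lemma contDiffOn_energyDensity (hu : ContDiffOn ℝ 4 u {0}ᶜ) :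
    ContDiffOn ℝ 2 (energyDensity a c2 k9 c10 k11 k12 k13 u) {0}ᶜ := by
  have hO := isOpen_compl_zero (n := n)
  have h0 := zero_notMem_compl (n := n)
  have hu1 : ContDiffOn ℝ 3 (rad u) {0}ᶜ := contDiffOn_rad_compl hu (by norm_num)
  have hu2 : ContDiffOn ℝ 2 (rad (rad u)) {0}ᶜ := contDiffOn_rad_compl hu1 (by norm_num)
  have hu1' : ContDiffOn ℝ 2 (rad u) {0}ᶜ := hu1.of_le (by norm_num)
  have hu' : ContDiffOn ℝ 2 u {0}ᶜ := hu.of_le (by norm_num)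
  have l0 : ContDiffOn ℝ 2 (angLap u) {0}ᶜ := contDiffOn_angLap hO h0 hu (by norm_num)
  have g0 : ContDiffOn ℝ 2 (gradDot u u) {0}ᶜ :=
    contDiffOn_gradDot hO h0 (hu.of_le (by norm_num)) (hu.of_le (by norm_num)) le_rfl
  have d0 : ContDiffOn ℝ 2 (hessDot u u) {0}ᶜ := contDiffOn_hessDot hO h0 hu hu (by norm_num)
  unfold energyDensity
  fun_prop

/-- The density of the functional `Υ`, in terms of its coefficients. -/
def upsilonDensity (k c a c2 : ℝ) (w : E n → ℝ) (x : E n) : ℝ :=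
  -(2 * k * rad w x + c * w x) * angLap w x + a * rad w x ^ 2 - 2 * c2 * (w x * rad w x)

/-- The radial derivative of `upsilonDensity`. -/
def upsilonDensity₁ (k c a c2 : ℝ) (w : E n → ℝ) (x : E n) : ℝ :=
  -(2 * k * rad (rad w) x + c * rad w x) * angLap w x
    - (2 * k * rad w x + c * w x) * angLap (rad w) x
    + 2 * a * (rad w x * rad (rad w) x)
    - 2 * c2 * (rad w x ^ 2 + w x * rad (rad w) x)

variable {k : ℝ}

lemma hasRad_upsilonDensity (hw : ContDiffOn ℝ 3 w {0}ᶜ) (hx : x ≠ 0) :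
    HasRad (upsilonDensity k c a c2 w) (upsilonDensity₁ k c a c2 w x) x := by
  have hw1 : ContDiffOn ℝ 2 (rad w) {0}ᶜ := contDiffOn_rad_compl hw (by norm_num)
  have r0 := hasRad_rad (hw.of_le (by norm_num)) hx
  have r1 := hasRad_rad (hw1.of_le (by norm_num)) hx
  have l0 := hasRad_angLap hw hx
  have h := ((((r1.const_mul (2 * k)).add (r0.const_mul c)).mul l0).const_mul (-1)).add
    (r1.sq.const_mul a) |>.sub ((r0.mul r1).const_mul (2 * c2))
  have e : upsilonDensity k c a c2 w = fun y => -1 * ((2 * k * rad w y + c * w y) * angLap w y)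
      + a * rad w y ^ 2 - 2 * c2 * (w y * rad w y) := by
    funext y; rw [upsilonDensity]; ring
  rw [e]
  refine h.congr_val ?_
  rw [upsilonDensity₁]
  ring

lemma contDiffOn_upsilonDensity (hw : ContDiffOn ℝ 3 w {0}ᶜ) :
    ContDiffOn ℝ 1 (upsilonDensity k c a c2 w) {0}ᶜ := by
  have hw1 : ContDiffOn ℝ 1 (rad w) {0}ᶜ := contDiffOn_rad_compl hw (by norm_num)
  have hw' : ContDiffOn ℝ 1 w {0}ᶜ := hw.of_le (by norm_num)
  have l0 : ContDiffOn ℝ 1 (angLap w) {0}ᶜ :=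
    contDiffOn_angLap isOpen_compl_zero zero_notMem_compl hw (by norm_num)
  unfold upsilonDensity
  fun_prop

end RadialJets

/-! ### The dissipation identity for functions that are C⁴ away from the origin. -/

section DissipationIdentity

variable {n : ℕ} {f g φ u w : E n → ℝ} {x : E n} {a c r p c2 c13 β : ℝ} {L : Localization n}

open Filter Topology

lemma avg_congr_of_ne_zero (hr : 0 < r) (h : ∀ x, x ≠ 0 → f x = g x) : L.avg f r = L.avg g r :=
  avg_congr fun ω _ => h _ (smul_sphere_ne_zero hr ω)

lemma avg_comb (hr : 0 < r) (c : ℝ) (hf : ContinuousOn f {0}ᶜ) (hg : ContinuousOn g {0}ᶜ) :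
    L.avg (fun x => f x + c * g x) r = L.avg f r + c * L.avg g r := by
  have hi : ∀ {h : E n → ℝ}, ContinuousOn h {0}ᶜ → L.ShellIntegrable h r := fun hh =>
    ((continuous_smul_sphere hr hh).mul L.continuous_weight).integrable_of_hasCompactSupport
      (HasCompactSupport.of_compactSpace _)
  have hg' : ContinuousOn (fun x => c * g x) {0}ᶜ := continuousOn_const.mul hg
  rw [avg_add (hi hf) (hi hg'), avg_const_mul]

lemma radR_const_mul (c : ℝ) (F : ℝ → ℝ) (r : ℝ) : radR (fun t => c * F t) r = c * radR F r := by
  rw [radR, radR, deriv_const_mul_field]; ring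

lemma gradDot_comb_self (c : ℝ) (hf : DifferentiableAt ℝ f x) (hg : DifferentiableAt ℝ g x) :
    gradDot (fun y => f y + c * g y) (fun y => f y + c * g y) x
      = gradDot f f x + 2 * c * gradDot g f x + c ^ 2 * gradDot g g x := by
  rw [gradDot_comb c hf hg, gradDot_comm f, gradDot_comm g, gradDot_comb c hf hg,
    gradDot_comb c hf hg, gradDot_comm f g]
  ring

lemma hessDot_comb_self (c : ℝ) (hf : ContDiffOn ℝ 2 f {0}ᶜ) (hg : ContDiffOn ℝ 2 g {0}ᶜ)
    (hx : x ≠ 0) :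
    hessDot (fun y => f y + c * g y) (fun y => f y + c * g y) x
      = hessDot f f x + 2 * c * hessDot g f x + c ^ 2 * hessDot g g x := by
  have h : ∀ k : E n → ℝ, hessDot (fun y => f y + c * g y) k x
      = hessDot f k x + c * hessDot g k x := fun k =>
    hessDot_comb isOpen_compl_zero zero_notMem_compl c hf hg hx
  rw [h, hessDot_comm f, hessDot_comm g, h, h, hessDot_comm f g]
  ring

/-- The test function `ϑ²u + a ϑu - c₂ u`. -/
def testFun (p c2 : ℝ) (u : E n → ℝ) (x : E n) : ℝ :=
  (rad (rad u) x + aH n p * rad u x) + -c2 * u x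

/-- The coefficient of `u` in the square of `Δ_S u + c₁₀ u`. -/
def c10 (n : ℕ) (p c2 : ℝ) : ℝ :=
  -(((n : ℝ) - 1) / ((n : ℝ) ^ 2 - 3 * n + 3)) * (cH n p + ((n : ℝ) - 2) * c2)

/-- The density of the shell energy for the chosen coefficients. -/
def chosenDensity (p c2 c13 : ℝ) (u : E n → ℝ) : E n → ℝ :=
  energyDensity (aH n p) c2 (((n : ℝ) ^ 2 - 3 * n + 3) / ((n : ℝ) - 1) ^ 2) (c10 n p c2)
    (1 / ((n : ℝ) - 1)) (2 / ((n : ℝ) - 1) * (1 + aH n p + c2)) (c13 ^ 2) u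

/-- The radial derivative of `chosenDensity`. -/
def chosenDensity₁ (p c2 c13 : ℝ) (u : E n → ℝ) : E n → ℝ :=
  energyDensity₁ (aH n p) c2 (((n : ℝ) ^ 2 - 3 * n + 3) / ((n : ℝ) - 1) ^ 2) (c10 n p c2)
    (1 / ((n : ℝ) - 1)) (2 / ((n : ℝ) - 1) * (1 + aH n p + c2)) (c13 ^ 2) u

/-- The second radial derivative of `chosenDensity`. -/
def chosenDensity₂ (p c2 c13 : ℝ) (u : E n → ℝ) : E n → ℝ :=
  energyDensity₂ (aH n p) c2 (((n : ℝ) ^ 2 - 3 * n + 3) / ((n : ℝ) - 1) ^ 2) (c10 n p c2)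
    (1 / ((n : ℝ) - 1)) (2 / ((n : ℝ) - 1) * (1 + aH n p + c2)) (c13 ^ 2) u

/-- The density of `Υ` for the chosen coefficients. -/
def chosenUpsilon (p c2 : ℝ) (u : E n → ℝ) : E n → ℝ :=
  upsilonDensity (((n : ℝ) - 2) / ((n : ℝ) - 1)) (cH n p / (((n : ℝ) - 1) * aH n p)) (aH n p) c2
    (harm p u)

/-- The radial derivative of `chosenUpsilon`. -/
def chosenUpsilon₁ (p c2 : ℝ) (u : E n → ℝ) : E n → ℝ :=
  upsilonDensity₁ (((n : ℝ) - 2) / ((n : ℝ) - 1)) (cH n p / (((n : ℝ) - 1) * aH n p)) (aH n p) c2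
    (harm p u)

lemma sub_one_pos (hn : 3 ≤ n) : 0 < (n : ℝ) - 1 := by linarith [one_le_sub_two hn]

lemma sq_sub_pos (n : ℕ) : 0 < (n : ℝ) ^ 2 - 3 * n + 3 := by nlinarith [sq_nonneg ((n : ℝ) - 3 / 2)]

/-- Everything is expanded in the jet of `u` and handed to `jet_identity`. The equality is
pointwise, because the weak form has already absorbed all integrations by parts. -/
lemma psiDensity_eq (hn : 3 ≤ n) (hp : p < (n : ℝ) - 2) (hc2 : 0 < c2)
    (hu : ContDiffOn ℝ 4 u {0}ᶜ) (hx : x ≠ 0) :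
    psiDensity p c2 c13 β u x = 1 / 2 * (chosenDensity₂ p c2 c13 u x
      + 3 * aH n p * chosenDensity₁ p c2 c13 u x + 2 * aH n p ^ 2 * chosenDensity p c2 c13 u x
      + -(2 / ((n : ℝ) - 1)) * weakHam p (testFun p c2 u) u x
      + -2 * chosenUpsilon₁ p c2 u x + -(2 * β) * chosenUpsilon p c2 u x) := by
  have hO := isOpen_compl_zero (n := n)
  have h0 := zero_notMem_compl (n := n)
  have hn1 := sub_one_pos hn
  have hu3 : ContDiffOn ℝ 3 u {0}ᶜ := hu.of_le (by norm_num)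
  have hu' : ContDiffOn ℝ 2 u {0}ᶜ := hu.of_le (by norm_num)
  have hu1 : ContDiffOn ℝ 3 (rad u) {0}ᶜ := contDiffOn_rad_compl hu (by norm_num)
  have hu1' : ContDiffOn ℝ 2 (rad u) {0}ᶜ := hu1.of_le (by norm_num)
  have hu2 : ContDiffOn ℝ 2 (rad (rad u)) {0}ᶜ := contDiffOn_rad_compl hu1 (by norm_num)
  have hv : ContDiffOn ℝ 2 (fun y => rad (rad u) y + aH n p * rad u y) {0}ᶜ :=
    hu2.add (contDiffOn_const.mul hu1')
  have hφ : ContDiffOn ℝ 2 (testFun p c2 u) {0}ᶜ := hv.add (contDiffOn_const.mul hu')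
  have d0 := differentiableAt_of_contDiffOn hO hu' hx (by simp)
  have d1 := differentiableAt_of_contDiffOn hO hu1' hx (by simp)
  have d2 := differentiableAt_of_contDiffOn hO hu2 hx (by simp)
  have dv := differentiableAt_of_contDiffOn hO hv hx (by simp)
  have ev := rad_harm_eventually (p := p) hO hu' hx
  have tφ : ∀ y, testFun p c2 u y = (rad (rad u) y + aH n p * rad u y) + -c2 * u y := fun _ => rfl
  have lφ : angLap (testFun p c2 u) x
      = angLap (rad (rad u)) x + aH n p * angLap (rad u) x - c2 * angLap u x := by
    have := angLap_comb hO h0 (-c2) hv hu' hx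
    rw [angLap_comb hO h0 _ hu2 hu1' hx] at this
    rw [sub_eq_add_neg, ← neg_mul, ← this]; rfl
  have gφ : ∀ k : E n → ℝ, gradDot (testFun p c2 u) k x
      = gradDot (rad (rad u)) k x + aH n p * gradDot (rad u) k x - c2 * gradDot u k x := fun k => by
    have := gradDot_comb (h := k) (-c2) dv d0
    rw [gradDot_comb _ d2 d1] at this
    rw [sub_eq_add_neg, ← neg_mul, ← this]; rfl
  have hφu : hessDot (testFun p c2 u) u x
      = hessDot (rad (rad u)) u x + aH n p * hessDot (rad u) u x - c2 * hessDot u u x := by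
    have := hessDot_comb (h := u) hO h0 (-c2) hv hu' hx
    rw [hessDot_comb hO h0 _ hu2 hu1' hx] at this
    rw [sub_eq_add_neg, ← neg_mul, ← this]; rfl
  have lw : angLap (harm p u) x = angLap (rad u) x + aH n p * angLap u x :=
    angLap_comb hO h0 _ hu1' hu' hx
  have lw1 : angLap (rad (harm p u)) x = angLap (rad (rad u)) x + aH n p * angLap (rad u) x := by
    rw [(angLap_congr ev).self_of_nhds, angLap_comb hO h0 _ hu2 hu1' hx]
  have gw : gradSq (harm p u) x = _ := gradDot_comb_self (aH n p) d1 d0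
  have gw1 : gradSq (rad (harm p u)) x = _ :=
    (gradSq_congr ev).self_of_nhds.trans (gradDot_comb_self (aH n p) d2 d1)
  have hw : hessDot (harm p u) (harm p u) x = _ := hessDot_comb_self (aH n p) hu1' hu' hx
  have key := jet_identity (n := n) (a := aH n p) (b := bH n p) (c := cH n p) (c13 := c13) (β := β)
    hn1.ne' (sq_sub_pos n).ne' (aH_pos hp).ne' hc2.ne' rfl rfl rfl
    (u x) (rad u x) (rad (rad u) x) (rad (rad (rad u)) x) (rad (rad (rad (rad u))) x)
    (angLap u x) (angLap (rad u) x) (angLap (rad (rad u)) x)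
    (gradDot u u x) (gradDot u (rad u) x) (gradDot u (rad (rad u)) x) (gradDot (rad u) (rad u) x)
    (gradDot (rad u) (rad (rad u)) x) (gradDot (rad (rad u)) (rad (rad u)) x)
    (hessDot u u x) (hessDot u (rad u) x) (hessDot u (rad (rad u)) x) (hessDot (rad u) (rad u) x)
  rw [psiDensity, psiTen, psiSca, psiBil, harmonicForm, chosenDensity₂, chosenDensity₁,
    chosenDensity, chosenUpsilon₁, chosenUpsilon, energyDensity, energyDensity₁, energyDensity₂,
    upsilonDensity, upsilonDensity₁, weakHam_eq hφ hu hx, hessTracelessSq_eq hn1.ne' _ hx,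
    ← hessDot_self, ← hessDot_self, hw, gw, gw1, lw, lw1, lφ, gφ, gφ, gφ, hφu, tφ, rad_harm hO hu' hx,
    rad_rad_harm hO hu3 hx, c130, c10, gradSq, harm, gradDot_comm (rad u) u,
    gradDot_comm (rad (rad u)) u, gradDot_comm (rad (rad u)) (rad u), hessDot_comm (rad u) u,
    hessDot_comm (rad (rad u)) u]
  linear_combination -key

/-- Each of Φ, ϑΦ, ϑ²Φ, M, Υ and ϑΥ becomes the average of a continuous density; by linearity their
combination is the average of the pointwise identity. -/
lemma dissipation_eq_of_contDiffOn (hn : 3 ≤ n) (hp : p < (n : ℝ) - 2) (hc2 : 0 < c2)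
    (hr : 0 < r) (hu : ContDiffOn ℝ 4 u {0}ᶜ) :
    dissipation L p (chosen n p c2 c13) β u r = dissipationForm L p c2 c13 β u r := by
  have hO := isOpen_compl_zero (n := n)
  have hn1 := sub_one_pos hn
  have ha := aH_pos hp
  have hD := sq_sub_pos n
  have hu1 : ContDiffOn ℝ 3 (rad u) {0}ᶜ := contDiffOn_rad_compl hu (by norm_num)
  have hu2 : ContDiffOn ℝ 2 (rad (rad u)) {0}ᶜ := contDiffOn_rad_compl hu1 (by norm_num)
  have hw : ContDiffOn ℝ 3 (harm p u) {0}ᶜ := contDiffOn_harm hO hu (by norm_num)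
  have hφ : ContDiffOn ℝ 2 (testFun p c2 u) {0}ᶜ :=
    (hu2.add (contDiffOn_const.mul (hu1.of_le (by norm_num)))).add
      (contDiffOn_const.mul (hu.of_le (by norm_num)))
  have s0 : ContDiffOn ℝ 2 (chosenDensity p c2 c13 u) {0}ᶜ := contDiffOn_energyDensity hu
  have s1 : ContDiffOn ℝ 1 (rad (chosenDensity p c2 c13 u)) {0}ᶜ :=
    contDiffOn_rad_compl s0 (by norm_num)
  have e1 : ∀ x, x ≠ 0 → rad (chosenDensity p c2 c13 u) x = chosenDensity₁ p c2 c13 u x :=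
    fun x hx => (hasRad_energyDensity hu hx).2
  have e2 : ∀ x, x ≠ 0 → rad (rad (chosenDensity p c2 c13 u)) x = chosenDensity₂ p c2 c13 u x := by
    intro x hx
    have ev : rad (chosenDensity p c2 c13 u) =ᶠ[𝓝 x] chosenDensity₁ p c2 c13 u := by
      filter_upwards [eventually_mem hO hx] with y hy using e1 y hy
    exact (rad_congr ev).self_of_nhds.trans (hasRad_energyDensity₁ hu hx).2
  have t0 : ContDiffOn ℝ 1 (chosenUpsilon p c2 u) {0}ᶜ := contDiffOn_upsilonDensity hw
  have f1 : ∀ x, x ≠ 0 → rad (chosenUpsilon p c2 u) x = chosenUpsilon₁ p c2 u x :=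
    fun x hx => (hasRad_upsilonDensity hw hx).2
  have k0 : ContinuousOn (chosenDensity p c2 c13 u) {0}ᶜ := s0.continuousOn
  have k1 : ContinuousOn (chosenDensity₁ p c2 c13 u) {0}ᶜ :=
    s1.continuousOn.congr fun x hx => (e1 x hx).symm
  have k2 : ContinuousOn (chosenDensity₂ p c2 c13 u) {0}ᶜ :=
    (contDiffOn_rad_compl (m := 0) s1 (by simp)).continuousOn.congr fun x hx => (e2 x hx).symm
  have l0 : ContinuousOn (chosenUpsilon p c2 u) {0}ᶜ := t0.continuousOn
  have l1 : ContinuousOn (chosenUpsilon₁ p c2 u) {0}ᶜ :=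
    (contDiffOn_rad_compl (m := 0) t0 (by simp)).continuousOn.congr fun x hx => (f1 x hx).symm
  have hΦ : ∀ t, 0 < t → shellEnergy L (chosen n p c2 c13) u t
      = 1 / 2 * L.avg (chosenDensity p c2 c13 u) t := fun t ht => by
    rw [shellEnergy]
    congr 1
    refine avg_congr_of_ne_zero ht fun x hx => ?_
    simp only [chosen]
    -- The coefficients c₉, c₁₁, c₁₂ are defined as square roots; for c₁₂ the radicand is
    -- nonnegative because a and c₂ are positive.
    rw [Real.sq_sqrt (by positivity), Real.sq_sqrt (by positivity), Real.sq_sqrt (by positivity),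
      hessTracelessSq_eq hn1.ne' _ hx, ← hessDot_self, chosenDensity, energyDensity, c10]
    simp only [gradSq]
    ring
  have hΦ1 : ∀ t, 0 < t → radR (shellEnergy L (chosen n p c2 c13) u) t
      = 1 / 2 * L.avg (chosenDensity₁ p c2 c13 u) t := fun t ht => by
    have ev : shellEnergy L (chosen n p c2 c13) u =ᶠ[𝓝 t]
        fun t => 1 / 2 * L.avg (chosenDensity p c2 c13 u) t := by
      filter_upwards [eventually_gt_nhds ht] with y hy using hΦ y hy
    rw [radR_congr ev, radR_const_mul, radR_avg ht (s0.of_le (by norm_num)),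
      avg_congr_of_ne_zero ht e1]
  have hΦ2 : radR (radR (shellEnergy L (chosen n p c2 c13) u)) r
      = 1 / 2 * L.avg (chosenDensity₂ p c2 c13 u) r := by
    have ev : radR (shellEnergy L (chosen n p c2 c13) u) =ᶠ[𝓝 r]
        fun t => 1 / 2 * L.avg (rad (chosenDensity p c2 c13 u)) t := by
      filter_upwards [eventually_gt_nhds hr] with y hy
      rw [hΦ1 y hy, avg_congr_of_ne_zero hy e1]
    rw [radR_congr ev, radR_const_mul, radR_avg hr s1, avg_congr_of_ne_zero hr e2]
  have hΥ : ∀ t, 0 < t → upsilonFunctional L p (chosen n p c2 c13) u t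
      = L.avg (chosenUpsilon p c2 u) t := fun t ht => by
    rw [upsilonFunctional]
    refine avg_congr_of_ne_zero ht fun x _ => ?_
    simp only [chosen, chosenUpsilon, upsilonDensity]
    ring
  have hΥ1 : radR (upsilonFunctional L p (chosen n p c2 c13) u) r
      = L.avg (chosenUpsilon₁ p c2 u) r := by
    have ev : upsilonFunctional L p (chosen n p c2 c13) u =ᶠ[𝓝 r] L.avg (chosenUpsilon p c2 u) := by
      filter_upwards [eventually_gt_nhds hr] with y hy using hΥ y hy
    rw [radR_congr ev, radR_avg hr t0, avg_congr_of_ne_zero hr f1]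
  have hM : sourceFunctional L p (chosen n p c2 c13) u r
      = -(1 / ((n : ℝ) - 1)) * L.avg (weakHam p (testFun p c2 u) u) r := by
    rw [sourceFunctional, ← avg_mul_hamOp hn hr hφ hu]
    congr 1
    refine avg_congr_of_ne_zero hr fun x _ => ?_
    simp only [chosen, testFun]
    ring
  have hm : ∀ {F G : E n → ℝ} (k : ℝ), ContinuousOn F {0}ᶜ → ContinuousOn G {0}ᶜ →
      ContinuousOn (fun x => F x + k * G x) {0}ᶜ := fun k hF hG => hF.add (continuousOn_const.mul hG)
  have k3 : ContinuousOn (weakHam p (testFun p c2 u) u) {0}ᶜ := continuousOn_weakHam hφ hu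
  have m1 := hm (3 * aH n p) k2 k1
  have m2 := hm (2 * aH n p ^ 2) m1 k0
  have m3 := hm (-(2 / ((n : ℝ) - 1))) m2 k3
  have m4 := hm (-2) m3 l1
  rw [dissipationForm_eq, avg_congr_of_ne_zero hr fun x hx => psiDensity_eq hn hp hc2 hu hx,
    avg_const_mul, avg_comb hr _ m4 l0, avg_comb hr _ m3 l1,
    avg_comb hr _ m2 k3, avg_comb hr _ m1 k0, avg_comb hr _ k2 k1,
    dissipation, chiFunctional, hΦ2, hΦ1 r hr, hΦ r hr, hM, hΥ1, hΥ r hr]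
  ring

end DissipationIdentity

/-! ### Locality, and reduction to functions that are smooth away from the origin. -/

section Cutoff

variable {n : ℕ} {f g u v : E n → ℝ} {x : E n} {r R p c2 c13 β : ℝ} {L : Localization n}

open Filter Topology

lemma lap_congr (h : f =ᶠ[𝓝 x] g) : lap f =ᶠ[𝓝 x] lap g := by
  have : ∀ᶠ y in 𝓝 x, ∀ i, pd i (pd i f) y = pd i (pd i g) y :=
    eventually_all.2 fun i => pd_congr i (pd_congr i h)
  filter_upwards [this] with y hy
  simp only [lap, hy]

lemma Localization.hamOp_congr (L : Localization n) (p : ℝ) (h : f =ᶠ[𝓝 x] g) :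
    L.hamOp p f x = L.hamOp p g x := by
  have h1 : (fun y => L.omegaSq p y * lap f y) =ᶠ[𝓝 x] fun y => L.omegaSq p y * lap g y := by
    filter_upwards [lap_congr h] with y hy
    rw [hy]
  have h2 : ∀ i j, (fun y => L.omegaSq p y * pd i (pd j f) y) =ᶠ[𝓝 x]
      fun y => L.omegaSq p y * pd i (pd j g) y := fun i j => by
    filter_upwards [pd_congr i (pd_congr j h)] with y hy
    rw [hy]
  rw [Localization.hamOp, Localization.hamOp, (lap_congr h1).self_of_nhds]
  simp only [fun i j => (pd_congr i (pd_congr j (h2 i j))).self_of_nhds]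

/-- `u` and `v` have the same germs at the points of `Λ` on the shell of radius `t`. -/
def GermEq (L : Localization n) (u v : E n → ℝ) (t : ℝ) : Prop :=
  ∀ ω : sphere (0 : E n) 1, 0 < L.rho ω → u =ᶠ[𝓝 (t • (ω : E n))] v

/-- Averages see only the points with ρ > 0, and equal germs there have equal derivatives of every
order. -/
lemma GermEq.shellEnergy_eq (h : GermEq L u v r) (k : ShellCoeffs) :
    shellEnergy L k u r = shellEnergy L k v r := by
  rw [shellEnergy, shellEnergy]
  congr 1
  refine avg_congr fun ω hω => ?_
  have h0 := h ω hω
  have h1 := rad_congr h0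
  have h5 : (fun y => rad u y + k.c5 * u y) =ᶠ[𝓝 (r • (ω : E n))]
      fun y => rad v y + k.c5 * v y := by
    filter_upwards [h0, h1] with y hy hy'
    rw [hy, hy']
  rw [(rad_congr h1).self_of_nhds, h1.self_of_nhds, h0.self_of_nhds,
    (angLap_congr h0).self_of_nhds, (gradSq_congr h5).self_of_nhds,
    (hessTracelessSq_congr h0).self_of_nhds, (gradSq_congr h0).self_of_nhds]

lemma GermEq.sourceFunctional_eq (h : GermEq L u v r) (p : ℝ) (k : ShellCoeffs) :
    sourceFunctional L p k u r = sourceFunctional L p k v r := by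
  rw [sourceFunctional, sourceFunctional]
  congr 1
  refine avg_congr fun ω hω => ?_
  have h0 := h ω hω
  have h1 := rad_congr h0
  rw [(rad_congr h1).self_of_nhds, h1.self_of_nhds, h0.self_of_nhds,
    (angLap_congr h0).self_of_nhds, L.hamOp_congr p h0]

lemma GermEq.upsilonFunctional_eq (h : GermEq L u v r) (p : ℝ) (k : ShellCoeffs) :
    upsilonFunctional L p k u r = upsilonFunctional L p k v r := by
  rw [upsilonFunctional, upsilonFunctional]
  refine avg_congr fun ω hω => ?_
  have h0 := harm_congr p (h ω hω)
  have h1 := rad_congr h0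
  rw [(gradDot_congr h0 h1).self_of_nhds, h1.self_of_nhds, h0.self_of_nhds,
    (angLap_congr h0).self_of_nhds, (gradSq_congr h0).self_of_nhds]

lemma GermEq.dissipationForm_eq (h : GermEq L u v r) (p c2 c13 β : ℝ) :
    dissipationForm L p c2 c13 β u r = dissipationForm L p c2 c13 β v r := by
  rw [dissipationForm, dissipationForm]
  refine avg_congr fun ω hω => ?_
  have h0 := h ω hω
  have w0 := harm_congr p h0
  have w1 := rad_congr w0
  simp only [psiTen, psiSca, psiBil, harmonicForm]
  rw [(hessTracelessSq_congr w0).self_of_nhds, (gradSq_congr w1).self_of_nhds,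
    (gradSq_congr w0).self_of_nhds, (rad_congr w1).self_of_nhds, (angLap_congr w0).self_of_nhds,
    w1.self_of_nhds, w0.self_of_nhds, (angLap_congr h0).self_of_nhds, h0.self_of_nhds,
    (hessSq_congr h0).self_of_nhds, (gradSq_congr h0).self_of_nhds]

/-- The functionals are differentiated in the radius, so agreement is required on all shells near
`r`, not only on one. -/
lemma dissipation_congr (h : ∀ᶠ t in 𝓝 r, GermEq L u v t) (p : ℝ) (k : ShellCoeffs) (β : ℝ) :
    dissipation L p k β u r = dissipation L p k β v r := by
  have e1 : shellEnergy L k u =ᶠ[𝓝 r] shellEnergy L k v := h.mono fun t ht => ht.shellEnergy_eq k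
  have e2 : upsilonFunctional L p k u =ᶠ[𝓝 r] upsilonFunctional L p k v :=
    h.mono fun t ht => ht.upsilonFunctional_eq p k
  have e3 : radR (shellEnergy L k u) =ᶠ[𝓝 r] radR (shellEnergy L k v) :=
    e1.eventuallyEq_nhds.mono fun t ht => radR_congr ht
  rw [dissipation, dissipation, chiFunctional, chiFunctional, radR_congr e3, radR_congr e1,
    e1.self_of_nhds, h.self_of_nhds.sourceFunctional_eq, radR_congr e2, e2.self_of_nhds]

/-- The radii stay away from 0, where x ↦ x/‖x‖ would be discontinuous. -/
lemma isClosed_shell (hR : 0 < R) (D : Set (E n)) :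
    IsClosed {x : E n | ‖x‖ ∈ Set.Icc R r ∧ ‖x‖⁻¹ • x ∈ closure D} := by
  have h1 : IsClosed {x : E n | ‖x‖ ∈ Set.Icc R r} := isClosed_Icc.preimage continuous_norm
  have h2 : ContinuousOn (fun x : E n => ‖x‖⁻¹ • x) {x : E n | ‖x‖ ∈ Set.Icc R r} :=
    (continuous_norm.continuousOn.inv₀ fun x hx => (hR.trans_le hx.1).ne').smul continuousOn_id
  exact h2.preimage_isClosed_of_isClosed h1 isClosed_closure

/-- A function that is `C^k` near a closed set agrees near it with a globally `C^k` function. -/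
lemma exists_contDiff_eventuallyEq {k : ℕ} {K : Set (E n)} (hK : IsClosed K)
    (hu : ∀ x ∈ K, ContDiffAt ℝ k u x) :
    ∃ v : E n → ℝ, ContDiff ℝ k v ∧ ∀ x ∈ K, u =ᶠ[𝓝 x] v := by
  have hU : IsOpen {x | ContDiffAt ℝ k u x} := by
    rw [isOpen_iff_mem_nhds]
    exact fun x hx => ContDiffAt.eventually hx (by simp)
  -- Two nested neighbourhoods of K: the cutoff vanishes outside V, whose closure lies where `u` is
  -- C^k, and it equals 1 on W, a neighbourhood of K.
  obtain ⟨V, hV, hKV, hVU⟩ := normal_exists_closure_subset hK hU hu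
  obtain ⟨W, hW, hKW, hWV⟩ := normal_exists_closure_subset hK hV hKV
  obtain ⟨χ, hχ0, hχ1, -⟩ := exists_contMDiffMap_zero_one_of_isClosed (modelWithCornersSelf ℝ (E n))
    (n := k) hV.isClosed_compl isClosed_closure (Set.disjoint_left.2 fun x hx hx' => hx (hWV hx'))
  have hχ : ContDiff ℝ k χ := χ.contMDiff.contDiff
  refine ⟨fun x => χ x * u x, contDiff_iff_contDiffAt.2 fun x => ?_, fun x hx => ?_⟩
  · by_cases hx : x ∈ closure V
    · exact hχ.contDiffAt.mul (hVU hx)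
    · have ev : (fun x => χ x * u x) =ᶠ[𝓝 x] fun _ => 0 := by
        filter_upwards [isClosed_closure.isOpen_compl.mem_nhds hx] with y hy
        rw [hχ0 (fun h => hy (subset_closure h)), Pi.zero_apply, zero_mul]
      exact contDiffAt_const.congr_of_eventuallyEq ev
  · filter_upwards [hW.mem_nhds (hKW hx)] with y hy
    rw [hχ1 (subset_closure hy), Pi.one_apply, one_mul]

/-- Both sides depend only on the germs of `u` over Λ near radius `r`, so `u` may be replaced by a
globally C⁴ function. Regularity up to the closure of Λ makes the set on which to cut off closed. -/
theorem dissipation_eq_dissipationForm (hn : 3 ≤ n) (hp : p < (n : ℝ) - 2) (hc2 : 0 < c2)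
    (hR : 0 < R)
    (hu : ∀ x : E n, R < ‖x‖ → ‖x‖⁻¹ • x ∈ closure L.dom → ContDiffAt ℝ 4 u x) (hr : R < r) :
    dissipation L p (chosen n p c2 c13) β u r = dissipationForm L p c2 c13 β u r := by
  have hm1 : R < (R + r) / 2 := by linarith
  have hm2 : (R + r) / 2 < r := by linarith
  -- The radii from (R + r)/2 to r + 1 contain a neighbourhood of `r` and stay strictly above `R`.
  obtain ⟨v, hv, huv⟩ := exists_contDiff_eventuallyEq (k := 4) (u := u)
    (isClosed_shell (R := (R + r) / 2) (r := r + 1) (hR.trans hm1) L.dom)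
    fun x hx => hu x (hm1.trans_le hx.1.1) hx.2
  have hg : ∀ᶠ t in 𝓝 r, GermEq L u v t := by
    filter_upwards [Ioo_mem_nhds hm2 (lt_add_one r)] with t ht ω hω
    have ht0 : 0 < t := (hR.trans hm1).trans ht.1
    refine huv _ ⟨?_, ?_⟩
    · rw [norm_smul_sphere ht0]; exact ⟨ht.1.le, ht.2.le⟩
    · rw [normalize_smul_sphere ht0]; exact subset_closure ⟨by simp, hω⟩
  rw [dissipation_congr hg, hg.self_of_nhds.dissipationForm_eq,
    dissipation_eq_of_contDiffOn hn hp hc2 (hR.trans hr) hv.contDiffOn]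

end Cutoff

end LocHam

end

theorem mainTheorem12 (n : ℕ) (hn : 3 ≤ n) (p : ℝ) (hp0 : 0 < p) (hp : p < (n : ℝ) - 2) :
    -- the conditions on the constants hold for `c2` large and then `c13` large
    (∃ c2₀ : ℝ, ∀ c2 ≥ c2₀, ∃ c13₀ : ℝ, ∀ c13 ≥ c13₀, LocHam.Admissible n p c2 c13) ∧
    -- and for a concrete choice
    (0 < LocHam.cH n p → ∀ c13 : ℝ,
      c13 ^ 2 = LocHam.c13sqChoice n p (LocHam.c2Choice n p) →
      LocHam.Admissible n p (LocHam.c2Choice n p) c13) ∧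
    ∀ c2 c13 : ℝ, LocHam.Admissible n p c2 c13 →
      -- the dissipation functional is the integral of an explicit quadratic form
      (∀ (L : LocHam.Localization n) (R : ℝ), 0 < R → ∀ u : LocHam.E n → ℝ,
        (∀ x : LocHam.E n, R < ‖x‖ → ‖x‖⁻¹ • x ∈ closure L.dom → ContDiffAt ℝ 4 u x) →
        ∀ β ∈ ({LocHam.aH n p, 2 * LocHam.aH n p} : Set ℝ), ∀ r : ℝ, R < r →
          LocHam.dissipation L p (LocHam.chosen n p c2 c13) β u r
            = LocHam.dissipationForm L p c2 c13 β u r) ∧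
      -- partial coercivity, with constants independent of the localization function
      (∃ c > 0, ∃ δ > 0, ∀ (L : LocHam.Localization n) (R : ℝ), 0 < R → ∀ u : LocHam.E n → ℝ,
        ContDiffOn ℝ 3 u (L.cone R) → ∀ r : ℝ, R < r → LocHam.FiniteShellNorm L u r →
        ∀ β ∈ ({LocHam.aH n p, 2 * LocHam.aH n p} : Set ℝ),
          δ * (LocHam.shellNormSq L (LocHam.rad u) r + LocHam.shellNormSq L u r)
            ≤ c * LocHam.dissipationForm L p c2 c13 β u r + L.avg (fun x => u x ^ 2) r) ∧
      -- coercivity of the localized dissipation under smallness conditions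
      (∃ C > 0, ∃ ε > 0, ∃ δ > 0, ∀ (L : LocHam.Localization n) (R : ℝ), 0 < R →
        (LocHam.poincareConst L (fun v x => LocHam.angLap v x ^ 2) < ENNReal.ofReal ε ∨
          LocHam.poincareConst L (fun v x => LocHam.angLap v x ^ 2 + LocHam.gradSq v x)
            < ENNReal.ofReal ε) →
        ∀ ν : LocHam.E n → ℝ, LocHam.IsNormalizedKernel L p ν →
        ∀ g > 0, ∀ κ : ℝ,
        (∀ u : LocHam.E n → ℝ, ContDiffOn ℝ 3 u (L.cone R) → ∀ r : ℝ, R < r →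
          LocHam.FiniteShellNorm L u r →
          LocHam.fluctOp L p ν u r ^ 2
            ≤ κ ^ 2 * (LocHam.shellNormSq L (LocHam.rad u) r + LocHam.shellNormSq L u r)) →
        g * κ ^ 2 < ε →
        ∀ u : LocHam.E n → ℝ, ContDiffOn ℝ 3 u (L.cone R) → ∀ r : ℝ, R < r →
          LocHam.FiniteShellNorm L u r →
          ∀ β ∈ ({LocHam.aH n p, 2 * LocHam.aH n p} : Set ℝ),
            δ * (LocHam.shellNormSq L (LocHam.rad u) r + LocHam.shellNormSq L u r)
              ≤ C * LocHam.dissipationForm L p c2 c13 β u r + L.avg u r ^ 2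
                - g * LocHam.fluctOp L p ν u r ^ 2) :=
  ⟨LocHam.exists_admissible hn hp, fun hc _ h => LocHam.choice_admissible hn hp hc h,
    fun _ _ hA => ⟨fun _ _ hR _ hu _ _ _ hr =>
        LocHam.dissipation_eq_dissipationForm hn hp hA.1 hR hu hr,
      LocHam.exists_coercive hn hp hA, LocHam.exists_coercive_of_small hn hp hA⟩⟩
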